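/- **Conventions.** Let $R$ be a domain with quotient field $L$, let $Z$ be an indeterminate over $L$, and let $I\neq 0$ be an ideal of $R$. For a quasilocal ring $S$, $M(S)$ is its maximal ideal; $S$ dominates a quasilocal subring $T$ if $M(T)=T\cap M(S)$. Call $I$ *complete* if $I=\bigcap_V (R\cap I(V))$, where $V$ runs over all valuation rings with quotient field $L$ and $R\subset V$, and each $I(V)$ is some ideal of $V$; call $I$ *normal* if all powers $I^n$ ($n\ge 1$) are complete. For a subring $A$ of $L$ let $\mathfrak V(A)=\{A_P: P\in\operatorname{spec} A\}$. Put $\mathfrak W(R,I)=\bigcup_{0\ne x\in I}\mathfrak V(R[Ix^{-1}])$, where $Ix^{-1}=\{y/x:y\in I\}$. For a set $U$ of quasilocal domains with quotient field $L$, let $U^{\mathfrak N}$ be the set of all rings which, for some $T\in U$, belong to $\mathfrak V(\overline T)$ and dominate $T$, where $\overline T$ is the integral closure of $T$ in $L$. Let $\mathfrak D(R,I,I)=U^{\mathfrak N}$, where $U$ is the set of all one-dimensional $T\in\mathfrak W(R,I)$ with $I\subset M(T)$. Let $E=R[IZ]\subset L(Z)$ be the Rees ring. Let $R$ be noetherian.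 For the valuation ring $V\supset R$ of a valuation $v$ of $L$ (also written $V(\cdot)$) put $V(I)=\min\{v(y): y\in I\}$; the *$(R,I)$-extension* of $V$ to $L(Z)$ is the valuation ring $W$ of the valuation $w$ of $L(Z)$ with $w(\sum_n f_nZ^n)=\min\{v(f_n)-nV(I): f_n\ne0\}$ for all nonzero $\sum_n f_nZ^n\in L[Z]$. For an ideal $J$, $\operatorname{nvspec}_S J$ is the set of minimal primes of $J$ in $S$. A decomposition into primary ideals is *irredundant* if it is finite, the radicals of the components are distinct and no component can be omitted. **Lemma.** Let $R$ be a normal noetherian domain and let $I$ be a nonzero nonunit normal ideal of $R$. Then $E$ is a normal noetherian domain, $\mathfrak W(R,I)^{\mathfrak N}=\mathfrak W(R,I)$, and $\mathfrak D(R,I,I)$ is a nonempty finite set of DVRs with quotient field $L$. Let $V_1,\dots,V_h$ be its distinct members and $W_1,\dots,W_h$ their respective $(R,I)$-extensions. Then $W_1,\dots,W_h$ are distinct DVRs with $E\subset W_j$ for all $j$. Put $P^*_j=E\cap M(W_j)$, $\overline P^*_j=E\cap IW_j$ and $J_j=R\cap IV_j$. Then $P^*_1,\dots,P^*_h$ are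 all the distinct members of $\operatorname{nvspec}_E(IE)$; for each $j$, $\operatorname{ht}_E P^*_j=1$, $E_{P^*_j}=W_j$ and $\overline P^*_j$ is $P^*_j$-primary; $IE=\overline P^*_1\cap\dots\cap\overline P^*_h$ is the unique irredundant primary decomposition of $IE$ in $E$; and $I=J_1\cap\dots\cap J_h$ with $J_j=R\cap\overline P^*_j$ for each $j$. Now let $0\ne x\in I$ be such that $V_j(x)=V_j(I)$ for all $j$ in a nonempty subset $\Lambda$ of $\{1,\dots,h\}$, and put $Y=xZ$, $A=R[Ix^{-1}]$, $B=A[Y,Y^{-1}]$. Then $A$ and $B$ are normal noetherian domains, with $A\subset V_j$ and $E\subset B\subset W_j$ for all $j\in\Lambda$. For $j\in\Lambda$ put $P_j=A\cap M(V_j)$, $\overline P_j=A\cap IV_j$, $Q_j=B\cap M(W_j)$, $\overline Q_j=B\cap IW_j$. For $j\ne j'$ in $\Lambda$ we have $P_j\ne P_{j'}$, $\overline P_j\neq\overline P_{j'}$, $Q_j\ne Q_{j'}$, $\overline Q_j\ne\overline Q_{j'}$. For all $j\in\Lambda$: $$xA=IA\subset P_j\in\operatorname{nvspec}_A(IA),\qquad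 xB=IB\subset Q_j\in\operatorname{nvspec}_B(IB);$$ $\operatorname{ht}_AP_j=1$, $A_{P_j}=V_j$ and $\overline P_j$ is $P_j$-primary; $\operatorname{ht}_BQ_j=1$, $B_{Q_j}=W_j$ and $\overline Q_j$ is $Q_j$-primary; $$P_jB=Q_j=P^*_jB,\quad P_j=A\cap Q_j,\quad P^*_j=E\cap Q_j,$$ $$\overline P_jB=\overline Q_j=\overline P^*_jB,\quad \overline P_j=A\cap\overline Q_j,\quad \overline P^*_j=E\cap\overline Q_j.$$ Finally, if $V_l(x)\ne V_l(I)$ for all $l\in\{1,\dots,h\}\setminus\Lambda$, then $IA=\bigcap_{j\in\Lambda}\overline P_j$ and $IB=\bigcap_{j\in\Lambda}\overline Q_j$ are the unique irredundant primary decompositions of $IA$ in $A$ and of $IB$ in $B$, and $\operatorname{nvspec}_A(IA)=\{P_j:j\in\Lambda\}$, $\operatorname{nvspec}_B(IB)=\{Q_j:j\in\Lambda\}$. -/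

import Mathlib

open IsLocalRing

namespace Dicritical

noncomputable section

section GaussExtension

open Polynomial

variable {L Γ : Type*} [Field L] [LinearOrderedCommGroupWithZero Γ]

/-- The value of `f = ∑ f_n Z^n` under the extension of `v` for which `Z` has value `γ`: in
multiplicative notation, the maximum of `v (f_n) * γ ^ n` over the `n` with `f_n ≠ 0`. -/
def gaussValue (v : Valuation L Γ) (γ : Γˣ) (f : L[X]) : Γ :=
  f.support.sup fun n => v (f.coeff n) * (γ : Γ) ^ n

theorem le_gaussValue (v : Valuation L Γ) (γ : Γˣ) (f : L[X]) (n : ℕ) :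
    v (f.coeff n) * (γ : Γ) ^ n ≤ gaussValue v γ f := by
  by_cases hn : n ∈ f.support
  · exact Finset.le_sup (f := fun n => v (f.coeff n) * (γ : Γ) ^ n) hn
  · rw [notMem_support_iff.1 hn]
    simp

theorem gaussValue_le (v : Valuation L Γ) (γ : Γˣ) (f : L[X]) (g : Γ)
    (h : ∀ n, v (f.coeff n) * (γ : Γ) ^ n ≤ g) : gaussValue v γ f ≤ g :=
  Finset.sup_le fun n _ => h n

theorem gaussValue_zero (v : Valuation L Γ) (γ : Γˣ) : gaussValue v γ 0 = 0 := by
  apply le_antisymm _ zero_le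
  exact gaussValue_le _ _ _ _ (by simp)

theorem gaussValue_ne_zero (v : Valuation L Γ) (γ : Γˣ) {f : L[X]} (hf : f ≠ 0) :
    gaussValue v γ f ≠ 0 := by
  intro h
  have h1 := le_gaussValue v γ f f.natDegree
  rw [h, le_zero_iff, mul_eq_zero] at h1
  rcases h1 with h1 | h1
  · exact hf (leadingCoeff_eq_zero.1 ((Valuation.zero_iff v).1 h1))
  · exact pow_ne_zero _ γ.ne_zero h1

/-- There is a least index at which the maximum is attained. -/
theorem exists_min_gaussValue (v : Valuation L Γ) (γ : Γˣ) {f : L[X]} (hf : f ≠ 0) :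
    ∃ i, v (f.coeff i) * (γ : Γ) ^ i = gaussValue v γ f ∧
      ∀ k < i, v (f.coeff k) * (γ : Γ) ^ k < gaussValue v γ f := by
  classical
  have hex : ∃ i, v (f.coeff i) * (γ : Γ) ^ i = gaussValue v γ f := by
    obtain ⟨i, _, hi⟩ := Finset.exists_mem_eq_sup f.support (support_nonempty.2 hf)
      fun n => v (f.coeff n) * (γ : Γ) ^ n
    exact ⟨i, hi.symm⟩
  exact ⟨Nat.find hex, Nat.find_spec hex, fun k hk =>
    lt_of_le_of_ne (le_gaussValue v γ f k) (Nat.find_min hex hk)⟩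

theorem gaussValue_mul (v : Valuation L Γ) (γ : Γˣ) (f g : L[X]) :
    gaussValue v γ (f * g) = gaussValue v γ f * gaussValue v γ g := by
  classical
  by_cases hf : f = 0
  · simp [hf, gaussValue_zero]
  by_cases hg : g = 0
  · simp [hg, gaussValue_zero]
  have term : ∀ p : ℕ × ℕ, ∀ n, p.1 + p.2 = n →
      v (f.coeff p.1 * g.coeff p.2) * (γ : Γ) ^ n =
        (v (f.coeff p.1) * (γ : Γ) ^ p.1) * (v (g.coeff p.2) * (γ : Γ) ^ p.2) := by
    intro p n hp
    rw [← hp, map_mul, pow_add]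
    exact mul_mul_mul_comm _ _ _ _
  have hpow : ∀ n : ℕ, (0 : Γ) < (γ : Γ) ^ n := fun n => pow_pos (zero_lt_iff.2 γ.ne_zero) n
  apply le_antisymm
  · refine gaussValue_le _ _ _ _ fun n => ?_
    rw [coeff_mul, ← le_div_iff₀ (hpow n)]
    refine Valuation.map_sum_le v fun p hp => ?_
    rw [le_div_iff₀ (hpow n), term p n (Finset.HasAntidiagonal.mem_antidiagonal.1 hp)]
    exact mul_le_mul' (le_gaussValue v γ f _) (le_gaussValue v γ g _)
  · obtain ⟨i, hi, hi'⟩ := exists_min_gaussValue v γ hf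
    obtain ⟨j, hj, hj'⟩ := exists_min_gaussValue v γ hg
    have hfp : 0 < gaussValue v γ f := zero_lt_iff.2 (gaussValue_ne_zero v γ hf)
    have hgp : 0 < gaussValue v γ g := zero_lt_iff.2 (gaussValue_ne_zero v γ hg)
    refine le_trans (le_of_eq ?_) (le_gaussValue v γ (f * g) (i + j))
    have key : v ((f * g).coeff (i + j)) = v (f.coeff i * g.coeff j) := by
      rw [coeff_mul]
      refine Valuation.map_sum_eq_of_lt v (j := (i, j)) (by simp) ?_
      · intro p hp
        simp only [Finset.mem_sdiff, Finset.HasAntidiagonal.mem_antidiagonal, Finset.mem_singleton] at hp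
        refine lt_of_mul_lt_mul_right (a := (γ : Γ) ^ (i + j)) ?_ (hpow _).le
        rw [term p (i + j) hp.1, term (i, j) (i + j) rfl, hi, hj]
        rcases lt_trichotomy p.1 i with h | h | h
        · exact mul_lt_mul_of_lt_of_le_of_nonneg_of_pos (hi' _ h) (le_gaussValue v γ g _)
            zero_le hgp
        · exact absurd (Prod.ext h (by simp only []; omega)) hp.2
        · have h2 : p.2 < j := by omega
          exact lt_of_le_of_lt (mul_le_mul_left (le_gaussValue v γ f _) _)
            (mul_lt_mul_of_pos_left (hj' _ h2) hfp)
    rw [key, term (i, j) (i + j) rfl, hi, hj]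

/-- The Gauss valuation on `L[Z]` extending `v` and giving `Z` the value `γ`. -/
def gaussValuation (v : Valuation L Γ) (γ : Γˣ) : Valuation L[X] Γ where
  toFun := gaussValue v γ
  map_zero' := gaussValue_zero v γ
  map_one' := by
    apply le_antisymm
    · refine gaussValue_le _ _ _ _ fun n => ?_
      by_cases hn : n = 0
      · simp [hn]
      · simp [coeff_one, hn]
    · simpa using le_gaussValue v γ 1 0
  map_mul' := gaussValue_mul v γ
  map_add_le_max' := fun f g => by
    refine gaussValue_le _ _ _ _ fun n => ?_
    have hpow : (0 : Γ) < (γ : Γ) ^ n := pow_pos (zero_lt_iff.2 γ.ne_zero) n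
    rw [coeff_add, ← le_div_iff₀ hpow]
    refine Valuation.map_add_le v ?_ ?_
    · rw [le_div_iff₀ hpow]
      exact le_max_of_le_left (le_gaussValue v γ f n)
    · rw [le_div_iff₀ hpow]
      exact le_max_of_le_right (le_gaussValue v γ g n)

theorem nonZeroDivisors_le_supp_primeCompl (v : Valuation L Γ) (γ : Γˣ) :
    nonZeroDivisors L[X] ≤ (gaussValuation v γ).supp.primeCompl := by
  intro f hf h
  exact gaussValue_ne_zero v γ (nonZeroDivisors.ne_zero hf)
    ((Valuation.mem_supp_iff (gaussValuation v γ) f).1 h)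

/-- The Gauss valuation on the rational function field `L(Z)`. -/
def ratFuncValuation (v : Valuation L Γ) (γ : Γˣ) : Valuation (RatFunc L) Γ :=
  (gaussValuation v γ).extendToLocalization (nonZeroDivisors_le_supp_primeCompl v γ) (RatFunc L)

end GaussExtension

section Ideals

variable {R K σ : Type*} [CommRing R] [Field K] [Algebra R K] [SetLike σ K] [SubringClass σ K]

/-- The extension `I S` of an ideal `I` of `R` to a subring `S` of `K` containing (the image of)
`R`: the ideal of `S` generated by the image of `I`. -/
def extendIdeal (I : Ideal R) (S : σ) : Ideal S :=
  Ideal.span {s : S | ∃ a ∈ I, algebraMap R K a = (s : K)}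

/-- The contraction `R ∩ N` of an ideal `N` of a subring `S` of `K` containing (the image of)
`R`. -/
def contractIdeal {S : σ} (h : ∀ r : R, algebraMap R K r ∈ S) (N : Ideal S) : Ideal R :=
  N.comap ((algebraMap R K).codRestrict S h)

end Ideals

/-- The finite family `q` is an irredundant primary decomposition of `J` (finite intersection of
primary ideals with distinct radicals, none of which can be omitted), with distinct members, and it
is the only such decomposition of `J`. -/
def IsUniqueIrredundantPrimaryDecomposition {S ι : Type*} [CommRing S] [Fintype ι]
    (J : Ideal S) (q : ι → Ideal S) : Prop :=
  letI : DecidableEq (Ideal S) := Classical.decEq _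
  Function.Injective q ∧
    Submodule.IsMinimalPrimaryDecomposition J (Finset.univ.image q) ∧
    ∀ t : Finset (Ideal S), Submodule.IsMinimalPrimaryDecomposition J t → t = Finset.univ.image q

section Models

variable {K : Type*} [Field K]

/-- `𝔙(A)`: the set of the localizations `A_P` at the prime ideals `P` of `A`, as local subrings
of a field containing `A`. -/
def modelicSpec (A : Subring K) : Set (LocalSubring K) :=
  {T | ∃ (P : Ideal A) (_ : P.IsPrime), T = LocalSubring.ofPrime A P}

/-- `U^𝔑`, for a set `U` of local domains with quotient field `K`: the local rings `S` of the
integral closures in `K` of the members `T` of `U` such that `S` dominates `T`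
(`T ≤ S` in `LocalSubring K` means that `S` dominates `T`). -/
def normalization (U : Set (LocalSubring K)) : Set (LocalSubring K) :=
  {S | ∃ T ∈ U, S ∈ modelicSpec (integralClosure T.toSubring K).toSubring ∧ T ≤ S}

end Models

section Blowup

variable {R : Type*} [CommRing R] (L : Type*) [Field L] [Algebra R L]

/-- The affine chart `R[I x⁻¹]` of the blowup, inside the quotient field `L` of `R`. -/
def chart (I : Ideal R) (x : R) : Subring L :=
  (Algebra.adjoin R {z : L | ∃ y ∈ I, z = algebraMap R L y / algebraMap R L x}).toSubring

/-- `𝔚(R, J)`: the modelic blowup, the union of `𝔙(R[J x⁻¹])` over `0 ≠ x ∈ J`. -/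
def blowup (J : Ideal R) : Set (LocalSubring L) :=
  {T | ∃ x ∈ J, x ≠ 0 ∧ T ∈ modelicSpec (chart L J x)}

/-- `𝔚(R, J, M)^Δ_i`: the `i`-dimensional members of the blowup whose maximal ideal
contains `M`. -/
def blowupOver (J M : Ideal R) (i : ℕ) : Set (LocalSubring L) :=
  {T | T ∈ blowup L J ∧ ringKrullDim T.toSubring = i ∧
    ∀ m ∈ M, ∃ t ∈ maximalIdeal T.toSubring, (t : L) = algebraMap R L m}

/-- `𝔇(R, J, M)`: the dicritical set of `(J, M)` in `R`. -/
def dicriticalSet (J M : Ideal R) : Set (LocalSubring L) :=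
  normalization (blowupOver L J M 1)

/-- `J` is complete: it is the intersection, over all valuation rings `V` of `L` containing `R`, of
`R ∩ N_V` for some ideal `N_V` of `V`. -/
def IsCompleteIdeal (J : Ideal R) : Prop :=
  ∃ N : ∀ V : ValuationSubring L, Ideal V, ∀ a : R,
    a ∈ J ↔ ∀ V : ValuationSubring L, (∀ r : R, algebraMap R L r ∈ V) →
      ∃ n ∈ N V, (n : L) = algebraMap R L a

/-- `J` is normal: all its positive powers are complete. -/
def IsNormalIdeal (J : Ideal R) : Prop :=
  ∀ n : ℕ, 0 < n → IsCompleteIdeal L (J ^ n)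

/-- The Rees ring `E = R[IZ]` inside `L(Z)`. -/
def reesRing (I : Ideal R) : Subring (RatFunc L) :=
  (reesAlgebra I).toSubring.map
    ((algebraMap (Polynomial L) (RatFunc L)).comp (Polynomial.mapRingHom (algebraMap R L)))

/-- The element `Y = xZ` of `L(Z)`. -/
def chartVariable (x : R) : RatFunc L :=
  algebraMap L (RatFunc L) (algebraMap R L x) * RatFunc.X

variable {L}

/-- `B = A[Y, Y⁻¹]` inside `L(Z)`, for a subring `A` of `L` and `Y` in `L(Z)`. -/
def laurentRing (A : Subring L) (Y : RatFunc L) : Subring (RatFunc L) :=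
  A.map (algebraMap L (RatFunc L)) ⊔ Subring.closure {Y, Y⁻¹}

open Classical in
/-- The value `V(I)`. Mathlib writes valuations multiplicatively with reversed order, so this is the
greatest element of `v(I)`; it exists if `R ⊆ V` and `I` is finitely generated. -/
def idealValue (V : ValuationSubring L) (I : Ideal R) : V.ValueGroup :=
  if h : ∃ g, IsGreatest ((fun a : R => V.valuation (algebraMap R L a)) '' (I : Set R)) g then
    h.choose
  else 0

/-- The value of `Z` under the `(R, I)`-extension: the inverse of `V(I)` (in additive notation
`-V(I)`); the value `1` is never used for nonzero `I` and noetherian `R ⊆ V`. -/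
def slope (V : ValuationSubring L) (I : Ideal R) : (V.ValueGroup)ˣ :=
  (if h : idealValue V I = 0 then 1 else Units.mk0 _ h)⁻¹

/-- The `(R, I)`-extension `W` of `V` to `L(Z)`: the valuation ring of the valuation that sends
`∑ f_n Z^n` to the minimum (in additive notation) of `v(f_n) - n V(I)`. -/
def reesExtension (V : ValuationSubring L) (I : Ideal R) : ValuationSubring (RatFunc L) :=
  (ratFuncValuation V.valuation (slope V I)).valuationSubring

end Blowup

end

end Dicritical

open Dicritical

/-!
Throughout, `E = R[IZ]` is the Rees ring, `A = R[Ix⁻¹]` a chart of the blowup, `Y = xZ` and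
`B = A[Y, Y⁻¹]`; `W` denotes the `(R, I)`-extension of a valuation ring `V ⊇ R` of `L`.

*Normality.* Since all powers of `I` are complete, a polynomial `∑ f_n Z^n` over `L` is in `E` as
soon as `V(f_n) ≥ n V(I)` (additively) for all `n` and all `V ⊇ R`. So `E` is the intersection of
`L[Z]` with all the rings `W`, and is integrally closed (`mem_reesRing_of_isIntegral`). As
`B = E[Y⁻¹]` and `A = B ∩ L`, the rings `B` and `A` are normal as well. In particular the local
rings of the blowup are normal, so that normalizing has no effect, and the dicritical set consists
of the discrete valuation rings that are the localizations of charts at height-one primes over `I`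
(`IsDicritical`).

*From `V` to `W`.* Let `V = A_P` be in the dicritical set. Then `V(x) = V(I)`, so `Y` has value zero
under `W`, and clearing the coefficients of numerator and denominator shows that `W` is the
localization of `B`, and therefore of `E`, at its centre. The same computation moves `V` from one
chart to another with `V(x) = V(I)`. All these centres have height one, since `W` and `V` are
discrete valuation rings, and a centre determines the valuation ring.

*The associated primes of `IE`.* Let `P = (IE : f)` be prime. If `P` contained `IZ`, the equality
`(I^(n+2) : I) = I^(n+1)`, valid for a normal ideal, would give `f ∈ IE`; so `P` omits `xZ` for some
`x ∈ I`. Then `IE` is generated by `x` locally at `P`, and `E_P` is a noetherian normal local domain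
whose maximal ideal is the conductor of a principal ideal, that is, a discrete valuation ring
(`exists_isLocalizationAtCenter`). On homogeneous elements `P` is the conductor of one homogeneous
component of `f`, so the centre of `E_P` on `A` is a conductor of `xA`; hence its localization `V`
is a discrete valuation ring in the dicritical set, and `E_P` is its extension
(`exists_isDicritical_of_conductor`). Every element outside `IE` has a conductor contained in such a
prime, and this yields `IE = ⋂ (E ∩ IW_j)`, as well as the existence of a dicritical valuation ring;
finiteness follows since the centres are minimal primes of `IE`.

*Decompositions.* The ideals `E ∩ IW_j` are primary with radicals the centres of the `W_j`, and
these are pairwise incomparable, which makes the decomposition irredundant and unique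
(`isUniqueIrredundantPrimaryDecomposition_iInf`). For the charts, `Y` is a unit of `W_j` when
`V_j(x) = V_j(I)` and lies in its maximal ideal otherwise; so multiplying an element of
`⋂_{j ∈ Λ} (B ∩ IW_j)` by a high power of `Y` puts it in `IE`, and `x⁻¹ IE ⊆ B`.
-/

namespace Dicritical

/-! ### Centres of valuation rings -/

theorem eq_of_le_of_height_eq_one {S : Type*} [CommRing S] [IsDomain S] {P Q : Ideal S}
    [P.IsPrime] [Q.IsPrime] (hP : P ≠ ⊥) (hQ : Q.height = 1) (h : P ≤ Q) : P = Q := by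
  by_contra hne
  have h1 := Ideal.height_add_one_le_of_lt_of_isPrime (lt_of_le_of_ne h hne)
  rw [hQ] at h1
  have h2 : P.height = 0 := by
    have : P.height + 1 ≤ 0 + 1 := by simpa using h1
    simpa using (ENat.add_le_add_iff_right ENat.one_ne_top).1 this
  exact hP (Ideal.height_eq_zero_iff_eq_bot.1 h2)

section Centers

variable {R K : Type*} [CommRing R] [Field K] [Algebra R K]

theorem mem_contractIdeal_maximalIdeal (W : ValuationSubring K) (h : ∀ r : R, algebraMap R K r ∈ W)
    (r : R) : r ∈ contractIdeal h (maximalIdeal W) ↔ W.valuation (algebraMap R K r) < 1 :=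
  ValuationSubring.valuation_lt_one_iff W ⟨_, h r⟩

/-- If `S` contains all `y / x` with `y ∈ I`, then `IS = xS`. -/
theorem mem_extendIdeal_iff_div_mem {σ : Type*} [SetLike σ K] [SubringClass σ K] (I : Ideal R)
    (S : σ) {x : R} (hx : x ∈ I) (hxS : algebraMap R K x ∈ S) (hx0 : algebraMap R K x ≠ 0)
    (h : ∀ y ∈ I, algebraMap R K y / algebraMap R K x ∈ S) (z : S) :
    z ∈ extendIdeal I S ↔ (z : K) / algebraMap R K x ∈ S := by
  have key : extendIdeal I S = Ideal.span {(⟨algebraMap R K x, hxS⟩ : S)} := by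
    apply le_antisymm
    · refine Ideal.span_le.2 ?_
      rintro s ⟨a, ha, has⟩
      refine Ideal.mem_span_singleton'.2 ⟨⟨_, h a ha⟩, Subtype.ext ?_⟩
      simp only [MulMemClass.coe_mul]
      rw [div_mul_cancel₀ _ hx0, has]
    · exact Ideal.span_mono (by rintro _ rfl; exact ⟨x, hx, rfl⟩)
  rw [key, Ideal.mem_span_singleton']
  constructor
  · rintro ⟨a, rfl⟩
    simp only [MulMemClass.coe_mul]
    rw [mul_div_cancel_right₀ _ hx0]
    exact a.2
  · intro hz
    exact ⟨⟨_, hz⟩, Subtype.ext (by simp only [MulMemClass.coe_mul]; rw [div_mul_cancel₀ _ hx0])⟩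

theorem isFractionRing_of_forall_exists_div (S : Subring K)
    (h : ∀ z : K, ∃ a ∈ S, ∃ b ∈ S, b ≠ 0 ∧ z = a / b) : IsFractionRing S K := by
  refine IsFractionRing.of_field S K fun z => ?_
  obtain ⟨a, ha, b, hb, -, rfl⟩ := h z
  exact ⟨⟨a, ha⟩, ⟨b, hb⟩, rfl⟩

/-- The valuation ring `W` is the localization of the subring `S` at the centre of `W`. -/
structure IsLocalizationAtCenter (S : Subring K) (W : ValuationSubring K) : Prop where
  le : S ≤ W.toSubring
  exists_mul_eq : ∀ z ∈ W, ∃ a ∈ S, ∃ s ∈ S, W.valuation s = 1 ∧ z * s = a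

namespace IsLocalizationAtCenter

variable {S : Subring K} {W : ValuationSubring K}

/-- The centre of `W` on `S`. -/
abbrev center (h : IsLocalizationAtCenter S W) : Ideal S :=
  contractIdeal (fun a : S => h.le a.2) (maximalIdeal W)

theorem mem_center (h : IsLocalizationAtCenter S W) (a : S) :
    a ∈ h.center ↔ W.valuation (a : K) < 1 :=
  mem_contractIdeal_maximalIdeal W _ a

instance (h : IsLocalizationAtCenter S W) : h.center.IsPrime := by
  unfold center contractIdeal
  infer_instance

theorem valuation_eq_one (h : IsLocalizationAtCenter S W) {a : S} (ha : a ∉ h.center) :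
    W.valuation (a : K) = 1 := by
  rw [h.mem_center, not_lt] at ha
  exact le_antisymm ((W.valuation_le_one_iff _).2 (h.le a.2)) ha

theorem mem_ofPrime_iff (S : Subring K) (P : Ideal S) [P.IsPrime] (z : K) :
    z ∈ (LocalSubring.ofPrime S P).toSubring ↔ ∃ a s : S, s ∉ P ∧ z * s = a := by
  constructor
  · intro hz
    obtain ⟨⟨a, s⟩, has⟩ := IsLocalization.surj P.primeCompl
      (⟨z, hz⟩ : (LocalSubring.ofPrime S P).toSubring)
    exact ⟨a, s, s.2, congrArg Subtype.val has⟩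
  · rintro ⟨a, s, hs, h⟩
    have hs0 : (s : K) ≠ 0 := by
      intro h0
      have : s = 0 := Subtype.ext h0
      exact hs (this ▸ P.zero_mem)
    have := IsLocalization.mk'_spec (LocalSubring.ofPrime S P).toSubring a
      (⟨s, hs⟩ : P.primeCompl)
    have h2 := congrArg Subtype.val this
    have h3 : z = ((IsLocalization.mk' (LocalSubring.ofPrime S P).toSubring a
      (⟨s, hs⟩ : P.primeCompl) : (LocalSubring.ofPrime S P).toSubring) : K) := by
      apply mul_right_cancel₀ hs0
      rw [h]
      exact h2.symm
    rw [h3]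
    exact Subtype.property _

theorem ofPrime_center (h : IsLocalizationAtCenter S W) :
    LocalSubring.ofPrime S h.center = W.toLocalSubring := by
  apply LocalSubring.toSubring_injective
  ext z
  rw [mem_ofPrime_iff]
  constructor
  · rintro ⟨a, s, hs, e⟩
    have hv := h.valuation_eq_one hs
    have hz : W.valuation z ≤ 1 := by
      have := congrArg W.valuation e
      rw [map_mul, hv, mul_one] at this
      rw [this]
      exact (W.valuation_le_one_iff _).2 (h.le a.2)
    exact (W.valuation_le_one_iff _).1 hz
  · intro hz
    obtain ⟨a, ha, s, hs, hv, e⟩ := h.exists_mul_eq z hz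
    exact ⟨⟨a, ha⟩, ⟨s, hs⟩, by rw [h.mem_center]; exact hv.not_lt, e⟩

theorem of_ofPrime_eq {P : Ideal S} [P.IsPrime]
    (h : LocalSubring.ofPrime S P = W.toLocalSubring) : IsLocalizationAtCenter S W := by
  have hmem : ∀ z, z ∈ W ↔ ∃ a s : S, s ∉ P ∧ z * s = a := fun z => by
    rw [← mem_ofPrime_iff S P z, h]; rfl
  have hle : S ≤ W.toSubring := by
    have := LocalSubring.le_ofPrime S P
    rwa [h] at this
  refine ⟨hle, fun z hz => ?_⟩
  obtain ⟨a, s, hs, e⟩ := (hmem z).1 hz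
  refine ⟨a, a.2, s, s.2, ?_, e⟩
  have hs0 : (s : K) ≠ 0 := by
    intro h0
    have : s = 0 := Subtype.ext h0
    exact hs (this ▸ P.zero_mem)
  apply le_antisymm ((W.valuation_le_one_iff _).2 (hle s.2))
  have : (s : K)⁻¹ ∈ W := (hmem _).2 ⟨1, s, hs, by simp [hs0]⟩
  have h1 := (W.valuation_le_one_iff _).2 this
  rw [map_inv₀] at h1
  have hpos : 0 < W.valuation (s : K) := by rwa [zero_lt_iff, ne_eq, Valuation.zero_iff]
  exact (inv_le_one₀ hpos).1 h1

theorem center_eq_of_ofPrime_eq {P : Ideal S} [P.IsPrime]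
    (h : LocalSubring.ofPrime S P = W.toLocalSubring) :
    (of_ofPrime_eq h).center = P := by
  ext a
  rw [mem_center]
  have hmem : ∀ z, z ∈ W ↔ ∃ a s : S, s ∉ P ∧ z * s = a := fun z => by
    rw [← mem_ofPrime_iff S P z, h]; rfl
  by_cases ha0 : (a : K) = 0
  · have : a = 0 := Subtype.ext ha0
    simp [this]
  have hpos : 0 < W.valuation (a : K) := by rwa [zero_lt_iff, ne_eq, Valuation.zero_iff]
  rw [← not_iff_not, not_lt, ← inv_le_one₀ hpos, ← map_inv₀, W.valuation_le_one_iff, hmem]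
  constructor
  · rintro ⟨b, s, hs, e⟩ haP
    apply hs
    have : s = a * b := by
      apply Subtype.ext
      simp only [Subring.coe_mul]
      rw [← e, mul_inv_cancel_left₀ ha0]
    rw [this]
    exact P.mul_mem_right _ haP
  · intro haP
    exact ⟨1, a, haP, by simp [ha0]⟩

theorem isLocalization (h : IsLocalizationAtCenter S W) :
    letI := (Subring.inclusion h.le).toAlgebra
    IsLocalization.AtPrime W.toSubring h.center := by
  have e := h.ofPrime_center
  have key : ∀ (T : LocalSubring K) (_ : LocalSubring.ofPrime S h.center = T)
      (hle : S ≤ T.toSubring),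
      letI := (Subring.inclusion hle).toAlgebra
      IsLocalization.AtPrime T.toSubring h.center := by
    rintro T rfl hle
    exact inferInstanceAs (IsLocalization.AtPrime
      (LocalSubring.ofPrime S h.center).toSubring h.center)
  exact key _ e h.le

theorem isNoetherianRing (h : IsLocalizationAtCenter S W) [IsNoetherianRing S] :
    IsNoetherianRing W := by
  let := (Subring.inclusion h.le).toAlgebra
  have := h.isLocalization
  exact IsLocalization.isNoetherianRing h.center.primeCompl W.toSubring inferInstance

theorem isDiscreteValuationRing (h : IsLocalizationAtCenter S W) [IsNoetherianRing S]
    {z : K} (hz0 : z ≠ 0) (hz1 : W.valuation z < 1) : IsDiscreteValuationRing W := by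
  have := h.isNoetherianRing
  have hf : ¬ IsField W := by
    intro hf
    have hzW : z ∈ W := (W.valuation_le_one_iff _).1 hz1.le
    have hm : (⟨z, hzW⟩ : W) ∈ maximalIdeal W := (W.valuation_lt_one_iff _).2 hz1
    rw [isField_iff_maximalIdeal_eq.1 hf] at hm
    have h0 := congrArg Subtype.val ((Submodule.mem_bot W).1 hm)
    exact hz0 h0
  exact ((IsDiscreteValuationRing.TFAE W hf).out 0 1).2 (inferInstance : ValuationRing W)

theorem height_center (h : IsLocalizationAtCenter S W) [IsDiscreteValuationRing W] :
    h.center.height = 1 := by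
  let := (Subring.inclusion h.le).toAlgebra
  have := h.isLocalization
  have h1 := IsLocalization.AtPrime.ringKrullDim_eq_height h.center W.toSubring
  have h2 : ringKrullDim W.toSubring = 1 := IsDiscreteValuationRing.ringKrullDim_eq_one W
  rw [h2] at h1
  exact_mod_cast h1.symm

theorem center_mem_minimalPrimes (h : IsLocalizationAtCenter S W) [IsDiscreteValuationRing W]
    {J : Ideal S} (hJ : J ≤ h.center) (hJ0 : J ≠ ⊥) : h.center ∈ J.minimalPrimes := by
  refine ⟨⟨inferInstance, hJ⟩, ?_⟩
  rintro P ⟨hP, hJP⟩ hle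
  exact (eq_of_le_of_height_eq_one (fun hbot => hJ0 (le_bot_iff.1 (hbot ▸ hJP)))
    h.height_center hle).ge

/-- Both centres have height one, so an inclusion between them is an equality, and the centre
determines the valuation ring as the localization there. -/
theorem eq_of_center_le {W' : ValuationSubring K} (h : IsLocalizationAtCenter S W)
    (h' : IsLocalizationAtCenter S W') [IsDiscreteValuationRing W] [IsDiscreteValuationRing W']
    (hle : h.center ≤ h'.center) : W = W' := by
  have e := eq_of_le_of_height_eq_one (Ideal.ne_bot_of_height_eq_one h.height_center)
    h'.height_center hle
  apply ValuationSubring.toLocalSubring_injective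
  rw [← h.ofPrime_center, ← h'.ofPrime_center]
  congr 1

theorem isPrimary_contractIdeal (h : IsLocalizationAtCenter S W) [IsDiscreteValuationRing W]
    {N : Ideal W} (hN0 : N ≠ ⊥) (hN1 : N ≠ ⊤) :
    (contractIdeal (fun a : S => h.le a.2) N).IsPrimary ∧
      (contractIdeal (fun a : S => h.le a.2) N).radical = h.center := by
  have hrad : N.radical = maximalIdeal W := by
    obtain ⟨n, rfl⟩ := exists_maximalIdeal_pow_eq_of_principal W
      (IsPrincipalIdealRing.principal _) N hN0
    have hn : n ≠ 0 := by
      rintro rfl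
      exact hN1 (by simp)
    rw [Ideal.radical_pow _ hn, (inferInstance : (maximalIdeal W).IsPrime).radical]
  constructor
  · exact Ideal.IsPrimary.comap (Ideal.isPrimary_of_isMaximal_radical (by
      rw [hrad]; infer_instance)) _
  · unfold contractIdeal center
    rw [← Ideal.comap_radical, hrad]
    rfl

end IsLocalizationAtCenter

end Centers

/-! ### Normal noetherian rings and normalization -/

section NormalRings

variable {K : Type*} [Field K]

/-- A noetherian normal local ring `T` is a discrete valuation ring as soon as its maximal ideal
is the conductor `(T : u)` of an element `u` of the quotient field: if `u M(T) ⊆ M(T)`, then `u`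
would be integral over `T`, so `u M(T) = T` and `M(T)` is generated by `u⁻¹`. -/
theorem maximalIdeal_isPrincipal_of_conductor (T : Subring K) [IsLocalRing T] [IsNoetherianRing T]
    [IsIntegrallyClosed T] [IsFractionRing T K] (u : K)
    (hu : ∀ z : T, z ∈ maximalIdeal T ↔ (z : K) * u ∈ T) : (maximalIdeal T).IsPrincipal := by
  have huT : u ∉ T := fun h => by
    have : (1 : T) ∈ maximalIdeal T := (hu 1).2 (by simpa using h)
    exact (Ideal.ne_top_iff_one _).1 (IsLocalRing.maximalIdeal.isMaximal T).ne_top this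
  by_cases hbot : maximalIdeal T = ⊥
  · rw [hbot]; infer_instance
  by_cases hm : ∀ z : T, ∀ hz : z ∈ maximalIdeal T,
      (⟨(z : K) * u, (hu z).1 hz⟩ : T) ∈ maximalIdeal T
  · exfalso
    let M : Submodule T K := Submodule.map (Algebra.linearMap T K) (maximalIdeal T)
    have hint : IsIntegral T u := by
      refine isIntegral_of_smul_mem_submodule M ?_ ?_ u ?_
      · obtain ⟨a, ha, ha0⟩ := Submodule.exists_mem_ne_zero_of_ne_bot hbot
        rw [Submodule.ne_bot_iff]
        exact ⟨a, ⟨a, ha, rfl⟩, fun h => ha0 (Subtype.ext h)⟩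
      · exact Submodule.FG.map _ (IsNoetherian.noetherian _)
      · rintro _ ⟨z, hz, rfl⟩
        refine ⟨⟨_, (hu z).1 hz⟩, hm z hz, ?_⟩
        exact mul_comm (z : K) u
    obtain ⟨y, rfl⟩ := IsIntegrallyClosed.algebraMap_eq_of_integral hint
    exact huT y.2
  · push Not at hm
    obtain ⟨p, hp, hpu⟩ := hm
    have hunit : IsUnit (⟨(p : K) * u, (hu p).1 hp⟩ : T) := by
      rwa [mem_maximalIdeal, mem_nonunits_iff, not_not] at hpu
    obtain ⟨w, hw⟩ := hunit.exists_left_inv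
    refine ⟨p, le_antisymm (fun z hz => ?_) ?_⟩
    · refine Ideal.mem_span_singleton'.2 ⟨⟨_, (hu z).1 hz⟩ * w, Subtype.ext ?_⟩
      have hw' : (w : K) * (p * u) = 1 := congrArg Subtype.val hw
      simp only [Subring.coe_mul]
      linear_combination (z : K) * hw'
    · exact Ideal.span_le.2 (by simpa using hp)

theorem exists_toLocalSubring_eq (T : LocalSubring K) [IsFractionRing T.toSubring K]
    [ValuationRing T.toSubring] : ∃ W : ValuationSubring K, W.toLocalSubring = T :=
  ⟨ValuationSubring.ofSubring T.toSubring fun z => by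
    rcases ValuationRing.isInteger_or_isInteger T.toSubring z with ⟨a, rfl⟩ | ⟨a, h⟩
    · exact Or.inl a.2
    · exact Or.inr (h ▸ a.2), LocalSubring.toSubring_injective rfl⟩

/-- In a noetherian normal domain `S`, a prime which is locally the conductor `(xS : f)` of
a nonzero principal ideal is the centre of a discrete valuation ring `S_P`. -/
theorem exists_isLocalizationAtCenter (S : Subring K) [IsNoetherianRing S] [IsIntegrallyClosed S]
    [IsFractionRing S K] (P : Ideal S) [P.IsPrime] (x f : S) (hx : x ≠ 0)
    (H : ∀ s, s ∈ P ↔ ∃ t, t ∉ P ∧ x ∣ t * s * f) :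
    ∃ (W : ValuationSubring K) (h : IsLocalizationAtCenter S W), h.center = P ∧
      IsDiscreteValuationRing W := by
  set T := LocalSubring.ofPrime S P with hT
  have hle : S ≤ T.toSubring := LocalSubring.le_ofPrime S P
  have hloc : IsLocalization.AtPrime T.toSubring P :=
    inferInstanceAs (IsLocalization.AtPrime (LocalSubring.ofPrime S P).toSubring P)
  have hxK : (x : K) ≠ 0 := fun h => hx (Subtype.ext h)
  have hfrac : IsFractionRing T.toSubring K := by
    refine isFractionRing_of_forall_exists_div _ fun z => ?_
    obtain ⟨a, b, hb, rfl⟩ := IsFractionRing.div_surjective (A := S) z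
    exact ⟨a, hle a.2, b, hle b.2, fun h => nonZeroDivisors.ne_zero hb (Subtype.ext h), rfl⟩
  have hnoeth : IsNoetherianRing T.toSubring :=
    IsLocalization.isNoetherianRing P.primeCompl _ inferInstance
  have hnormal : IsIntegrallyClosed T.toSubring :=
    isIntegrallyClosed_of_isLocalization (R := S) _ P.primeCompl P.primeCompl_le_nonZeroDivisors
  have hmax : ∀ (a s : S) (_ : s ∉ P) (z : T.toSubring), (z : K) * s = a →
      (z ∈ maximalIdeal T.toSubring ↔ a ∈ P) := by
    intro a s hs z hz
    have hz' : z * algebraMap S T.toSubring s = algebraMap S T.toSubring a := Subtype.ext hz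
    rw [← IsLocalization.AtPrime.to_map_mem_maximal_iff T.toSubring P a, ← hz']
    have hu : IsUnit (algebraMap S T.toSubring s) :=
      IsLocalization.map_units T.toSubring (⟨s, hs⟩ : P.primeCompl)
    exact (Ideal.mul_unit_mem_iff_mem _ hu).symm
  have hprin := maximalIdeal_isPrincipal_of_conductor T.toSubring ((f : K) / x) (by
    intro z
    obtain ⟨a, s, hs, e⟩ := (IsLocalizationAtCenter.mem_ofPrime_iff S P z).1 z.2
    have hs0 : (s : K) ≠ 0 := fun h => hs (by
      have : s = 0 := Subtype.ext h
      exact this ▸ P.zero_mem)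
    rw [hmax a s hs z e, H]
    refine Iff.trans ?_ (IsLocalizationAtCenter.mem_ofPrime_iff S P _).symm
    constructor
    · rintro ⟨t, ht, c, hc⟩
      refine ⟨c, t * s, fun h => (Ideal.IsPrime.mem_or_mem ‹_› h).elim ht hs, ?_⟩
      have hc' : (t : K) * a * f = x * c := congrArg Subtype.val hc
      rw [← e] at hc'
      simp only [Subring.coe_mul]
      field_simp
      linear_combination hc'
    · rintro ⟨c, t, ht, hc⟩
      refine ⟨t, ht, s * c, Subtype.ext ?_⟩
      simp only [Subring.coe_mul]
      rw [← e]
      field_simp at hc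
      linear_combination (s : K) * hc)
  have hxP : x ∈ P := (H x).2 ⟨1, P.primeCompl.one_mem, f, by ring⟩
  have hfield : ¬ IsField T.toSubring := by
    rw [isField_iff_maximalIdeal_eq]
    intro h
    have : algebraMap S T.toSubring x ∈ maximalIdeal T.toSubring :=
      (IsLocalization.AtPrime.to_map_mem_maximal_iff T.toSubring P x).2 hxP
    rw [h] at this
    exact hxK (congrArg Subtype.val ((Submodule.mem_bot T.toSubring).1 this))
  have hdvr : IsDiscreteValuationRing T.toSubring :=
    ((IsDiscreteValuationRing.TFAE T.toSubring hfield).out 0 4).2 hprin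
  obtain ⟨W, hW⟩ := exists_toLocalSubring_eq T
  exact ⟨W, .of_ofPrime_eq hW.symm, IsLocalizationAtCenter.center_eq_of_ofPrime_eq hW.symm,
    show IsDiscreteValuationRing W.toLocalSubring.toSubring from hW ▸ hdvr⟩

theorem ofPrime_maximalIdeal (T : LocalSubring K) :
    LocalSubring.ofPrime T.toSubring (maximalIdeal T.toSubring) = T := by
  apply LocalSubring.toSubring_injective
  ext z
  rw [IsLocalizationAtCenter.mem_ofPrime_iff]
  constructor
  · rintro ⟨a, s, hs, e⟩
    obtain ⟨w, hw⟩ := (notMem_maximalIdeal.1 hs).exists_right_inv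
    have hw' : (s : K) * w = 1 := congrArg Subtype.val hw
    have : z = (a * w : T.toSubring) := by
      simp only [Subring.coe_mul]
      linear_combination (w : K) * e - z * hw'
    rw [this]
    exact Subtype.property _
  · intro hz
    exact ⟨⟨z, hz⟩, 1, (maximalIdeal T.toSubring).primeCompl.one_mem, by simp⟩

/-- If every `T ∈ U` is integrally closed in `K`, then the only localization of `T` dominating `T`
is `T` itself, so normalizing `U` changes nothing. -/
theorem normalization_eq_self (U : Set (LocalSubring K))
    (hU : ∀ T ∈ U, ∀ z : K, IsIntegral T.toSubring z → z ∈ T.toSubring) : normalization U = U := by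
  have key : ∀ T ∈ U, (integralClosure T.toSubring K).toSubring = T.toSubring := by
    intro T hT
    ext z
    exact ⟨fun hz => hU T hT z hz, fun hz => isIntegral_algebraMap (x := (⟨z, hz⟩ : T.toSubring))⟩
  ext S
  constructor
  · rintro ⟨T, hT, ⟨P, hP, hS⟩, hTS⟩
    have gen : ∀ (A : Subring K) (_ : A = T.toSubring) (P : Ideal A) (_ : P.IsPrime),
        S = LocalSubring.ofPrime A P → S = T := by
      rintro _ rfl P hP rfl
      obtain ⟨hle, hloc⟩ := hTS
      have : P = maximalIdeal T.toSubring := by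
        refine le_antisymm (le_maximalIdeal hP.ne_top) fun a ha => ?_
        by_contra haP
        have h1 := IsLocalization.map_units (LocalSubring.ofPrime T.toSubring P).toSubring
          (⟨a, haP⟩ : P.primeCompl)
        exact (mem_maximalIdeal a).1 ha (hloc.map_nonunit a h1)
      subst this
      exact ofPrime_maximalIdeal T
    rw [gen _ (key T hT) P hP hS]
    exact hT
  · intro hS
    refine ⟨S, hS, ?_, le_rfl⟩
    rw [key S hS]
    exact ⟨_, inferInstance, (ofPrime_maximalIdeal S).symm⟩

end NormalRings

/-! ### Uniqueness of primary decompositions -/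

section PrimaryDecomposition

variable {S ι : Type*} [CommRing S] [Fintype ι]

theorem exists_le_of_iInf_le_isPrime {q : ι → Ideal S} {P : Ideal S} (hP : P.IsPrime)
    (h : ⨅ i, q i ≤ P) : ∃ i, q i ≤ P := by
  have : Finset.univ.inf q ≤ P := by rwa [Finset.inf_univ_eq_iInf]
  obtain ⟨i, -, hi⟩ := (Ideal.IsPrime.inf_le' hP).1 this
  exact ⟨i, hi⟩

theorem minimalPrimes_iInf_of_radical {q p : ι → Ideal S} (hq : ∀ i, (q i).IsPrimary)
    (hr : ∀ i, (q i).radical = p i) (hp : ∀ i j, p i ≤ p j → i = j) :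
    (⨅ i, q i).minimalPrimes = Set.range p := by
  have hprime : ∀ i, (p i).IsPrime := fun i => hr i ▸ Ideal.isPrime_radical (hq i)
  have hle : ∀ i, ⨅ i, q i ≤ p i := fun i => (iInf_le _ i).trans (hr i ▸ Ideal.le_radical)
  have hex : ∀ P : Ideal S, P.IsPrime → ⨅ i, q i ≤ P → ∃ i, p i ≤ P := by
    intro P hP h
    obtain ⟨i, hi⟩ := exists_le_of_iInf_le_isPrime hP h
    exact ⟨i, hr i ▸ hP.radical_le_iff.2 hi⟩
  ext P
  constructor
  · rintro ⟨⟨hP, h1⟩, h2⟩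
    obtain ⟨i, hi⟩ := hex P hP h1
    exact ⟨i, le_antisymm hi (h2 ⟨hprime i, hle i⟩ hi)⟩
  · rintro ⟨i, rfl⟩
    refine ⟨⟨hprime i, hle i⟩, ?_⟩
    rintro P ⟨hP, h1⟩ h2
    obtain ⟨j, hj⟩ := hex P hP h1
    obtain rfl := hp j i (hj.trans h2)
    exact hj

/-- A finite intersection of primary ideals whose radicals are pairwise incomparable is an
irredundant primary decomposition, and it is the only one since all its components are isolated. -/
theorem isUniqueIrredundantPrimaryDecomposition_iInf {q p : ι → Ideal S}
    (hq : ∀ i, (q i).IsPrimary) (hr : ∀ i, (q i).radical = p i) (hp : ∀ i j, p i ≤ p j → i = j) :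
    IsUniqueIrredundantPrimaryDecomposition (⨅ i, q i) q := by
  classical
  have hprime : ∀ i, (p i).IsPrime := fun i => hr i ▸ Ideal.isPrime_radical (hq i)
  have hqp : ∀ i, q i ≤ p i := fun i => hr i ▸ Ideal.le_radical
  have hpq : ∀ {i : ι} {P : Ideal S}, P.IsPrime → q i ≤ P → p i ≤ P := fun {i P} hP h =>
    hr i ▸ hP.radical_le_iff.2 h
  have hcancel : ∀ {Q : Ideal S} {a s : S}, Q.IsPrimary → s * a ∈ Q → s ∉ Q.radical → a ∈ Q := by
    intro Q a s hQ h hs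
    rw [mul_comm] at h
    exact ((Ideal.isPrimary_iff.1 hQ).2 h).resolve_right hs
  have hinj : Function.Injective q := fun i j h => hp i j (by rw [← hr i, ← hr j, h])
  have hinf : (Finset.univ.image q).inf id = ⨅ i, q i := by
    rw [Finset.inf_image, Function.id_comp, Finset.inf_univ_eq_iInf]
  -- the prime `p i` contains no `q j` with `j ≠ i`, hence not their intersection either
  have hsep : ∀ i, ∃ s, s ∉ p i ∧ ∀ j, j ≠ i → s ∈ q j := by
    intro i
    have : ¬ (Finset.univ.erase i).inf q ≤ p i := by
      rw [Ideal.IsPrime.inf_le' (hprime i)]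
      rintro ⟨j, hj, hji⟩
      exact (Finset.mem_erase.1 hj).1 (hp j i (hpq (hprime i) hji))
    obtain ⟨s, hs, hsp⟩ := SetLike.not_le_iff_exists.1 this
    refine ⟨s, hsp, fun j hj => ?_⟩
    exact (Submodule.mem_finsetInf.1 hs) j (Finset.mem_erase.2 ⟨hj, Finset.mem_univ j⟩)
  have hmin : Submodule.IsMinimalPrimaryDecomposition (⨅ i, q i) (Finset.univ.image q) := by
    refine ⟨hinf, ?_, ?_, ?_⟩
    · intro J hJ
      obtain ⟨i, -, rfl⟩ := Finset.mem_image.1 hJ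
      exact hq i
    · intro J hJ J' hJ' hne
      obtain ⟨i, -, rfl⟩ := Finset.mem_image.1 (Finset.mem_coe.1 hJ)
      obtain ⟨j, -, rfl⟩ := Finset.mem_image.1 (Finset.mem_coe.1 hJ')
      simp only [Function.onFun, Submodule.colon_univ, hr]
      intro h
      exact hne (congrArg q (hp i j h.le))
    · intro J hJ hle
      obtain ⟨i, -, rfl⟩ := Finset.mem_image.1 hJ
      obtain ⟨s, hs, hsq⟩ := hsep i
      refine hs (hqp i (hle (Submodule.mem_finsetInf.2 fun Q hQ => ?_)))
      obtain ⟨hne, hQ⟩ := Finset.mem_erase.1 hQ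
      obtain ⟨j, -, rfl⟩ := Finset.mem_image.1 hQ
      exact hsq j fun h => hne (by rw [h])
  have huniq : ∀ t : Finset (Ideal S), Submodule.IsMinimalPrimaryDecomposition (⨅ i, q i) t →
      t = Finset.univ.image q := by
    intro t ht
    have hrad : ∀ Q ∈ t, Q.radical.IsPrime := fun Q hQ => Ideal.isPrime_radical (ht.primary hQ)
    have hle : ∀ Q ∈ t, ⨅ i, q i ≤ Q := fun Q hQ => ht.inf_eq ▸ Finset.inf_le (f := id) hQ
    have hex : ∀ Q ∈ t, ∃ i, p i ≤ Q.radical := by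
      intro Q hQ
      obtain ⟨i, hi⟩ := exists_le_of_iInf_le_isPrime (hrad Q hQ)
        ((hle Q hQ).trans Ideal.le_radical)
      exact ⟨i, hpq (hrad Q hQ) hi⟩
    have hmem : ∀ i, q i ∈ t := by
      intro i
      have h1 : t.inf id ≤ p i := by
        rw [ht.inf_eq]; exact (iInf_le _ i).trans (hqp i)
      obtain ⟨Q, hQ, hQi⟩ := (Ideal.IsPrime.inf_le' (hprime i)).1 h1
      have hQr : Q.radical = p i := by
        have h2 : Q.radical ≤ p i := (hprime i).radical_le_iff.2 hQi
        obtain ⟨j, hj⟩ := hex Q hQ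
        obtain rfl := hp j i (hj.trans h2)
        exact le_antisymm h2 hj
      have h3 : ¬ (t.erase Q).inf id ≤ p i := by
        rw [Ideal.IsPrime.inf_le' (hprime i)]
        rintro ⟨Q', hQ', hQ'i⟩
        obtain ⟨hne, hQ't⟩ := Finset.mem_erase.1 hQ'
        have h2 : Q'.radical ≤ p i := (hprime i).radical_le_iff.2 hQ'i
        obtain ⟨j, hj⟩ := hex Q' hQ't
        obtain rfl := hp j i (hj.trans h2)
        have := ht.distinct (Finset.mem_coe.2 hQ't) (Finset.mem_coe.2 hQ) hne
        simp only [Function.onFun, Submodule.colon_univ, hQr] at this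
        exact this (le_antisymm h2 hj)
      obtain ⟨s', hs', hs'p⟩ := SetLike.not_le_iff_exists.1 h3
      obtain ⟨s, hs, hsq⟩ := hsep i
      -- an element outside `p i` lying in all the other components of one decomposition carries the
      -- component at `p i` into the intersection, hence into the component of the other one
      have : Q = q i := by
        apply le_antisymm
        · intro a ha
          refine hcancel (hq i) (s := s') ?_ (by rwa [hr])
          have : s' * a ∈ t.inf id := by
            refine Submodule.mem_finsetInf.2 fun Q' hQ' => ?_
            by_cases h : Q' = Q
            · subst h; exact Ideal.mul_mem_left _ _ ha
            · exact Ideal.mul_mem_right _ _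
                ((Submodule.mem_finsetInf.1 hs') Q' (Finset.mem_erase.2 ⟨h, hQ'⟩))
          rw [ht.inf_eq] at this
          exact (Ideal.mem_iInf.1 this) i
        · intro a ha
          refine hcancel (ht.primary hQ) (s := s) (hle Q hQ (Ideal.mem_iInf.2 fun j => ?_))
            (by rwa [hQr])
          by_cases h : j = i
          · subst h; exact Ideal.mul_mem_left _ _ ha
          · exact Ideal.mul_mem_right _ _ (hsq j h)
      rwa [← this]
    apply Finset.Subset.antisymm
    · intro Q hQ
      by_contra hne
      refine ht.minimal hQ (le_trans ?_ (hle Q hQ))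
      refine le_iInf fun i => Finset.inf_le (f := id) (Finset.mem_erase.2 ⟨?_, hmem i⟩)
      rintro rfl
      exact hne (Finset.mem_image_of_mem q (Finset.mem_univ i))
    · intro Q hQ
      obtain ⟨i, -, rfl⟩ := Finset.mem_image.1 hQ
      exact hmem i
  refine ⟨hinj, ?_, ?_⟩
  · convert hmin
  · intro t ht
    convert huniq t ht
end PrimaryDecomposition

open Polynomial

/-! ### The Rees ring -/

theorem algebraMap_ratFunc_eq {R L : Type*} [CommRing R] [Field L] [Algebra R L]
    (r : R) :
    algebraMap R (RatFunc L) r = algebraMap L (RatFunc L) (algebraMap R L r) := by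
  rw [← IsScalarTower.algebraMap_apply R L (RatFunc L)]

section ReesRing

variable {R : Type*} [CommRing R] (L : Type*) [Field L] [Algebra R L]

/-- The embedding of `R[Z]` into `L(Z)`. -/
noncomputable def polyMap : R[X] →+* RatFunc L :=
  (algebraMap L[X] (RatFunc L)).comp (mapRingHom (algebraMap R L))

theorem polyMap_apply (q : R[X]) :
    polyMap L q = algebraMap L[X] (RatFunc L) (q.map (algebraMap R L)) := rfl

theorem algebraMap_poly_injective : Function.Injective (algebraMap L[X] (RatFunc L)) :=
  RatFunc.algebraMap_injective L

theorem polyMap_injective (hL : Function.Injective (algebraMap R L)) :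
    Function.Injective (polyMap (R := R) L) :=
  (algebraMap_poly_injective L).comp (map_injective _ hL)

theorem polyMap_C (r : R) : polyMap L (C r) = algebraMap R (RatFunc L) r := by
  rw [polyMap_apply, map_C, algebraMap_ratFunc_eq]
  rfl

theorem polyMap_X : polyMap (R := R) L X = RatFunc.X := by
  rw [polyMap_apply, map_X]
  exact RatFunc.algebraMap_X

theorem polyMap_monomial (n : ℕ) (r : R) :
    polyMap L (monomial n r) = algebraMap R (RatFunc L) r * RatFunc.X ^ n := by
  rw [← C_mul_X_pow_eq_monomial, map_mul, map_pow, polyMap_C, polyMap_X]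

variable {L}

theorem algebraMap_ratFunc_ne_zero {x : R} (hx0 : algebraMap R L x ≠ 0) :
    algebraMap R (RatFunc L) x ≠ 0 := by
  rw [algebraMap_ratFunc_eq]
  exact (map_ne_zero_iff _ (algebraMap L (RatFunc L)).injective).2 hx0

theorem mem_reesRing_iff (I : Ideal R) (z : RatFunc L) :
    z ∈ reesRing L I ↔ ∃ q : R[X], (∀ n, q.coeff n ∈ I ^ n) ∧ polyMap L q = z := by
  constructor
  · rintro ⟨q, hq, rfl⟩
    exact ⟨q, (mem_reesAlgebra_iff I q).1 hq, rfl⟩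
  · rintro ⟨q, hq, rfl⟩
    exact ⟨q, (mem_reesAlgebra_iff I q).2 hq, rfl⟩

theorem monomial_mem_reesRing {I : Ideal R} {n : ℕ} {a : R} (ha : a ∈ I ^ n) :
    algebraMap R (RatFunc L) a * RatFunc.X ^ n ∈ reesRing L I := by
  rw [← polyMap_monomial]
  exact ⟨_, reesAlgebra.monomial_mem.2 ha, rfl⟩

theorem algebraMap_mem_reesRing (I : Ideal R) (a : R) :
    algebraMap R (RatFunc L) a ∈ reesRing L I := by
  simpa using monomial_mem_reesRing (L := L) (I := I) (n := 0) (a := a) (by simp)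

theorem reesRing_mk_eq_sum {I : Ideal R} {q : R[X]} (hq : ∀ n, q.coeff n ∈ I ^ n)
    (h : polyMap L q ∈ reesRing L I) : (⟨polyMap L q, h⟩ : reesRing L I) =
      ∑ n ∈ q.support, (⟨_, monomial_mem_reesRing (L := L) (hq n)⟩ : reesRing L I) := by
  apply Subtype.ext
  change polyMap L q = _
  conv_lhs => rw [q.as_sum_support]
  rw [map_sum, AddSubmonoidClass.coe_finsetSum]
  exact Finset.sum_congr rfl fun n _ => polyMap_monomial L n _

/-- `IE` consists of the polynomials whose coefficient of `Z^n` is in `I^(n+1)`. -/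
theorem mem_extendIdeal_reesRing_iff (I : Ideal R) (f : reesRing L I) :
    f ∈ extendIdeal I (reesRing L I) ↔
      ∃ q : R[X], (∀ n, q.coeff n ∈ I ^ (n + 1)) ∧ polyMap L q = f := by
  constructor
  · intro hf
    induction hf using Submodule.span_induction with
    | mem s hs =>
      obtain ⟨a, ha, has⟩ := hs
      refine ⟨C a, fun n => ?_, by rw [polyMap_C, has]⟩
      rw [coeff_C]
      split_ifs with h
      · simpa [h] using ha
      · exact Ideal.zero_mem _
    | zero => exact ⟨0, fun n => by simp, by simp⟩
    | add s t _ _ hs ht =>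
      obtain ⟨p, hp, hps⟩ := hs
      obtain ⟨q, hq, hqt⟩ := ht
      exact ⟨p + q, fun n => by rw [coeff_add]; exact Ideal.add_mem _ (hp n) (hq n),
        by rw [map_add, hps, hqt]; rfl⟩
    | smul e s _ hs =>
      obtain ⟨q, hq, hqt⟩ := hs
      obtain ⟨p, hp, hpe⟩ := (mem_reesRing_iff I _).1 e.2
      refine ⟨p * q, fun n => ?_, by rw [map_mul, hpe, hqt]; rfl⟩
      rw [coeff_mul]
      refine Ideal.sum_mem _ fun ij hij => ?_
      rw [← Finset.HasAntidiagonal.mem_antidiagonal.1 hij, add_assoc, pow_add]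
      exact Ideal.mul_mem_mul (hp _) (hq _)
  · rintro ⟨q, hq, hqf⟩
    have hmon : ∀ (n : ℕ) (a : R) (ha : a ∈ I ^ (n + 1)),
        (⟨_, monomial_mem_reesRing (L := L) (Ideal.pow_le_pow_right n.le_succ ha)⟩ :
          reesRing L I) ∈ extendIdeal I (reesRing L I) := by
      intro n a ha
      have ha' := ha
      rw [pow_succ'] at ha'
      have key : ∃ h, (⟨algebraMap R (RatFunc L) a * RatFunc.X ^ n, h⟩ : reesRing L I) ∈
          extendIdeal I (reesRing L I) := by
        clear ha
        induction ha' using Submodule.mul_induction_on' with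
        | mem_mul_mem y hy b hb =>
          refine ⟨monomial_mem_reesRing (Ideal.mul_mem_left _ _ hb), ?_⟩
          have h1 : (⟨_, algebraMap_mem_reesRing (L := L) I y⟩ : reesRing L I) ∈
              extendIdeal I (reesRing L I) := Ideal.subset_span ⟨y, hy, rfl⟩
          have h2 := Ideal.mul_mem_right
            (⟨_, monomial_mem_reesRing (L := L) hb⟩ : reesRing L I) _ h1
          convert h2 using 1
          apply Subtype.ext
          simp only [Subring.coe_mul, map_mul]
          ring
        | add b _ c _ hb hc =>
          obtain ⟨h1, h1'⟩ := hb
          obtain ⟨h2, h2'⟩ := hc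
          have h3 := Ideal.add_mem _ h1' h2'
          refine ⟨by rw [map_add, add_mul]; exact add_mem h1 h2, ?_⟩
          convert h3 using 1
          apply Subtype.ext
          simp only [Subring.coe_add, map_add, add_mul]
      exact key.2
    have hsum : f = ∑ n ∈ q.support, (⟨_, monomial_mem_reesRing (L := L)
        (Ideal.pow_le_pow_right n.le_succ (hq n))⟩ : reesRing L I) := by
      apply Subtype.ext
      rw [← hqf]
      conv_lhs => rw [q.as_sum_support]
      rw [map_sum, AddSubmonoidClass.coe_finsetSum]
      exact Finset.sum_congr rfl fun n _ => polyMap_monomial L n _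
    rw [hsum]
    exact Ideal.sum_mem _ fun n _ => hmon n _ (hq n)

/-- `Z · IE ⊆ E`. -/
theorem X_mul_mem_reesRing {I : Ideal R} {f : reesRing L I}
    (hf : f ∈ extendIdeal I (reesRing L I)) : RatFunc.X * (f : RatFunc L) ∈ reesRing L I := by
  obtain ⟨q, hq, e⟩ := (mem_extendIdeal_reesRing_iff I _).1 hf
  refine (mem_reesRing_iff I _).2 ⟨X * q, fun n => ?_, by rw [map_mul, polyMap_X, e]⟩
  rcases n with _ | n
  · simp
  · rw [coeff_X_mul]
    exact hq n

theorem isIntegral_of_ringHom {A B K : Type*} [CommRing A] [CommRing B] [CommRing K] [Algebra A K]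
    [Algebra B K] (h : A →+* B) (hh : ∀ a, algebraMap B K (h a) = algebraMap A K a) {z : K}
    (hz : IsIntegral A z) : IsIntegral B z := by
  obtain ⟨p, hp, hpz⟩ := hz
  refine ⟨p.map h, hp.map h, ?_⟩
  rw [eval₂_map]
  convert hpz
  exact RingHom.ext hh

end ReesRing

/-! ### Complete ideals and Gauss extensions -/

section Complete

variable {R : Type*} [CommRing R] {L : Type*} [Field L] [Algebra R L]

/-- An element whose value under every valuation ring containing `R` is at least (additively) the
value of some element of a complete ideal belongs to that ideal. -/
theorem IsCompleteIdeal.mem_of_valuation_le {J : Ideal R} (hJ : IsCompleteIdeal L J) {a : R}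
    (H : ∀ V : ValuationSubring L, (∀ r : R, algebraMap R L r ∈ V) →
      ∃ b ∈ J, V.valuation (algebraMap R L a) ≤ V.valuation (algebraMap R L b)) : a ∈ J := by
  obtain ⟨N, hN⟩ := hJ
  refine (hN a).2 fun V hV => ?_
  obtain ⟨b, hb, hab⟩ := H V hV
  obtain ⟨n, hn, hnb⟩ := (hN b).1 hb V hV
  obtain ⟨c, hc⟩ := (V.valuation_le_iff _ _).1 hab
  exact ⟨c * n, Ideal.mul_mem_left _ _ hn, by rw [← hc, ← hnb]; rfl⟩

theorem valuation_le_pow {Γ : Type*} [LinearOrderedCommGroupWithZero Γ] (v : Valuation L Γ)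
    (hv : ∀ r : R, v (algebraMap R L r) ≤ 1) (I : Ideal R) {g : Γ}
    (hg : ∀ y ∈ I, v (algebraMap R L y) ≤ g) (n : ℕ) {a : R} (ha : a ∈ I ^ n) :
    v (algebraMap R L a) ≤ g ^ n := by
  induction n generalizing a with
  | zero => simpa using hv a
  | succ n ih =>
    rw [pow_succ] at ha
    induction ha using Submodule.mul_induction_on' with
    | mem_mul_mem b hb y hy =>
      rw [map_mul, map_mul, pow_succ]
      exact mul_le_mul' (ih hb) (hg y hy)
    | add b _ c _ hb hc =>
      rw [map_add]
      exact v.map_add_le hb hc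

section

variable {V : ValuationSubring L} {I : Ideal R}

theorem ratFuncValuation_poly (p : L[X]) :
    ratFuncValuation V.valuation (slope V I) (algebraMap L[X] (RatFunc L) p) =
      gaussValue V.valuation (slope V I) p :=
  Valuation.extendToLocalization_apply_map_apply _ _ _ _

theorem ratFuncValuation_algebraMap (v : L) :
    ratFuncValuation V.valuation (slope V I) (algebraMap L (RatFunc L) v) = V.valuation v := by
  have : algebraMap L (RatFunc L) v = algebraMap L[X] (RatFunc L) (C v) := rfl
  rw [this, ratFuncValuation_poly]
  apply le_antisymm
  · refine gaussValue_le _ _ _ _ fun n => ?_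
    rw [coeff_C]
    split_ifs with hn
    · simp [hn]
    · simp
  · simpa using le_gaussValue V.valuation (slope V I) (C v) 0

theorem mem_reesExtension_iff (z : RatFunc L) :
    z ∈ reesExtension V I ↔ ratFuncValuation V.valuation (slope V I) z ≤ 1 := Iff.rfl

theorem valuation_reesExtension_lt_one_iff (z : RatFunc L) :
    (reesExtension V I).valuation z < 1 ↔
      ratFuncValuation V.valuation (slope V I) z < 1 :=
  ((Valuation.isEquiv_valuation_valuationSubring _).lt_one_iff_lt_one).symm

theorem valuation_reesExtension_eq_one_iff (z : RatFunc L) :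
    (reesExtension V I).valuation z = 1 ↔
      ratFuncValuation V.valuation (slope V I) z = 1 :=
  ((Valuation.isEquiv_valuation_valuationSubring _).eq_one_iff_eq_one).symm

theorem comap_reesExtension : (reesExtension V I).comap (algebraMap L (RatFunc L)) = V := by
  ext z
  rw [ValuationSubring.mem_comap, mem_reesExtension_iff, ratFuncValuation_algebraMap,
    ValuationSubring.valuation_le_one_iff]

end

/-- The value of `I` under `V` is attained at the nonzero element `x` of `I`. The valuation being
written multiplicatively, `x` has the greatest value among the elements of `I`. -/
structure AttainsIdealValue (V : ValuationSubring L) (I : Ideal R) (x : R) : Prop where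
  mem : x ∈ I
  ne_zero : algebraMap R L x ≠ 0
  le : ∀ y ∈ I, V.valuation (algebraMap R L y) ≤ V.valuation (algebraMap R L x)

theorem exists_attainsIdealValue [IsNoetherianRing R] (hL : Function.Injective (algebraMap R L))
    {V : ValuationSubring L} (hV : ∀ r : R, algebraMap R L r ∈ V) {I : Ideal R} (hI : I ≠ ⊥) :
    ∃ x, AttainsIdealValue V I x := by
  obtain ⟨s, hs⟩ := IsNoetherian.noetherian I
  have hne : s.Nonempty := by
    rw [Finset.nonempty_iff_ne_empty]
    rintro rfl
    exact hI (by rw [← hs]; simp)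
  obtain ⟨x, hxs, hx⟩ := s.exists_max_image (fun y => V.valuation (algebraMap R L y)) hne
  have hle : ∀ y ∈ I, V.valuation (algebraMap R L y) ≤ V.valuation (algebraMap R L x) := by
    intro y hy
    rw [← hs] at hy
    induction hy using Submodule.span_induction with
    | mem y hy => exact hx y hy
    | zero => simp
    | add y z _ _ hy hz => rw [map_add]; exact V.valuation.map_add_le hy hz
    | smul r y _ hy =>
      rw [smul_eq_mul, map_mul, map_mul]
      exact mul_le_of_le_one_of_le ((V.valuation_le_one_iff _).2 (hV r)) hy
  refine ⟨x, hs ▸ Submodule.subset_span hxs, fun h0 => ?_, hle⟩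
  obtain ⟨y, hy, hy0⟩ := Submodule.exists_mem_ne_zero_of_ne_bot hI
  have := hle y hy
  rw [h0, map_zero, le_zero_iff, Valuation.zero_iff] at this
  exact hy0 (hL (by rw [this, map_zero]))

namespace AttainsIdealValue

variable {V : ValuationSubring L} {I : Ideal R} {x : R}

theorem valuation_ne_zero (h : AttainsIdealValue V I x) : V.valuation (algebraMap R L x) ≠ 0 :=
  (Valuation.ne_zero_iff _).2 h.ne_zero

theorem idealValue_eq (h : AttainsIdealValue V I x) :
    idealValue V I = V.valuation (algebraMap R L x) := by
  have hg : IsGreatest ((fun a : R => V.valuation (algebraMap R L a)) '' (I : Set R))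
      (V.valuation (algebraMap R L x)) := by
    refine ⟨⟨x, h.mem, rfl⟩, ?_⟩
    rintro _ ⟨y, hy, rfl⟩
    exact h.le y hy
  have hex : ∃ g, IsGreatest ((fun a : R => V.valuation (algebraMap R L a)) '' (I : Set R)) g :=
    ⟨_, hg⟩
  rw [idealValue, dif_pos hex]
  exact hex.choose_spec.unique hg

theorem of_valuation_eq (h : AttainsIdealValue V I x) {y : R} (hy : y ∈ I)
    (hyv : V.valuation (algebraMap R L y) = idealValue V I) : AttainsIdealValue V I y := by
  rw [h.idealValue_eq] at hyv
  refine ⟨hy, ?_, fun z hz => hyv ▸ h.le z hz⟩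
  rw [← Valuation.ne_zero_iff V.valuation, hyv]
  exact h.valuation_ne_zero

theorem slope_eq (h : AttainsIdealValue V I x) :
    (slope V I : V.ValueGroup) = (V.valuation (algebraMap R L x))⁻¹ := by
  have h0 : idealValue V I ≠ 0 := by rw [h.idealValue_eq]; exact h.valuation_ne_zero
  rw [slope, dif_neg h0, Units.val_inv_eq_inv_val, Units.val_mk0, h.idealValue_eq]

theorem ratFuncValuation_le_iff (h : AttainsIdealValue V I x) (p : L[X]) (g : V.ValueGroup) :
    ratFuncValuation V.valuation (slope V I) (algebraMap L[X] (RatFunc L) p) ≤ g ↔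
      ∀ n, V.valuation (p.coeff n) ≤ g * V.valuation (algebraMap R L x) ^ n := by
  have hpos : ∀ n : ℕ, 0 < V.valuation (algebraMap R L x) ^ n := fun n =>
    pow_pos (zero_lt_iff.2 h.valuation_ne_zero) n
  have hterm : ∀ n, V.valuation (p.coeff n) * (slope V I : V.ValueGroup) ^ n ≤ g ↔
      V.valuation (p.coeff n) ≤ g * V.valuation (algebraMap R L x) ^ n := fun n => by
    rw [h.slope_eq, inv_pow, mul_inv_le_iff₀ (hpos n)]
  rw [ratFuncValuation_poly]
  exact ⟨fun hp n => (hterm n).1 ((le_gaussValue _ _ p n).trans hp),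
    fun hp => gaussValue_le _ _ _ _ fun n => (hterm n).2 (hp n)⟩

theorem ratFuncValuation_lt_iff (h : AttainsIdealValue V I x) (p : L[X]) {g : V.ValueGroup}
    (hg : 0 < g) :
    ratFuncValuation V.valuation (slope V I) (algebraMap L[X] (RatFunc L) p) < g ↔
      ∀ n, V.valuation (p.coeff n) < g * V.valuation (algebraMap R L x) ^ n := by
  have hpos : ∀ n : ℕ, 0 < V.valuation (algebraMap R L x) ^ n := fun n =>
    pow_pos (zero_lt_iff.2 h.valuation_ne_zero) n
  have hterm : ∀ n, V.valuation (p.coeff n) * (slope V I : V.ValueGroup) ^ n < g ↔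
      V.valuation (p.coeff n) < g * V.valuation (algebraMap R L x) ^ n := fun n => by
    rw [h.slope_eq, inv_pow, mul_inv_lt_iff₀ (hpos n)]
  rw [ratFuncValuation_poly]
  refine ⟨fun hp n => (hterm n).1 ((le_gaussValue _ _ p n).trans_lt hp), fun hp => ?_⟩
  exact (Finset.sup_lt_iff hg).2 fun n _ => (hterm n).2 (hp n)

theorem ratFuncValuation_polyMap_le_iff (h : AttainsIdealValue V I x) (q : R[X])
    (g : V.ValueGroup) : ratFuncValuation V.valuation (slope V I) (polyMap L q) ≤ g ↔
      ∀ n, V.valuation (algebraMap R L (q.coeff n)) ≤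
        g * V.valuation (algebraMap R L x) ^ n := by
  simp_rw [polyMap_apply, h.ratFuncValuation_le_iff, coeff_map]

theorem ratFuncValuation_polyMap_lt_iff (h : AttainsIdealValue V I x) (q : R[X])
    {g : V.ValueGroup} (hg : 0 < g) :
    ratFuncValuation V.valuation (slope V I) (polyMap L q) < g ↔
      ∀ n, V.valuation (algebraMap R L (q.coeff n)) <
        g * V.valuation (algebraMap R L x) ^ n := by
  simp_rw [polyMap_apply, h.ratFuncValuation_lt_iff _ hg, coeff_map]

theorem ratFuncValuation_X (h : AttainsIdealValue V I x) :
    ratFuncValuation V.valuation (slope V I) RatFunc.X =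
      (V.valuation (algebraMap R L x))⁻¹ := by
  rw [← RatFunc.algebraMap_X, ratFuncValuation_poly, ← h.slope_eq]
  apply le_antisymm
  · refine gaussValue_le _ _ _ _ fun n => ?_
    rw [coeff_X]
    split_ifs with hn
    · simp [← hn]
    · simp
  · simpa using le_gaussValue V.valuation (slope V I) X 1

theorem ratFuncValuation_chartVariable (h : AttainsIdealValue V I x) :
    ratFuncValuation V.valuation (slope V I) (chartVariable L x) = 1 := by
  rw [chartVariable, map_mul, h.ratFuncValuation_X, ratFuncValuation_algebraMap,
    mul_inv_cancel₀ h.valuation_ne_zero]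

theorem reesRing_le (h : AttainsIdealValue V I x) (hV : ∀ r : R, algebraMap R L r ∈ V) :
    reesRing L I ≤ (reesExtension V I).toSubring := by
  intro z hz
  obtain ⟨q, hq, rfl⟩ := (mem_reesRing_iff I z).1 hz
  refine (mem_reesExtension_iff _).2 ((h.ratFuncValuation_polyMap_le_iff _ _).2 fun n => ?_)
  rw [one_mul]
  exact valuation_le_pow _ (fun r => (V.valuation_le_one_iff _).2 (hV r)) I h.le n (hq n)

end AttainsIdealValue

end Complete

/-! ### Charts of the blowup and Laurent rings -/

section Charts

variable {R : Type*} [CommRing R] {L : Type*} [Field L] [Algebra R L]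

/-- The elements of `A = R[Ix⁻¹]` are the fractions `b / x^n` with `b ∈ I^n`. -/
theorem mem_chart_iff {I : Ideal R} {x : R} (hx : x ∈ I) (hx0 : algebraMap R L x ≠ 0) (z : L) :
    z ∈ chart L I x ↔ ∃ n : ℕ, ∃ b ∈ I ^ n, z = algebraMap R L b / algebraMap R L x ^ n := by
  constructor
  · intro hz
    induction hz using Algebra.adjoin_induction with
    | mem z hz =>
      obtain ⟨y, hy, rfl⟩ := hz
      exact ⟨1, y, by simpa using hy, by simp⟩
    | algebraMap r => exact ⟨0, r, by simp, by simp⟩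
    | add u v _ _ hu hv =>
      obtain ⟨n, b, hb, rfl⟩ := hu
      obtain ⟨m, c, hc, rfl⟩ := hv
      refine ⟨n + m, b * x ^ m + x ^ n * c, ?_, ?_⟩
      · rw [pow_add]
        exact Ideal.add_mem _ (Ideal.mul_mem_mul hb (Ideal.pow_mem_pow hx m))
          (Ideal.mul_mem_mul (Ideal.pow_mem_pow hx n) hc)
      · simp only [map_add, map_mul, map_pow, pow_add]
        field_simp
    | mul u v _ _ hu hv =>
      obtain ⟨n, b, hb, rfl⟩ := hu
      obtain ⟨m, c, hc, rfl⟩ := hv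
      refine ⟨n + m, b * c, ?_, ?_⟩
      · rw [pow_add]
        exact Ideal.mul_mem_mul hb hc
      · simp only [map_mul, pow_add]
        field_simp
  · rintro ⟨n, b, hb, rfl⟩
    induction n generalizing b with
    | zero => simpa using (show algebraMap R L b ∈ chart L I x from Subalgebra.algebraMap_mem _ b)
    | succ n ih =>
      rw [pow_succ] at hb
      induction hb using Submodule.mul_induction_on' with
      | mem_mul_mem b hb y hy =>
        have h1 := (chart L I x).mul_mem (ih b hb)
          (Algebra.subset_adjoin (R := R) (show algebraMap R L y / algebraMap R L x ∈ _ from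
            ⟨y, hy, rfl⟩))
        convert h1 using 1
        rw [map_mul, pow_succ]
        field_simp
      | add b _ c _ hb hc =>
        rw [map_add, add_div]
        exact add_mem hb hc

theorem algebraMap_mem_chart (I : Ideal R) (x : R) (r : R) : algebraMap R L r ∈ chart L I x :=
  (Algebra.adjoin R _).algebraMap_mem r

theorem div_mem_chart (I : Ideal R) (x : R) {y : R} (hy : y ∈ I) :
    algebraMap R L y / algebraMap R L x ∈ chart L I x :=
  Algebra.subset_adjoin (R := R) ⟨y, hy, rfl⟩

theorem isNoetherianRing_reesRing [IsNoetherianRing R] (I : Ideal R) :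
    IsNoetherianRing (reesRing L I) := by
  let f : reesAlgebra I →+* reesRing L I :=
    ((polyMap L).comp (reesAlgebra I).val.toRingHom).codRestrict (reesRing L I)
      fun q => ⟨q, q.2, rfl⟩
  refine isNoetherianRing_of_surjective _ _ f ?_
  rintro ⟨_, q, hq, rfl⟩
  exact ⟨⟨q, hq⟩, rfl⟩

/-- The chart is the image of the Rees algebra under `Z ↦ x⁻¹`. -/
theorem isNoetherianRing_chart [IsNoetherianRing R] {I : Ideal R} {x : R} (hx : x ∈ I)
    (hx0 : algebraMap R L x ≠ 0) : IsNoetherianRing (chart L I x) := by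
  let f : reesAlgebra I →+* chart L I x :=
    ((eval₂RingHom (algebraMap R L) (algebraMap R L x)⁻¹).comp
      (reesAlgebra I).val.toRingHom).codRestrict (chart L I x) fun q => by
      change eval₂ (algebraMap R L) (algebraMap R L x)⁻¹ (q : R[X]) ∈ _
      rw [eval₂_eq_sum, Polynomial.sum]
      refine sum_mem fun n _ =>
        (mem_chart_iff hx hx0 _).2 ⟨n, _, (mem_reesAlgebra_iff I q).1 q.2 n, ?_⟩
      rw [inv_pow, div_eq_mul_inv]
  refine isNoetherianRing_of_surjective _ _ f ?_
  rintro ⟨z, hz⟩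
  obtain ⟨n, b, hb, rfl⟩ := (mem_chart_iff hx hx0 _).1 hz
  refine ⟨⟨monomial n b, reesAlgebra.monomial_mem.2 hb⟩, Subtype.ext ?_⟩
  change eval₂ (algebraMap R L) (algebraMap R L x)⁻¹ (monomial n b) = _
  rw [eval₂_monomial, inv_pow]
  exact (div_eq_mul_inv _ _).symm

theorem isFractionRing_chart [IsFractionRing R L] (I : Ideal R) (x : R) :
    IsFractionRing (chart L I x) L := by
  rcases subsingleton_or_nontrivial R with h | h
  · exact (not_subsingleton L (IsLocalization.subsingleton_iff (R := R) (S := L)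
      (M := nonZeroDivisors R) |>.2 (Subsingleton.elim (0 : R) 1 ▸ Submonoid.one_mem _))).elim
  refine isFractionRing_of_forall_exists_div _ fun z => ?_
  obtain ⟨a, b, hb, rfl⟩ := IsFractionRing.div_surjective (A := R) z
  exact ⟨_, algebraMap_mem_chart I x a, _, algebraMap_mem_chart I x b,
    IsFractionRing.to_map_ne_zero_of_mem_nonZeroDivisors hb, rfl⟩

theorem chartVariable_ne_zero {x : R} (hx0 : algebraMap R L x ≠ 0) : chartVariable L x ≠ 0 :=
  mul_ne_zero ((map_ne_zero_iff _ (algebraMap L (RatFunc L)).injective).2 hx0) RatFunc.X_ne_zero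

theorem chartVariable_eq (x : R) :
    chartVariable L x = algebraMap R (RatFunc L) x * RatFunc.X := by
  rw [chartVariable, ← algebraMap_ratFunc_eq]

theorem chartVariable_mem_reesRing {I : Ideal R} {x : R} (hx : x ∈ I) :
    chartVariable L x ∈ reesRing L I := by
  rw [chartVariable_eq]
  simpa using monomial_mem_reesRing (L := L) (n := 1) (show x ∈ I ^ 1 by simpa using hx)

/-- `bZ^n = (b / x^n) Y^n`. -/
theorem monomial_eq_mul_chartVariable_pow {x : R} (hx0 : algebraMap R L x ≠ 0) (b : R) (n : ℕ) :
    algebraMap R (RatFunc L) b * RatFunc.X ^ n =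
      algebraMap L (RatFunc L) (algebraMap R L b / algebraMap R L x ^ n) *
        chartVariable L x ^ n := by
  have h0 : algebraMap L (RatFunc L) (algebraMap R L x) ≠ 0 :=
    (map_ne_zero_iff _ (algebraMap L (RatFunc L)).injective).2 hx0
  rw [chartVariable, mul_pow, ← mul_assoc, map_div₀, map_pow, div_mul_cancel₀ _ (pow_ne_zero _ h0),
    algebraMap_ratFunc_eq]

theorem algebraMap_mem_laurentRing {A : Subring L} (Y : RatFunc L) {a : L} (ha : a ∈ A) :
    algebraMap L (RatFunc L) a ∈ laurentRing A Y :=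
  (le_sup_left : _ ≤ laurentRing A Y) ⟨a, ha, rfl⟩

theorem mem_laurentRing_self (A : Subring L) (Y : RatFunc L) : Y ∈ laurentRing A Y :=
  (le_sup_right : _ ≤ laurentRing A Y) (Subring.subset_closure (by simp))

theorem inv_mem_laurentRing (A : Subring L) (Y : RatFunc L) : Y⁻¹ ∈ laurentRing A Y :=
  (le_sup_right : _ ≤ laurentRing A Y) (Subring.subset_closure (by simp))

theorem reesRing_le_laurentRing {I : Ideal R} {x : R} (hx : x ∈ I) (hx0 : algebraMap R L x ≠ 0) :
    reesRing L I ≤ laurentRing (chart L I x) (chartVariable L x) := by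
  intro z hz
  obtain ⟨q, hq, rfl⟩ := (mem_reesRing_iff I z).1 hz
  rw [q.as_sum_support, map_sum]
  refine sum_mem fun n _ => ?_
  rw [polyMap_monomial, monomial_eq_mul_chartVariable_pow hx0]
  exact mul_mem (algebraMap_mem_laurentRing _ ((mem_chart_iff hx hx0 _).2 ⟨n, _, hq n, rfl⟩))
    (pow_mem (mem_laurentRing_self _ _) n)

/-- `B = E[Y⁻¹]`. -/
theorem mem_laurentRing_iff {I : Ideal R} {x : R} (hx : x ∈ I) (hx0 : algebraMap R L x ≠ 0)
    (z : RatFunc L) : z ∈ laurentRing (chart L I x) (chartVariable L x) ↔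
      ∃ n : ℕ, z * chartVariable L x ^ n ∈ reesRing L I := by
  have hY := chartVariable_mem_reesRing (L := L) hx
  have hY0 := chartVariable_ne_zero hx0
  constructor
  · intro hz
    let B' : Subring (RatFunc L) :=
      { carrier := {z | ∃ n : ℕ, z * chartVariable L x ^ n ∈ reesRing L I}
        mul_mem' := by
          rintro a b ⟨n, hn⟩ ⟨m, hm⟩
          refine ⟨n + m, ?_⟩
          have := mul_mem hn hm
          rwa [mul_mul_mul_comm, ← pow_add] at this
        one_mem' := ⟨0, by simp⟩
        add_mem' := by
          rintro a b ⟨n, hn⟩ ⟨m, hm⟩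
          refine ⟨n + m, ?_⟩
          have := add_mem (mul_mem hn (pow_mem hY m)) (mul_mem hm (pow_mem hY n))
          convert this using 1
          ring
        zero_mem' := ⟨0, by simp⟩
        neg_mem' := by
          rintro a ⟨n, hn⟩
          exact ⟨n, by rw [neg_mul]; exact neg_mem hn⟩ }
    have hle : laurentRing (chart L I x) (chartVariable L x) ≤ B' := by
      refine sup_le ?_ (Subring.closure_le.2 ?_)
      · rintro _ ⟨a, ha, rfl⟩
        obtain ⟨n, b, hb, rfl⟩ := (mem_chart_iff hx hx0 a).1 ha
        refine ⟨n, ?_⟩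
        rw [← monomial_eq_mul_chartVariable_pow hx0]
        exact monomial_mem_reesRing hb
      · rintro _ (rfl | rfl)
        · exact ⟨0, by simpa using hY⟩
        · exact ⟨1, by simp [hY0]⟩
    exact hle hz
  · rintro ⟨n, hn⟩
    have := mul_mem (reesRing_le_laurentRing hx hx0 hn)
      (pow_mem (inv_mem_laurentRing (chart L I x) (chartVariable L x)) n)
    rwa [inv_pow, mul_inv_cancel_right₀ (pow_ne_zero _ hY0)] at this

/-- `A = B ∩ L`. -/
theorem mem_chart_of_algebraMap_mem_laurentRing
    {I : Ideal R} {x : R} (hx : x ∈ I) (hx0 : algebraMap R L x ≠ 0) {a : L}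
    (ha : algebraMap L (RatFunc L) a ∈ laurentRing (chart L I x) (chartVariable L x)) :
    a ∈ chart L I x := by
  obtain ⟨n, hn⟩ := (mem_laurentRing_iff hx hx0 _).1 ha
  obtain ⟨q, hq, hqa⟩ := (mem_reesRing_iff I _).1 hn
  refine (mem_chart_iff hx hx0 a).2 ⟨n, q.coeff n, hq n, ?_⟩
  have h1 : q.map (algebraMap R L) = monomial n (a * algebraMap R L x ^ n) := by
    apply algebraMap_poly_injective L
    rw [← polyMap_apply, hqa, chartVariable, ← C_mul_X_pow_eq_monomial, map_mul, map_pow,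
      RatFunc.algebraMap_X, mul_pow, map_mul, ← mul_assoc, map_pow, map_mul, map_pow]
    rfl
  have h2 := congrArg (fun p => p.coeff n) h1
  simp only [coeff_map, coeff_monomial, if_true] at h2
  rw [h2, mul_div_cancel_right₀ _ (pow_ne_zero _ hx0)]

theorem isLocalization_laurentRing {I : Ideal R} {x : R} (hx : x ∈ I)
    (hx0 : algebraMap R L x ≠ 0) :
    letI := (Subring.inclusion (reesRing_le_laurentRing (L := L) hx hx0)).toAlgebra
    IsLocalization (Submonoid.powers
      (⟨_, chartVariable_mem_reesRing hx⟩ : reesRing L I))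
      (laurentRing (chart L I x) (chartVariable L x)) := by
  let := (Subring.inclusion (reesRing_le_laurentRing (L := L) hx hx0)).toAlgebra
  have hY0 := chartVariable_ne_zero hx0
  have hunit : ∀ y : Submonoid.powers (⟨_, chartVariable_mem_reesRing hx⟩ : reesRing L I),
      IsUnit (algebraMap (reesRing L I) (laurentRing (chart L I x) (chartVariable L x)) y) := by
    rintro ⟨_, n, rfl⟩
    dsimp only
    rw [map_pow]
    refine IsUnit.pow n (IsUnit.of_mul_eq_one ⟨_, inv_mem_laurentRing _ _⟩ (Subtype.ext ?_))
    exact mul_inv_cancel₀ hY0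
  refine ⟨hunit, ?_, ?_⟩
  · rintro ⟨z, hz⟩
    obtain ⟨n, hn⟩ := (mem_laurentRing_iff hx hx0 z).1 hz
    exact ⟨⟨⟨_, hn⟩, ⟨_, n, rfl⟩⟩, Subtype.ext rfl⟩
  · intro a b hab
    refine ⟨1, ?_⟩
    have : (a : RatFunc L) = b := congrArg (Subtype.val (p := (· ∈ laurentRing _ _))) hab
    rw [Subtype.ext this]

theorem isNoetherianRing_laurentRing [IsNoetherianRing R] {I : Ideal R} {x : R} (hx : x ∈ I)
    (hx0 : algebraMap R L x ≠ 0) :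
    IsNoetherianRing (laurentRing (chart L I x) (chartVariable L x)) := by
  let := (Subring.inclusion (reesRing_le_laurentRing (L := L) hx hx0)).toAlgebra
  have := isLocalization_laurentRing (L := L) hx hx0
  exact IsLocalization.isNoetherianRing (Submonoid.powers
      (⟨_, chartVariable_mem_reesRing hx⟩ : reesRing L I)) _ (isNoetherianRing_reesRing I)

theorem isFractionRing_reesRing [IsDomain R] [IsFractionRing R L] {I : Ideal R} {x : R} (hx : x ∈ I)
    (hx0 : algebraMap R L x ≠ 0) : IsFractionRing (reesRing L I) (RatFunc L) := by
  let D : Subfield (RatFunc L) :=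
    { carrier := {z | ∃ a ∈ reesRing L I, ∃ b ∈ reesRing L I, b ≠ 0 ∧ z = a / b}
      mul_mem' := by
        rintro _ _ ⟨a, ha, b, hb, hb0, rfl⟩ ⟨c, hc, d, hd, hd0, rfl⟩
        exact ⟨_, mul_mem ha hc, _, mul_mem hb hd, mul_ne_zero hb0 hd0, div_mul_div_comm ..⟩
      one_mem' := ⟨1, one_mem _, 1, one_mem _, one_ne_zero, by simp⟩
      add_mem' := by
        rintro _ _ ⟨a, ha, b, hb, hb0, rfl⟩ ⟨c, hc, d, hd, hd0, rfl⟩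
        exact ⟨_, add_mem (mul_mem ha hd) (mul_mem hb hc), _, mul_mem hb hd, mul_ne_zero hb0 hd0,
          div_add_div _ _ hb0 hd0⟩
      zero_mem' := ⟨0, zero_mem _, 1, one_mem _, one_ne_zero, by simp⟩
      neg_mem' := by
        rintro _ ⟨a, ha, b, hb, hb0, rfl⟩
        exact ⟨_, neg_mem ha, _, hb, hb0, (neg_div _ _).symm⟩
      inv_mem' := by
        rintro _ ⟨a, ha, b, hb, hb0, rfl⟩
        by_cases ha0 : a = 0
        · exact ⟨0, zero_mem _, 1, one_mem _, one_ne_zero, by simp [ha0]⟩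
        · exact ⟨_, hb, _, ha, ha0, inv_div _ _⟩ }
  have hE : ∀ e ∈ reesRing L I, e ∈ D := fun e he => ⟨e, he, 1, one_mem _, one_ne_zero, by simp⟩
  have hC : ∀ a : L, algebraMap L (RatFunc L) a ∈ D := by
    intro a
    obtain ⟨r, s, -, rfl⟩ := IsFractionRing.div_surjective (A := R) a
    rw [map_div₀, ← algebraMap_ratFunc_eq, ← algebraMap_ratFunc_eq]
    exact div_mem (hE _ (algebraMap_mem_reesRing I r)) (hE _ (algebraMap_mem_reesRing I s))
  have hX : (RatFunc.X : RatFunc L) ∈ D := by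
    have h := div_mem (hE _ (chartVariable_mem_reesRing (L := L) hx)) (hC (algebraMap R L x))
    rwa [chartVariable, mul_div_cancel_left₀] at h
    exact (map_ne_zero_iff _ (algebraMap L (RatFunc L)).injective).2 hx0
  have hpoly : ∀ p : L[X], algebraMap L[X] (RatFunc L) p ∈ D := by
    intro p
    rw [p.as_sum_support_C_mul_X_pow, map_sum]
    refine sum_mem fun n _ => ?_
    rw [map_mul, map_pow, RatFunc.algebraMap_X]
    exact mul_mem (hC _) (pow_mem hX n)
  refine isFractionRing_of_forall_exists_div _ fun z => ?_
  obtain ⟨p, q, -, rfl⟩ := IsFractionRing.div_surjective (A := L[X]) z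
  exact div_mem (hpoly p) (hpoly q)

/-- A normal domain is the intersection of the valuation rings containing it. -/
theorem exists_algebraMap_eq_of_forall_mem_valuationSubring [IsDomain R] [IsFractionRing R L]
    [IsIntegrallyClosed R] {a : L}
    (ha : ∀ V : ValuationSubring L, (∀ r : R, algebraMap R L r ∈ V) → a ∈ V) :
    ∃ r : R, algebraMap R L r = a := by
  have hbij : Function.Bijective (algebraMap R L).rangeRestrict :=
    ⟨fun r s h => IsFractionRing.injective R L (congrArg Subtype.val h),
      (algebraMap R L).rangeRestrict_surjective⟩
  let e : R ≃+* (algebraMap R L).range := RingEquiv.ofBijective _ hbij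
  have hclosed : ∀ z : L, IsIntegral (algebraMap R L).range z → z ∈ (algebraMap R L).range := by
    intro z hz
    have : IsIntegral R z := isIntegral_of_ringHom (e.symm : (algebraMap R L).range →+* R) (by
      intro s
      obtain ⟨r, rfl⟩ := e.surjective s
      simp only [RingHom.coe_coe, RingEquiv.symm_apply_apply]
      rfl) hz
    exact IsIntegrallyClosed.algebraMap_eq_of_integral this
  have : IsIntegrallyClosedIn (algebraMap R L).range L :=
    isIntegrallyClosedIn_iff.2 ⟨Subtype.val_injective, fun {z} hz => ⟨⟨z, hclosed z hz⟩, rfl⟩⟩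
  by_contra hne
  obtain ⟨V, hV, haV⟩ := (algebraMap R L).range.exists_le_valuationSubring_of_isIntegrallyClosedIn
    (x := a) hne
  exact haV (ha V fun r => hV ⟨r, rfl⟩)

/-- The Rees ring of a normal ideal is the intersection of `L[Z]` with the `(R, I)`-extensions of
all the valuation rings containing `R`, and all of these rings are integrally closed. -/
theorem mem_reesRing_of_isIntegral [IsDomain R] [IsFractionRing R L] [IsIntegrallyClosed R]
    [IsNoetherianRing R] {I : Ideal R} (hI0 : I ≠ ⊥) (hI : IsNormalIdeal L I) {z : RatFunc L}
    (hz : IsIntegral (reesRing L I) z) : z ∈ reesRing L I := by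
  have hL := IsFractionRing.injective R L
  have hz1 : IsIntegral L[X] z := by
    let e : (reesAlgebra I).toSubring ≃+* reesRing L I :=
      Subring.equivMapOfInjective _ (polyMap L) (polyMap_injective L hL)
    refine isIntegral_of_ringHom ((mapRingHom (algebraMap R L)).comp
      ((reesAlgebra I).toSubring.subtype.comp (e.symm : reesRing L I →+* _))) (fun s => ?_) hz
    obtain ⟨q, rfl⟩ := e.surjective s
    simp only [RingHom.comp_apply, RingHom.coe_coe, RingEquiv.symm_apply_apply]
    rfl
  obtain ⟨p, rfl⟩ := IsIntegrallyClosed.algebraMap_eq_of_integral hz1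
  have hp : ∀ V : ValuationSubring L, (∀ r : R, algebraMap R L r ∈ V) →
      ∃ x, AttainsIdealValue V I x ∧
        ∀ n, V.valuation (p.coeff n) ≤ V.valuation (algebraMap R L x) ^ n := by
    intro V hV
    obtain ⟨x, hx⟩ := exists_attainsIdealValue hL hV hI0
    refine ⟨x, hx, ?_⟩
    have h1 : IsIntegral (reesExtension V I) (algebraMap L[X] (RatFunc L) p) :=
      isIntegral_of_ringHom (Subring.inclusion (hx.reesRing_le hV)) (fun _ => rfl) hz
    obtain ⟨w, hw⟩ := IsIntegrallyClosed.algebraMap_eq_of_integral h1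
    have h2 : algebraMap L[X] (RatFunc L) p ∈ reesExtension V I := hw ▸ w.2
    rw [mem_reesExtension_iff, hx.ratFuncValuation_le_iff] at h2
    simpa using h2
  have hcoeff : ∀ n, ∃ r ∈ I ^ n, algebraMap R L r = p.coeff n := by
    intro n
    obtain ⟨r, hr⟩ := exists_algebraMap_eq_of_forall_mem_valuationSubring (R := R) (a := p.coeff n)
      (by
        intro V hV
        obtain ⟨x, hx, h⟩ := hp V hV
        exact (V.valuation_le_one_iff _).1 ((h n).trans
          (pow_le_one₀ zero_le ((V.valuation_le_one_iff _).2 (hV x)))))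
    refine ⟨r, ?_, hr⟩
    rcases n.eq_zero_or_pos with rfl | hn
    · simp
    · refine (hI n hn).mem_of_valuation_le fun V hV => ?_
      obtain ⟨x, hx, h⟩ := hp V hV
      exact ⟨x ^ n, Ideal.pow_mem_pow hx.mem n, by rw [hr, map_pow, map_pow]; exact h n⟩
  choose r hr hrp using hcoeff
  have hsum : algebraMap L[X] (RatFunc L) p =
      ∑ n ∈ p.support, algebraMap R (RatFunc L) (r n) * RatFunc.X ^ n := by
    conv_lhs => rw [p.as_sum_support_C_mul_X_pow]
    rw [map_sum]
    refine Finset.sum_congr rfl fun n _ => ?_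
    rw [map_mul, map_pow, RatFunc.algebraMap_X, algebraMap_ratFunc_eq, hrp]
    rfl
  rw [hsum]
  exact sum_mem fun n _ => monomial_mem_reesRing (hr n)

end Charts

/-! ### Normality of the Rees ring and of the charts -/

section NormalCharts

variable {R : Type*} [CommRing R] [IsDomain R] [IsNoetherianRing R] [IsIntegrallyClosed R]
  {L : Type*} [Field L] [Algebra R L] [IsFractionRing R L] {I : Ideal R}

/-- The field of quotients of `E` is `L(Z)`, so that `E` is normal once it is integrally closed in
`L(Z)`. -/
theorem isIntegrallyClosed_reesRing (hI0 : I ≠ ⊥) (hI : IsNormalIdeal L I) :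
    IsIntegrallyClosed (reesRing L I) := by
  obtain ⟨x, hx, hx0⟩ := Submodule.exists_mem_ne_zero_of_ne_bot hI0
  have hx0' : algebraMap R L x ≠ 0 := (map_ne_zero_iff _ (IsFractionRing.injective R L)).2 hx0
  have := isFractionRing_reesRing (L := L) hx hx0'
  exact (isIntegrallyClosed_iff (RatFunc L)).2 fun {z} hz =>
    ⟨⟨z, mem_reesRing_of_isIntegral hI0 hI hz⟩, rfl⟩

theorem isIntegrallyClosed_laurentRing (hI : IsNormalIdeal L I) {x : R} (hx : x ∈ I)
    (hx0 : algebraMap R L x ≠ 0) :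
    IsIntegrallyClosed (laurentRing (chart L I x) (chartVariable L x)) := by
  have hI0 : I ≠ ⊥ := by
    rintro rfl
    rw [Submodule.mem_bot] at hx
    exact hx0 (by rw [hx, map_zero])
  let := (Subring.inclusion (reesRing_le_laurentRing (L := L) hx hx0)).toAlgebra
  have := isLocalization_laurentRing (L := L) hx hx0
  have := isIntegrallyClosed_reesRing (L := L) hI0 hI
  refine isIntegrallyClosed_of_isLocalization (R := reesRing L I) _ (Submonoid.powers
      (⟨_, chartVariable_mem_reesRing hx⟩ : reesRing L I)) ?_
  refine powers_le_nonZeroDivisors_of_noZeroDivisors fun h => ?_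
  exact chartVariable_ne_zero hx0 (congrArg Subtype.val h)

/-- `A = B ∩ L` is integrally closed in `L` since `B = E[Y⁻¹]` is normal. -/
theorem mem_chart_of_isIntegral (hI : IsNormalIdeal L I) {x : R} (hx : x ∈ I)
    (hx0 : algebraMap R L x ≠ 0) {z : L} (hz : IsIntegral (chart L I x) z) :
    z ∈ chart L I x := by
  have hI0 : I ≠ ⊥ := by
    rintro rfl
    rw [Submodule.mem_bot] at hx
    exact hx0 (by rw [hx, map_zero])
  have hE := isFractionRing_reesRing (L := L) hx hx0
  have hB := isIntegrallyClosed_laurentRing hI hx hx0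
  have hfrac : IsFractionRing (laurentRing (chart L I x) (chartVariable L x)) (RatFunc L) := by
    refine isFractionRing_of_forall_exists_div _ fun z => ?_
    obtain ⟨a, b, hb, rfl⟩ := IsFractionRing.div_surjective (A := reesRing L I) z
    exact ⟨a, reesRing_le_laurentRing hx hx0 a.2, b, reesRing_le_laurentRing hx hx0 b.2,
      fun h => nonZeroDivisors.ne_zero hb (Subtype.ext h), rfl⟩
  have h1 : IsIntegral (laurentRing (chart L I x) (chartVariable L x))
      (algebraMap L (RatFunc L) z) := by
    have h2 : IsIntegral (chart L I x) (algebraMap L (RatFunc L) z) :=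
      hz.map (IsScalarTower.toAlgHom (chart L I x) L (RatFunc L))
    refine isIntegral_of_ringHom ((algebraMap L (RatFunc L)).restrict (chart L I x)
      (laurentRing (chart L I x) (chartVariable L x))
      fun a ha => algebraMap_mem_laurentRing _ ha) (fun a => ?_) h2
    rw [IsScalarTower.algebraMap_apply (chart L I x) L (RatFunc L)]
    rfl
  obtain ⟨w, hw⟩ := IsIntegrallyClosed.algebraMap_eq_of_integral h1
  exact mem_chart_of_algebraMap_mem_laurentRing hx hx0 (hw ▸ w.2)

theorem isIntegrallyClosed_chart (hI : IsNormalIdeal L I) {x : R} (hx : x ∈ I)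
    (hx0 : algebraMap R L x ≠ 0) : IsIntegrallyClosed (chart L I x) := by
  have := isFractionRing_chart (L := L) I x
  exact (isIntegrallyClosed_iff L).2 fun {z} hz => ⟨⟨z, mem_chart_of_isIntegral hI hx hx0 hz⟩, rfl⟩

end NormalCharts

/-! ### From a chart to the Laurent ring and the Rees ring -/

section Transfer

variable {R : Type*} [CommRing R] {L : Type*} [Field L] [Algebra R L] {I : Ideal R}
  {V : ValuationSubring L} {x : R}

theorem AttainsIdealValue.of_chart_le (hx : x ∈ I) (hx0 : algebraMap R L x ≠ 0)
    (h : chart L I x ≤ V.toSubring) : AttainsIdealValue V I x := by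
  refine ⟨hx, hx0, fun y hy => ?_⟩
  have h1 := (V.valuation_le_one_iff _).2 (h (div_mem_chart I x hy))
  rwa [map_div₀, div_le_one₀ (zero_lt_iff.2 ((Valuation.ne_zero_iff _).2 hx0))] at h1

theorem AttainsIdealValue.chart_le (h : AttainsIdealValue V I x)
    (hV : ∀ r : R, algebraMap R L r ∈ V) : chart L I x ≤ V.toSubring := by
  intro z hz
  obtain ⟨n, b, hb, rfl⟩ := (mem_chart_iff h.mem h.ne_zero z).1 hz
  refine (V.valuation_le_one_iff _).1 ?_
  rw [map_div₀, map_pow, div_le_one₀ (pow_pos (zero_lt_iff.2 h.valuation_ne_zero) n)]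
  exact valuation_le_pow _ (fun r => (V.valuation_le_one_iff _).2 (hV r)) I h.le n hb

/-- If `V` is a local ring of one chart of the blowup, then it is a local ring of every chart
`R[Ix⁻¹]` with `V(x) = V(I)`. -/
theorem IsLocalizationAtCenter.chart_of_attainsIdealValue {x' : R}
    (h' : AttainsIdealValue V I x') (hc : IsLocalizationAtCenter (chart L I x') V)
    (h : AttainsIdealValue V I x) : IsLocalizationAtCenter (chart L I x) V := by
  have hV : ∀ r : R, algebraMap R L r ∈ V := fun r => hc.le (algebraMap_mem_chart I x' r)
  have hvx : V.valuation (algebraMap R L x) = V.valuation (algebraMap R L x') :=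
    le_antisymm (h'.le x h.mem) (h.le x' h'.mem)
  refine ⟨h.chart_le hV, fun z hz => ?_⟩
  obtain ⟨a, ha, s, hs, hs1, e⟩ := hc.exists_mul_eq z hz
  obtain ⟨n, b, hb, rfl⟩ := (mem_chart_iff h'.mem h'.ne_zero a).1 ha
  obtain ⟨m, c, hcm, rfl⟩ := (mem_chart_iff h'.mem h'.ne_zero s).1 hs
  have hx0 := h.ne_zero
  have hx0' := h'.ne_zero
  -- bring both fractions to the denominator `x' ^ (n + m)`, then replace `x'` by `x`
  refine ⟨_, (mem_chart_iff h.mem hx0 _).2 ⟨n + m, b * x' ^ m, ?_, rfl⟩, _,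
    (mem_chart_iff h.mem hx0 _).2 ⟨n + m, c * x' ^ n, ?_, rfl⟩, ?_, ?_⟩
  · rw [pow_add]
    exact Ideal.mul_mem_mul hb (Ideal.pow_mem_pow h'.mem m)
  · rw [add_comm, pow_add]
    exact Ideal.mul_mem_mul hcm (Ideal.pow_mem_pow h'.mem n)
  · have h0 : V.valuation (algebraMap R L x') ≠ 0 := h'.valuation_ne_zero
    rw [map_div₀, map_pow] at hs1
    rw [map_div₀, map_pow, hvx, map_mul, map_mul, map_pow, map_pow, pow_add]
    rw [div_eq_one_iff_eq (pow_ne_zero _ h0)] at hs1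
    rw [hs1, mul_comm, div_self (mul_ne_zero (pow_ne_zero _ h0) (pow_ne_zero _ h0))]
  · simp only [map_mul, map_pow]
    field_simp at e ⊢
    linear_combination e

theorem AttainsIdealValue.laurentRing_le (h : AttainsIdealValue V I x)
    (hV : ∀ r : R, algebraMap R L r ∈ V) :
    laurentRing (chart L I x) (chartVariable L x) ≤ (reesExtension V I).toSubring := by
  intro z hz
  obtain ⟨n, hn⟩ := (mem_laurentRing_iff h.mem h.ne_zero z).1 hz
  have h1 := (mem_reesExtension_iff _).1 (h.reesRing_le hV hn)
  rw [map_mul, map_pow, h.ratFuncValuation_chartVariable, one_pow, mul_one] at h1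
  exact (mem_reesExtension_iff _).2 h1

/-- If `V = A_P`, then every polynomial with coefficients (with respect to `Y`) in `V` has a
multiple with coefficients in `A` by an element of `A` outside `P`. -/
theorem IsLocalizationAtCenter.exists_mul_mem_laurentRing
    (hc : IsLocalizationAtCenter (chart L I x) V) (h : AttainsIdealValue V I x) (p : L[X])
    (hp : ratFuncValuation V.valuation (slope V I) (algebraMap L[X] (RatFunc L) p) ≤ 1) :
    ∃ s ∈ chart L I x, V.valuation s = 1 ∧
      algebraMap L (RatFunc L) s * algebraMap L[X] (RatFunc L) p ∈
        laurentRing (chart L I x) (chartVariable L x) := by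
  have hx0 := h.ne_zero
  have hpn : ∀ n, p.coeff n / algebraMap R L x ^ n ∈ V := by
    intro n
    refine (V.valuation_le_one_iff _).1 ?_
    rw [map_div₀, map_pow, div_le_one₀ (pow_pos (zero_lt_iff.2 h.valuation_ne_zero) n)]
    simpa using (h.ratFuncValuation_le_iff p 1).1 hp n
  choose a ha s hs hs1 e using fun n => hc.exists_mul_eq _ (hpn n)
  refine ⟨∏ n ∈ p.support, s n, prod_mem fun n _ => hs n, ?_, ?_⟩
  · rw [map_prod]
    exact Finset.prod_eq_one fun n _ => hs1 n
  · conv in algebraMap L[X] (RatFunc L) p => rw [p.as_sum_support_C_mul_X_pow]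
    rw [map_sum, Finset.mul_sum]
    refine sum_mem fun n hn => ?_
    have h1 : algebraMap L (RatFunc L) (∏ m ∈ p.support, s m) *
        algebraMap L[X] (RatFunc L) (C (p.coeff n) * X ^ n) =
        algebraMap L (RatFunc L) ((∏ m ∈ p.support.erase n, s m) * a n) *
          chartVariable L x ^ n := by
      have h2 : algebraMap L[X] (RatFunc L) (C (p.coeff n)) =
          algebraMap L (RatFunc L) (p.coeff n) := rfl
      rw [← Finset.mul_prod_erase _ _ hn, ← e n, chartVariable, map_mul _ (C _), h2, map_pow,
        RatFunc.algebraMap_X, mul_pow, ← mul_assoc, ← map_mul, ← map_pow (algebraMap L (RatFunc L)),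
        ← mul_assoc, ← map_mul]
      congr 2
      field_simp
    rw [h1]
    exact mul_mem (algebraMap_mem_laurentRing _ (mul_mem (prod_mem fun m _ => hs m) (ha n)))
      (pow_mem (mem_laurentRing_self _ _) n)

/-- If `V` is a local ring of the chart `A`, then its `(R, I)`-extension is a local ring of `B`:
clear the coefficients of numerator and denominator of an element of `W`, after scaling both
so that the denominator has value zero (additively). -/
theorem IsLocalizationAtCenter.laurentRing (hc : IsLocalizationAtCenter (chart L I x) V)
    (h : AttainsIdealValue V I x) :
    IsLocalizationAtCenter (laurentRing (chart L I x) (chartVariable L x))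
      (reesExtension V I) := by
  have hV : ∀ r : R, algebraMap R L r ∈ V := fun r => hc.le (algebraMap_mem_chart I x r)
  refine ⟨h.laurentRing_le hV, fun z hz => ?_⟩
  obtain ⟨p, q, hq, rfl⟩ := IsFractionRing.div_surjective (A := L[X]) z
  have hq0 : q ≠ 0 := nonZeroDivisors.ne_zero hq
  -- normalize so that the denominator has value `1`
  obtain ⟨c, hcv⟩ := V.valuation_surjective
    (ratFuncValuation V.valuation (slope V I) (algebraMap L[X] (RatFunc L) q))
  have hqv : ratFuncValuation V.valuation (slope V I) (algebraMap L[X] (RatFunc L) q) ≠ 0 := by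
    rw [ratFuncValuation_poly]
    exact gaussValue_ne_zero _ _ hq0
  have hc0 : c ≠ 0 := by
    rintro rfl
    rw [map_zero] at hcv
    exact hqv hcv.symm
  have hC : ∀ p : L[X], algebraMap L[X] (RatFunc L) (C c⁻¹ * p) =
      algebraMap L (RatFunc L) c⁻¹ * algebraMap L[X] (RatFunc L) p := fun p => map_mul _ _ _
  have hq1 : ratFuncValuation V.valuation (slope V I)
      (algebraMap L[X] (RatFunc L) (C c⁻¹ * q)) = 1 := by
    rw [hC, map_mul, ratFuncValuation_algebraMap, map_inv₀, hcv, inv_mul_cancel₀ hqv]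
  have hp1 : ratFuncValuation V.valuation (slope V I)
      (algebraMap L[X] (RatFunc L) (C c⁻¹ * p)) ≤ 1 := by
    rw [mem_reesExtension_iff, map_div₀, div_le_one₀ (zero_lt_iff.2 hqv), ← hcv] at hz
    rw [hC, map_mul, ratFuncValuation_algebraMap, map_inv₀,
      inv_mul_le_one₀ (zero_lt_iff.2 ((Valuation.ne_zero_iff _).2 hc0))]
    exact hz
  obtain ⟨s, hs, hs1, hsp⟩ := hc.exists_mul_mem_laurentRing h _ hp1
  obtain ⟨t, ht, ht1, htq⟩ := hc.exists_mul_mem_laurentRing h _ hq1.le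
  refine ⟨_, mul_mem (algebraMap_mem_laurentRing _ ht) hsp, _,
    mul_mem (algebraMap_mem_laurentRing _ hs) htq, ?_, ?_⟩
  · rw [valuation_reesExtension_eq_one_iff, map_mul, map_mul, hq1, ratFuncValuation_algebraMap,
      ratFuncValuation_algebraMap, hs1, ht1, one_mul, one_mul]
  · have hqK : algebraMap L[X] (RatFunc L) q ≠ 0 :=
      (map_ne_zero_iff _ (algebraMap_poly_injective L)).2 hq0
    rw [hC, hC]
    field_simp

/-- `W` is also a local ring of `E`, because `B = E[Y⁻¹]` and `Y` is a unit of `W`. -/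
theorem IsLocalizationAtCenter.reesRing (hc : IsLocalizationAtCenter (chart L I x) V)
    (h : AttainsIdealValue V I x) :
    IsLocalizationAtCenter (reesRing L I) (reesExtension V I) := by
  have hV : ∀ r : R, algebraMap R L r ∈ V := fun r => hc.le (algebraMap_mem_chart I x r)
  have hY0 := chartVariable_ne_zero h.ne_zero
  refine ⟨h.reesRing_le hV, fun z hz => ?_⟩
  obtain ⟨a, ha, s, hs, hs1, e⟩ := (hc.laurentRing h).exists_mul_eq z hz
  obtain ⟨n, hn⟩ := (mem_laurentRing_iff h.mem h.ne_zero a).1 ha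
  obtain ⟨m, hm⟩ := (mem_laurentRing_iff h.mem h.ne_zero s).1 hs
  have hY := chartVariable_mem_reesRing (L := L) h.mem
  refine ⟨_, mul_mem hn (pow_mem hY m), _, mul_mem hm (pow_mem hY n), ?_, ?_⟩
  · rw [valuation_reesExtension_eq_one_iff] at hs1 ⊢
    simp only [map_mul, map_pow, hs1, h.ratFuncValuation_chartVariable, one_pow, mul_one]
  · rw [← e]
    ring

end Transfer

/-! ### The dicritical set -/

section Dicriticals

variable {R : Type*} [CommRing R] {L : Type*} [Field L] [Algebra R L] {I : Ideal R}

theorem isFractionRing_ofPrime_chart [IsDomain R] [IsFractionRing R L]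
    (x : R) (P : Ideal (chart L I x)) [P.IsPrime] :
    IsFractionRing (LocalSubring.ofPrime (chart L I x) P).toSubring L := by
  have hle := LocalSubring.le_ofPrime (chart L I x) P
  refine isFractionRing_of_forall_exists_div _ fun z => ?_
  obtain ⟨a, b, hb, rfl⟩ := IsFractionRing.div_surjective (A := R) z
  exact ⟨_, hle (algebraMap_mem_chart I x a), _, hle (algebraMap_mem_chart I x b),
    IsFractionRing.to_map_ne_zero_of_mem_nonZeroDivisors hb, rfl⟩

theorem isIntegrallyClosed_ofPrime_chart [IsDomain R] [IsNoetherianRing R]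
    [IsIntegrallyClosed R] [IsFractionRing R L]
    (hI : IsNormalIdeal L I) {x : R} (hx : x ∈ I)
    (hx0 : x ≠ 0) (P : Ideal (chart L I x)) [P.IsPrime] :
    IsIntegrallyClosed (LocalSubring.ofPrime (chart L I x) P).toSubring := by
  have := isIntegrallyClosed_chart hI hx
    ((map_ne_zero_iff _ (IsFractionRing.injective R L)).2 hx0)
  exact isIntegrallyClosed_of_isLocalization (R := chart L I x) _ P.primeCompl
    P.primeCompl_le_nonZeroDivisors

theorem mem_of_isIntegral_of_mem_blowup [IsDomain R] [IsNoetherianRing R]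
    [IsIntegrallyClosed R] [IsFractionRing R L]
    (hI : IsNormalIdeal L I) {T : LocalSubring L}
    (hT : T ∈ blowup L I) {z : L} (hz : IsIntegral T.toSubring z) : z ∈ T.toSubring := by
  obtain ⟨x, hx, hx0, P, hP, rfl⟩ := hT
  have := isIntegrallyClosed_ofPrime_chart hI hx hx0 P
  have := isFractionRing_ofPrime_chart x P
  obtain ⟨w, rfl⟩ := IsIntegrallyClosed.algebraMap_eq_of_integral hz
  exact w.2

theorem normalization_blowup [IsDomain R] [IsNoetherianRing R]
    [IsIntegrallyClosed R] [IsFractionRing R L]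
    (hI : IsNormalIdeal L I) :
    normalization (blowup L I) = blowup L I :=
  normalization_eq_self _ fun _ hT _ hz => mem_of_isIntegral_of_mem_blowup hI hT hz

theorem dicriticalSet_eq [IsDomain R] [IsNoetherianRing R]
    [IsIntegrallyClosed R] [IsFractionRing R L]
    (hI : IsNormalIdeal L I) : dicriticalSet L I I = blowupOver L I I 1 :=
  normalization_eq_self _ fun _ hT _ hz => mem_of_isIntegral_of_mem_blowup hI hT.1 hz

/-- `V` is the localization of a chart of the blowup of `I` at its centre, and its maximal ideal
contains `I`. For a normal ideal of a normal noetherian domain these are the valuation rings in the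
dicritical set. -/
structure IsDicritical (I : Ideal R) (V : ValuationSubring L) : Prop where
  exists_chart : ∃ x ∈ I, algebraMap R L x ≠ 0 ∧ IsLocalizationAtCenter (chart L I x) V
  valuation_lt_one : ∀ y ∈ I, V.valuation (algebraMap R L y) < 1

/-- A member of the dicritical set is a one-dimensional normal noetherian local domain, hence a
valuation ring. -/
theorem exists_toLocalSubring_eq_of_mem_dicriticalSet [IsDomain R] [IsNoetherianRing R]
    [IsIntegrallyClosed R] [IsFractionRing R L]
    (hI : IsNormalIdeal L I) {T : LocalSubring L}
    (hT : T ∈ dicriticalSet L I I) : ∃ V : ValuationSubring L, V.toLocalSubring = T := by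
  rw [dicriticalSet_eq hI] at hT
  obtain ⟨⟨x, hx, hx0, P, hP, rfl⟩, hdim, -⟩ := hT
  have := isIntegrallyClosed_ofPrime_chart hI hx hx0 P
  have := isFractionRing_ofPrime_chart x P
  have := isNoetherianRing_chart (L := L) hx
    ((map_ne_zero_iff _ (IsFractionRing.injective R L)).2 hx0)
  set T := LocalSubring.ofPrime (chart L I x) P
  have hnoeth : IsNoetherianRing T.toSubring :=
    IsLocalization.isNoetherianRing P.primeCompl (LocalSubring.ofPrime (chart L I x) P).toSubring
      inferInstance
  have hdim' : Ring.KrullDimLE 1 T.toSubring := Ring.krullDimLE_iff.2 (by rw [hdim])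
  have : IsIntegrallyClosed T.toSubring ∧ ∀ Q : Ideal T.toSubring, Q ≠ ⊥ → Q.IsPrime →
      Q = maximalIdeal T.toSubring := ⟨inferInstance, fun Q hQ hQ' => eq_maximalIdeal
      (Ring.krullDimLE_one_iff_of_isPrime_bot.1 hdim' Q hQ hQ')⟩
  have : ValuationRing T.toSubring :=
    ((tfae_of_isNoetherianRing_of_isLocalRing_of_isDomain T.toSubring).out 1 3).2 this
  exact exists_toLocalSubring_eq T

namespace IsDicritical

variable {V : ValuationSubring L} {x : R}

theorem algebraMap_mem (h : IsDicritical I V) (r : R) : algebraMap R L r ∈ V := by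
  obtain ⟨x, -, -, hc⟩ := h.exists_chart
  exact hc.le (algebraMap_mem_chart I x r)

theorem exists_attainsIdealValue (h : IsDicritical I V) : ∃ x, AttainsIdealValue V I x := by
  obtain ⟨x, hx, hx0, hc⟩ := h.exists_chart
  exact ⟨x, .of_chart_le hx hx0 hc.le⟩

theorem isLocalizationAtCenter_chart (h : IsDicritical I V) (hx : AttainsIdealValue V I x) :
    IsLocalizationAtCenter (chart L I x) V := by
  obtain ⟨x', hx', hx0', hc⟩ := h.exists_chart
  exact hc.chart_of_attainsIdealValue (.of_chart_le hx' hx0' hc.le) hx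

theorem isLocalizationAtCenter_laurentRing (h : IsDicritical I V)
    (hx : AttainsIdealValue V I x) :
    IsLocalizationAtCenter (laurentRing (chart L I x) (chartVariable L x))
      (reesExtension V I) :=
  (h.isLocalizationAtCenter_chart hx).laurentRing hx

theorem isLocalizationAtCenter_reesRing (h : IsDicritical I V) :
    IsLocalizationAtCenter (reesRing L I) (reesExtension V I) := by
  obtain ⟨x, hx⟩ := h.exists_attainsIdealValue
  exact (h.isLocalizationAtCenter_chart hx).reesRing hx

theorem isDiscreteValuationRing [IsNoetherianRing R]
    (h : IsDicritical I V) : IsDiscreteValuationRing V := by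
  obtain ⟨x, hx⟩ := h.exists_attainsIdealValue
  have := isNoetherianRing_chart (L := L) hx.mem hx.ne_zero
  exact (h.isLocalizationAtCenter_chart hx).isDiscreteValuationRing hx.ne_zero
    (h.valuation_lt_one x hx.mem)

theorem reesExtension_valuation_lt_one (h : IsDicritical I V) {y : R} (hy : y ∈ I) :
    (reesExtension V I).valuation (algebraMap R (RatFunc L) y) < 1 := by
  rw [valuation_reesExtension_lt_one_iff, algebraMap_ratFunc_eq, ratFuncValuation_algebraMap]
  exact h.valuation_lt_one y hy

theorem isDiscreteValuationRing_reesExtension [IsNoetherianRing R]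
    (h : IsDicritical I V) :
    IsDiscreteValuationRing (reesExtension V I) := by
  obtain ⟨x, hx⟩ := h.exists_attainsIdealValue
  have := isNoetherianRing_reesRing (L := L) I
  exact h.isLocalizationAtCenter_reesRing.isDiscreteValuationRing
    (algebraMap_ratFunc_ne_zero hx.ne_zero) (h.reesExtension_valuation_lt_one hx.mem)

theorem toLocalSubring_mem_dicriticalSet [IsDomain R] [IsNoetherianRing R]
    [IsIntegrallyClosed R] [IsFractionRing R L]
    (hI : IsNormalIdeal L I) (h : IsDicritical I V) :
    V.toLocalSubring ∈ dicriticalSet L I I := by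
  rw [dicriticalSet_eq hI]
  obtain ⟨x, hx, hx0, hc⟩ := h.exists_chart
  have := h.isDiscreteValuationRing
  refine ⟨⟨x, hx, ?_, hc.center, inferInstance, hc.ofPrime_center.symm⟩, ?_, fun y hy => ?_⟩
  · rintro rfl
    exact hx0 (map_zero _)
  · exact IsDiscreteValuationRing.ringKrullDim_eq_one V
  · exact ⟨⟨_, h.algebraMap_mem y⟩, (V.valuation_lt_one_iff _).2 (h.valuation_lt_one y hy), rfl⟩

theorem of_toLocalSubring_mem [IsDomain R] [IsNoetherianRing R]
    [IsIntegrallyClosed R] [IsFractionRing R L]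
    (hI : IsNormalIdeal L I)
    (h : V.toLocalSubring ∈ dicriticalSet L I I) : IsDicritical I V := by
  rw [dicriticalSet_eq hI] at h
  obtain ⟨⟨x, hx, hx0, P, hP, hV⟩, -, hm⟩ := h
  refine ⟨⟨x, hx, (map_ne_zero_iff _ (IsFractionRing.injective R L)).2 hx0,
    .of_ofPrime_eq hV.symm⟩, fun y hy => ?_⟩
  obtain ⟨t, ht, hty⟩ := hm y hy
  rw [← hty]
  exact (V.valuation_lt_one_iff t).1 ht

end IsDicritical

/-! ### Prime conductors of the extended ideal -/

/-- For a normal ideal, `(I^(n+2) : I) ⊆ I^(n+1)`: divide by an element of `I` whose value is that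
of `I`, for each valuation ring containing `R`. -/
theorem mem_pow_of_forall_mul_mem [IsNoetherianRing R] [IsFractionRing R L]
    (hI0 : I ≠ ⊥) (hI : IsNormalIdeal L I) {n : ℕ} {a : R}
    (h : ∀ y ∈ I, y * a ∈ I ^ (n + 2)) : a ∈ I ^ (n + 1) := by
  refine (hI (n + 1) n.succ_pos).mem_of_valuation_le fun V hV => ?_
  obtain ⟨x, hx⟩ := Dicritical.exists_attainsIdealValue (IsFractionRing.injective R L) hV hI0
  refine ⟨x ^ (n + 1), Ideal.pow_mem_pow hx.mem _, ?_⟩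
  have h1 := valuation_le_pow V.valuation (fun r => (V.valuation_le_one_iff _).2 (hV r)) I hx.le _
    (h x hx.mem)
  rw [map_mul, map_mul, pow_succ'] at h1
  rw [map_pow, map_pow]
  exact (mul_le_mul_iff_right₀ (zero_lt_iff.2 hx.valuation_ne_zero)).1 h1

theorem polyMap_mem_extendIdeal_iff [IsFractionRing R L]
    {q : R[X]} (h : polyMap L q ∈ reesRing L I) :
    (⟨_, h⟩ : reesRing L I) ∈ extendIdeal I (reesRing L I) ↔ ∀ n, q.coeff n ∈ I ^ (n + 1) := by
  rw [mem_extendIdeal_reesRing_iff]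
  constructor
  · rintro ⟨q', hq', e⟩
    rwa [← polyMap_injective L (IsFractionRing.injective R L) e]
  · exact fun h => ⟨q, h, rfl⟩

/-- A prime conductor `(IE : f)` does not contain `IZ`: if `f · IZ ⊆ IE`, then `f ∈ IE`, by
`mem_pow_of_forall_mul_mem` for each coefficient of `f`. -/
theorem exists_chartVariable_notMem [IsNoetherianRing R] [IsFractionRing R L]
    (hI0 : I ≠ ⊥) (hI : IsNormalIdeal L I)
    (P : Ideal (reesRing L I)) [P.IsPrime] (f : reesRing L I)
    (hP : ∀ e, e ∈ P ↔ e * f ∈ extendIdeal I (reesRing L I)) :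
    ∃ x, ∃ hx : x ∈ I, (⟨_, chartVariable_mem_reesRing hx⟩ : reesRing L I) ∉ P := by
  by_contra! hcon
  obtain ⟨f, hf⟩ := f
  obtain ⟨q, hq, rfl⟩ := (mem_reesRing_iff I f).1 hf
  have h1 : (1 : reesRing L I) ∈ P := by
    rw [hP, one_mul, polyMap_mem_extendIdeal_iff]
    refine fun n => mem_pow_of_forall_mul_mem hI0 hI fun y hy => ?_
    have h2 := (hP _).1 (hcon y hy)
    have h3 : polyMap L (monomial 1 y * q) ∈ reesRing L I := by
      rw [map_mul]
      refine mul_mem ?_ hf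
      rw [polyMap_monomial]
      exact monomial_mem_reesRing (by simpa using hy)
    have h4 : (⟨_, h3⟩ : reesRing L I) ∈ extendIdeal I (reesRing L I) := by
      convert h2 using 1
      apply Subtype.ext
      simp only [Subring.coe_mul, map_mul, polyMap_monomial, pow_one, chartVariable_eq]
    have h5 := (polyMap_mem_extendIdeal_iff h3).1 h4 (n + 1)
    rwa [coeff_monomial_mul] at h5
  exact (Ideal.ne_top_iff_one P).1 (Ideal.IsPrime.ne_top ‹_›) h1

theorem monomial_mul_mem_extendIdeal {k n : ℕ} {a b : R} (h : b * a ∈ I ^ (n + k + 1))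
    (he : algebraMap R (RatFunc L) b * RatFunc.X ^ k *
      (algebraMap R (RatFunc L) a * RatFunc.X ^ n) ∈ reesRing L I) :
    (⟨_, he⟩ : reesRing L I) ∈ extendIdeal I (reesRing L I) := by
  refine (mem_extendIdeal_reesRing_iff I _).2 ⟨monomial (n + k) (b * a), fun m => ?_, ?_⟩
  · rw [coeff_monomial]
    split_ifs with hm
    · exact hm ▸ h
    · exact Ideal.zero_mem _
  · rw [polyMap_monomial, map_mul]
    ring

/-- If `P = (IE : f)` is prime, then on homogeneous elements `P` is the conductor of a single
homogeneous component of `f`. -/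
theorem exists_homogeneous_conductor [IsFractionRing R L]
    (P : Ideal (reesRing L I)) [hPp : P.IsPrime]
    {q : R[X]} (hq : ∀ n, q.coeff n ∈ I ^ n)
    (hP : ∀ e : reesRing L I, e ∈ P ↔
      e * ⟨_, (mem_reesRing_iff I _).2 ⟨q, hq, rfl⟩⟩ ∈ extendIdeal I (reesRing L I)) :
    ∃ n, ∀ (k : ℕ) (b : R) (hb : b ∈ I ^ k),
      (⟨_, monomial_mem_reesRing hb⟩ : reesRing L I) ∈ P ↔ b * q.coeff n ∈ I ^ (n + k + 1) := by
  have hdir : ∀ (n k : ℕ) (b : R) (hb : b ∈ I ^ k),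
      (⟨_, monomial_mem_reesRing hb⟩ : reesRing L I) ∈ P → b * q.coeff n ∈ I ^ (n + k + 1) := by
    intro n k b hb h
    have h2 := (hP _).1 h
    have h3 : polyMap L (monomial k b * q) ∈ reesRing L I := by
      rw [map_mul, polyMap_monomial]
      exact mul_mem (monomial_mem_reesRing hb) ((mem_reesRing_iff I _).2 ⟨q, hq, rfl⟩)
    have h4 : (⟨_, h3⟩ : reesRing L I) ∈ extendIdeal I (reesRing L I) := by
      convert h2 using 1
      apply Subtype.ext
      simp only [Subring.coe_mul, map_mul, polyMap_monomial]
    have h5 := (polyMap_mem_extendIdeal_iff h3).1 h4 (n + k)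
    rwa [coeff_monomial_mul] at h5
  by_contra! hcon
  have hcon' : ∀ n, ∃ (k : ℕ) (b : R) (hb : b ∈ I ^ k), b * q.coeff n ∈ I ^ (n + k + 1) ∧
      (⟨_, monomial_mem_reesRing hb⟩ : reesRing L I) ∉ P := by
    intro n
    obtain ⟨k, b, hb, h⟩ := hcon n
    rcases h with h | h
    · exact (h.2 (hdir n k b hb h.1)).elim
    · exact ⟨k, b, hb, h.2, h.1⟩
  choose k b hb hbq hbP using hcon'
  -- the product of the homogeneous elements outside `P` that carry the components of `f` into `IE`
  -- carries `f` into `IE`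
  have hprod : ∏ n ∈ q.support, (⟨_, monomial_mem_reesRing (hb n)⟩ : reesRing L I) ∈ P := by
    rw [hP, reesRing_mk_eq_sum hq, Finset.mul_sum]
    refine Ideal.sum_mem _ fun n hn => ?_
    rw [← Finset.mul_prod_erase _ _ hn, mul_right_comm]
    refine Ideal.mul_mem_right _ _ ?_
    exact monomial_mul_mem_extendIdeal (hbq n) _
  obtain ⟨n, -, hn⟩ := hPp.prod_mem_iff.1 hprod
  exact hbP n hn

end Dicriticals

section AssociatedPrimes

variable {R : Type*} [CommRing R] {L : Type*} [Field L] [Algebra R L] {I : Ideal R}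

theorem IsDicritical.center_reesRing_eq_of_le {V : ValuationSubring L} (h : IsDicritical I V)
    {P : Ideal (reesRing L I)} [P.IsPrime] (hP : P.height = 1)
    (hle : h.isLocalizationAtCenter_reesRing.center ≤ P) :
    h.isLocalizationAtCenter_reesRing.center = P := by
  refine eq_of_le_of_height_eq_one (fun hbot => ?_) hP hle
  obtain ⟨x, hx⟩ := h.exists_attainsIdealValue
  have hxc : (⟨_, algebraMap_mem_reesRing I x⟩ : reesRing L I) ∈
      h.isLocalizationAtCenter_reesRing.center :=
    (IsLocalizationAtCenter.mem_center _ _).2 (h.reesExtension_valuation_lt_one hx.mem)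
  rw [hbot, Submodule.mem_bot] at hxc
  exact algebraMap_ratFunc_ne_zero hx.ne_zero (congrArg Subtype.val hxc)

/-- Every prime of the form `(IE : f)` is the centre on `E` of the `(R, I)`-extension of a member
of the dicritical set. Such a prime `P` has `xZ ∉ P` for some `x ∈ I`, so `IE` is locally
generated by `x` at `P` and `E_P` is a discrete valuation ring; its centre on the chart
`A = R[Ix⁻¹]` is a conductor of `xA`, so that its localization is a discrete valuation ring too. -/
theorem exists_isDicritical_of_conductor [IsDomain R] [IsNoetherianRing R]
    [IsIntegrallyClosed R] [IsFractionRing R L]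
    (hI0 : I ≠ ⊥) (hI : IsNormalIdeal L I)
    (P : Ideal (reesRing L I)) [hPp : P.IsPrime] (f : reesRing L I)
    (hP : ∀ e, e ∈ P ↔ e * f ∈ extendIdeal I (reesRing L I)) :
    ∃ (V : ValuationSubring L) (h : IsDicritical I V),
      h.isLocalizationAtCenter_reesRing.center = P := by
  obtain ⟨x, hx, hxP⟩ := exists_chartVariable_notMem hI0 hI P f hP
  have hx0 : algebraMap R L x ≠ 0 := by
    intro h0
    refine hxP ?_
    convert P.zero_mem
    rw [chartVariable, h0, map_zero, zero_mul]
    rfl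
  have hinj := IsFractionRing.injective R L
  have hxK : algebraMap R (RatFunc L) x ≠ 0 := algebraMap_ratFunc_ne_zero hx0
  have := isNoetherianRing_reesRing (L := L) I
  have := isIntegrallyClosed_reesRing (L := L) hI0 hI
  have := isFractionRing_reesRing (L := L) hx hx0
  set Y : reesRing L I := ⟨_, chartVariable_mem_reesRing hx⟩ with hY
  set xE : reesRing L I := ⟨_, algebraMap_mem_reesRing I x⟩ with hxE
  have hxI : xE ∈ extendIdeal I (reesRing L I) := Ideal.subset_span ⟨x, hx, rfl⟩
  obtain ⟨W', hW', hW'P, hdvr⟩ := exists_isLocalizationAtCenter (reesRing L I) P xE f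
    (fun h => hxK (congrArg Subtype.val h)) (by
      intro s
      constructor
      · intro hs
        refine ⟨Y, hxP, ⟨_, X_mul_mem_reesRing ((hP s).1 hs)⟩, Subtype.ext ?_⟩
        simp only [Subring.coe_mul, hY, hxE, chartVariable_eq]
        ring
      · rintro ⟨t, ht, u, hu⟩
        refine (hPp.mem_or_mem (x := t) (y := s) ((hP _).2 ?_)).resolve_left ht
        rw [hu]
        exact Ideal.mul_mem_right _ _ hxI)
  have hW'iff : ∀ e : reesRing L I, e ∈ P ↔ W'.valuation (e : RatFunc L) < 1 := fun e => by
    rw [← hW'P, hW'.mem_center]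
  have hYv : W'.valuation (chartVariable L x) = 1 := hW'.valuation_eq_one (a := Y) (hW'P ▸ hxP)
  have hhom : ∀ (k : ℕ) (b : R) (hb : b ∈ I ^ k),
      (⟨_, monomial_mem_reesRing hb⟩ : reesRing L I) ∈ P ↔
        W'.valuation (algebraMap L (RatFunc L) (algebraMap R L b / algebraMap R L x ^ k)) < 1 := by
    intro k b hb
    rw [hW'iff]
    dsimp only
    rw [monomial_eq_mul_chartVariable_pow hx0, map_mul, map_pow, hYv, one_pow, mul_one]
  have hAW : ∀ a : chart L I x, algebraMap (chart L I x) (RatFunc L) a ∈ W' := by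
    intro a
    have h1 : algebraMap L (RatFunc L) a ∈
        Dicritical.laurentRing (chart L I x) (chartVariable L x) :=
      algebraMap_mem_laurentRing _ a.2
    obtain ⟨n, hn⟩ := (mem_laurentRing_iff hx hx0 _).1 h1
    have h2 := (W'.valuation_le_one_iff _).2 (hW'.le hn)
    rw [map_mul, map_pow, hYv, one_pow, mul_one] at h2
    exact (W'.valuation_le_one_iff _).1 h2
  obtain ⟨f, hf⟩ := f
  obtain ⟨q, hq, rfl⟩ := (mem_reesRing_iff I f).1 hf
  obtain ⟨n, hn⟩ := exists_homogeneous_conductor P hq hP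
  -- the centre of `W'` on the chart `A`, which will be shown to be a conductor `(xA : a)`, where
  -- `a` is `f_n / x ^ n` for the homogeneous component `f_n Z ^ n` of `f`
  let PA : Ideal (chart L I x) := contractIdeal hAW (maximalIdeal W')
  have hPAp : PA.IsPrime := by
    unfold PA contractIdeal
    infer_instance
  have hPA : ∀ (k : ℕ) (b : R) (hb : b ∈ I ^ k) (a : chart L I x),
      (a : L) = algebraMap R L b / algebraMap R L x ^ k →
      (a ∈ PA ↔ b * q.coeff n ∈ I ^ (n + k + 1)) := by
    intro k b hb a ha
    rw [← hn k b hb, hhom k b hb, ← ha]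
    exact mem_contractIdeal_maximalIdeal W' hAW a
  have := isNoetherianRing_chart (L := L) hx hx0
  have := isIntegrallyClosed_chart hI hx hx0
  have := isFractionRing_chart (L := L) I x
  obtain ⟨V, hV, hVP, -⟩ := exists_isLocalizationAtCenter (chart L I x) PA
    ⟨_, algebraMap_mem_chart I x x⟩ ⟨_, (mem_chart_iff hx hx0 _).2 ⟨n, _, hq n, rfl⟩⟩
    (fun h => hx0 (congrArg Subtype.val h)) (by
      intro s
      obtain ⟨k, b, hb, hs⟩ := (mem_chart_iff hx hx0 _).1 s.2
      constructor
      · intro h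
        have h1 := (hPA k b hb s hs).1 h
        refine ⟨1, PA.primeCompl.one_mem,
          ⟨_, (mem_chart_iff hx hx0 _).2 ⟨_, _, h1, rfl⟩⟩, Subtype.ext ?_⟩
        rw [one_mul]
        change (s : L) * (algebraMap R L (q.coeff n) / algebraMap R L x ^ n) = algebraMap R L x *
          (algebraMap R L (b * q.coeff n) / algebraMap R L x ^ (n + k + 1))
        rw [hs, map_mul, pow_add, pow_add]
        field_simp
      · rintro ⟨t, ht, u, hu⟩
        obtain ⟨m, c, hc, hts⟩ := (mem_chart_iff hx hx0 _).1 t.2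
        obtain ⟨l, d, hd, hus⟩ := (mem_chart_iff hx hx0 _).1 u.2
        -- clear denominators: `t s x ^ l` is in the conductor of the component of `f`
        have hmem : c * b * x ^ l ∈ I ^ (m + k + l) := by
          rw [pow_add, pow_add]
          exact Ideal.mul_mem_mul (Ideal.mul_mem_mul hc hb) (Ideal.pow_mem_pow hx l)
        have hts' : t * s ∈ PA := by
          refine (hPA (m + k + l) (c * b * x ^ l) hmem (t * s) ?_).2 ?_
          · rw [Subring.coe_mul, hs, hts, map_mul, map_mul, map_pow, pow_add, pow_add]
            field_simp
          · have e : (t : L) * s * (algebraMap R L (q.coeff n) / algebraMap R L x ^ n) =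
                algebraMap R L x * u := congrArg Subtype.val hu
            have e2 : c * b * x ^ l * q.coeff n = d * x ^ (m + k + n + 1) := by
              apply hinj
              rw [hs, hts, hus] at e
              simp only [map_mul, map_pow, pow_add, pow_one]
              field_simp at e
              linear_combination e
            rw [e2, show n + (m + k + l) + 1 = l + (m + k + n + 1) by ring, pow_add]
            exact Ideal.mul_mem_mul hd (Ideal.pow_mem_pow hx _)
        exact (hPAp.mem_or_mem hts').resolve_left ht)
  have hdic : IsDicritical I V := by
    refine ⟨⟨x, hx, hx0, hV⟩, fun y hy => ?_⟩
    have hyP : (⟨_, algebraMap_mem_chart I x y⟩ : chart L I x) ∈ PA := by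
      refine (hPA 0 y (by simp) _ (by simp)).2 ?_
      rw [add_zero, pow_succ']
      exact Ideal.mul_mem_mul hy (hq n)
    rw [← hVP, hV.mem_center] at hyP
    exact hyP
  have hxV : AttainsIdealValue V I x := .of_chart_le hx hx0 hV.le
  refine ⟨V, hdic, hdic.center_reesRing_eq_of_le ?_ ?_⟩
  -- the centre on `E` of the extension of `V` is contained in `P`, which has height one
  · have := hW'.height_center
    rwa [hW'P] at this
  · intro e he
    obtain ⟨e, heE⟩ := e
    obtain ⟨p, hp, rfl⟩ := (mem_reesRing_iff I e).1 heE
    rw [IsLocalizationAtCenter.mem_center, valuation_reesExtension_lt_one_iff,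
      hxV.ratFuncValuation_polyMap_lt_iff _ zero_lt_one] at he
    rw [reesRing_mk_eq_sum hp]
    refine Ideal.sum_mem _ fun k _ => ?_
    have hk := he k
    rw [one_mul, ← map_pow, ← div_lt_one₀ (by
      rw [map_pow]; exact pow_pos (zero_lt_iff.2 hxV.valuation_ne_zero) k), ← map_div₀] at hk
    have hkA : (⟨_, (mem_chart_iff hx hx0 _).2 ⟨k, _, hp k, rfl⟩⟩ : chart L I x) ∈ PA := by
      rw [← hVP, hV.mem_center]
      exact hk
    exact (hn k _ (hp k)).2 ((hPA k _ (hp k) _ rfl).1 hkA)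

/-- If `f ∉ IE`, then `(IE : f)` is contained in the centre on `E` of the `(R, I)`-extension of a
member of the dicritical set. -/
theorem exists_isDicritical_of_notMem [IsDomain R] [IsNoetherianRing R]
    [IsIntegrallyClosed R] [IsFractionRing R L]
    (hI0 : I ≠ ⊥) (hI : IsNormalIdeal L I) {f : reesRing L I}
    (hf : f ∉ extendIdeal I (reesRing L I)) :
    ∃ (V : ValuationSubring L) (h : IsDicritical I V),
      ∀ e, e * f ∈ extendIdeal I (reesRing L I) →
        e ∈ h.isLocalizationAtCenter_reesRing.center := by
  have := isNoetherianRing_reesRing (L := L) I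
  set IE := extendIdeal I (reesRing L I)
  obtain ⟨P, hP, hle⟩ := exists_le_isAssociatedPrime_of_isNoetherianRing (reesRing L I)
    (Ideal.Quotient.mk IE f) (fun h => hf (Ideal.Quotient.eq_zero_iff_mem.1 h))
  obtain ⟨hPp, g, hg⟩ := isAssociatedPrime_iff.1 hP
  obtain ⟨g, rfl⟩ := Ideal.Quotient.mk_surjective g
  have hcolon : ∀ e g : reesRing L I, e ∈ (⊥ : Submodule (reesRing L I) (reesRing L I ⧸ IE)).colon
      {Ideal.Quotient.mk IE g} ↔ e * g ∈ IE := by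
    intro e g
    rw [Submodule.mem_colon_singleton, Submodule.mem_bot, ← Ideal.Quotient.eq_zero_iff_mem]
    rfl
  obtain ⟨V, h, hV⟩ := exists_isDicritical_of_conductor hI0 hI P g
    (fun e => by rw [hg]; exact hcolon e g)
  exact ⟨V, h, fun e he => hV ▸ hle ((hcolon e f).2 he)⟩

/-- `IE` is the intersection of the contractions of the ideals `IW`. -/
theorem mem_extendIdeal_of_forall_isDicritical [IsDomain R] [IsNoetherianRing R]
    [IsIntegrallyClosed R] [IsFractionRing R L]
    (hI0 : I ≠ ⊥) (hI : IsNormalIdeal L I)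
    {f : reesRing L I}
    (hf : ∀ V : ValuationSubring L, IsDicritical I V → ∃ x, AttainsIdealValue V I x ∧
      (f : RatFunc L) / algebraMap R (RatFunc L) x ∈ reesExtension V I) :
    f ∈ extendIdeal I (reesRing L I) := by
  by_contra hcon
  obtain ⟨V, h, hV⟩ := exists_isDicritical_of_notMem hI0 hI hcon
  obtain ⟨x, hx, hfx⟩ := hf V h
  obtain ⟨a, ha, s, hs, hs1, e⟩ := h.isLocalizationAtCenter_reesRing.exists_mul_eq _ hfx
  have hx0 : algebraMap R (RatFunc L) x ≠ 0 := algebraMap_ratFunc_ne_zero hx.ne_zero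
  have hmem : (⟨s, hs⟩ : reesRing L I) * f ∈ extendIdeal I (reesRing L I) := by
    have : (⟨s, hs⟩ : reesRing L I) * f = ⟨a, ha⟩ * ⟨_, algebraMap_mem_reesRing I x⟩ := by
      apply Subtype.ext
      simp only [Subring.coe_mul]
      rw [← e]
      field_simp
    rw [this]
    exact Ideal.mul_mem_left _ _ (Ideal.subset_span ⟨x, hx.mem, rfl⟩)
  have h1 := hV _ hmem
  rw [IsLocalizationAtCenter.mem_center] at h1
  exact h1.ne hs1

theorem algebraMap_mem_extendIdeal_iff [IsFractionRing R L]
    (a : R) :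
    (⟨_, algebraMap_mem_reesRing I a⟩ : reesRing L I) ∈ extendIdeal I (reesRing L I) ↔ a ∈ I := by
  constructor
  · intro h
    obtain ⟨q, hq, e⟩ := (mem_extendIdeal_reesRing_iff I _).1 h
    dsimp only at e
    rw [← polyMap_C] at e
    have h0 := hq 0
    rw [polyMap_injective L (IsFractionRing.injective R L) e] at h0
    simpa using h0
  · exact fun h => Ideal.subset_span ⟨a, h, rfl⟩

theorem exists_isDicritical [IsDomain R] [IsNoetherianRing R]
    [IsIntegrallyClosed R] [IsFractionRing R L]
    (hI0 : I ≠ ⊥) (hI1 : I ≠ ⊤) (hI : IsNormalIdeal L I) :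
    ∃ V : ValuationSubring L, IsDicritical I V := by
  have h1 : (⟨_, algebraMap_mem_reesRing I 1⟩ : reesRing L I) ∉ extendIdeal I (reesRing L I) := by
    rw [algebraMap_mem_extendIdeal_iff]
    exact (Ideal.ne_top_iff_one I).1 hI1
  obtain ⟨V, h, -⟩ := exists_isDicritical_of_notMem hI0 hI h1
  exact ⟨V, h⟩

theorem IsDicritical.extendIdeal_le_center {V : ValuationSubring L} (h : IsDicritical I V) :
    extendIdeal I (reesRing L I) ≤ h.isLocalizationAtCenter_reesRing.center := by
  refine Ideal.span_le.2 ?_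
  rintro s ⟨a, ha, has⟩
  rw [SetLike.mem_coe, IsLocalizationAtCenter.mem_center, ← has]
  exact h.reesExtension_valuation_lt_one ha

theorem extendIdeal_ne_bot {K σ : Type*} [Field K] [Algebra R K] [SetLike σ K] [SubringClass σ K]
    {S : σ} (hS : ∀ r : R, algebraMap R K r ∈ S) {x : R} (hx : x ∈ I)
    (hx0 : algebraMap R K x ≠ 0) : extendIdeal I S ≠ ⊥ := by
  intro h
  have hxS : (⟨_, hS x⟩ : S) ∈ extendIdeal I S := Ideal.subset_span ⟨x, hx, rfl⟩
  rw [h, Submodule.mem_bot] at hxS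
  exact hx0 (congrArg Subtype.val hxS)

theorem IsDicritical.center_mem_minimalPrimes [IsNoetherianRing R] {V : ValuationSubring L}
    (h : IsDicritical I V) :
    h.isLocalizationAtCenter_reesRing.center ∈ (extendIdeal I (reesRing L I)).minimalPrimes := by
  have := h.isDiscreteValuationRing_reesExtension
  obtain ⟨x, hx⟩ := h.exists_attainsIdealValue
  exact h.isLocalizationAtCenter_reesRing.center_mem_minimalPrimes h.extendIdeal_le_center
    (extendIdeal_ne_bot (algebraMap_mem_reesRing I) hx.mem (algebraMap_ratFunc_ne_zero hx.ne_zero))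

/-- A member of the dicritical set is determined by the centre of its extension on `E`. -/
theorem IsDicritical.eq_of_center_le [IsNoetherianRing R] {V V' : ValuationSubring L}
    (h : IsDicritical I V) (h' : IsDicritical I V')
    (e : h.isLocalizationAtCenter_reesRing.center ≤ h'.isLocalizationAtCenter_reesRing.center) :
    V = V' := by
  have := h.isDiscreteValuationRing_reesExtension
  have := h'.isDiscreteValuationRing_reesExtension
  rw [← comap_reesExtension (V := V) (I := I), ← comap_reesExtension (V := V') (I := I),
    h.isLocalizationAtCenter_reesRing.eq_of_center_le h'.isLocalizationAtCenter_reesRing e]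

/-- The centres on `E` of the extensions of the members are minimal primes of `IE`. -/
theorem finite_dicriticalSet [IsDomain R] [IsNoetherianRing R]
    [IsIntegrallyClosed R] [IsFractionRing R L]
    (hI : IsNormalIdeal L I) : (dicriticalSet L I I).Finite := by
  have := isNoetherianRing_reesRing (L := L) I
  have hfin :=
    ((extendIdeal I (reesRing L I)).finite_minimalPrimes_of_isNoetherianRing _).to_subtype
  let c : ({V : ValuationSubring L | IsDicritical I V} : Set _) →
      (extendIdeal I (reesRing L I)).minimalPrimes := fun V => ⟨_, V.2.center_mem_minimalPrimes⟩
  have hfin' : Finite ({V : ValuationSubring L | IsDicritical I V} : Set _) :=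
    Finite.of_injective c fun V V' h =>
      Subtype.ext (V.2.eq_of_center_le V'.2 (congrArg Subtype.val h).le)
  refine ((Set.toFinite {V : ValuationSubring L | IsDicritical I V}).image
    ValuationSubring.toLocalSubring).subset fun T hT => ?_
  obtain ⟨V, rfl⟩ := exists_toLocalSubring_eq_of_mem_dicriticalSet hI hT
  exact ⟨V, .of_toLocalSubring_mem hI hT, rfl⟩

end AssociatedPrimes

/-! ### Contractions and extensions of ideals -/

section Contractions

variable {R : Type*} [CommRing R] {L : Type*} [Field L] [Algebra R L] {I : Ideal R}
  {V : ValuationSubring L} {x : R}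

theorem AttainsIdealValue.div_mem (hx : AttainsIdealValue V I x) {y : R} (hy : y ∈ I) :
    algebraMap R L y / algebraMap R L x ∈ V := by
  refine (V.valuation_le_one_iff _).1 ?_
  rw [map_div₀, div_le_one₀ (zero_lt_iff.2 hx.valuation_ne_zero)]
  exact hx.le y hy

theorem algebraMap_mem_reesExtension_iff (a : L) :
    algebraMap L (RatFunc L) a ∈ reesExtension V I ↔ a ∈ V := by
  rw [← ValuationSubring.mem_comap, comap_reesExtension]

theorem algebraMap_div_algebraMap (y : R) (a : L) :
    algebraMap L (RatFunc L) a / algebraMap R (RatFunc L) y =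
      algebraMap L (RatFunc L) (a / algebraMap R L y) := by
  rw [algebraMap_ratFunc_eq y, map_div₀]

theorem AttainsIdealValue.div_mem_reesExtension (hx : AttainsIdealValue V I x) {y : R}
    (hy : y ∈ I) : algebraMap R (RatFunc L) y / algebraMap R (RatFunc L) x ∈ reesExtension V I := by
  rw [algebraMap_ratFunc_eq y, algebraMap_div_algebraMap, algebraMap_mem_reesExtension_iff]
  exact hx.div_mem hy

theorem mem_contractIdeal_extendIdeal {S : Type*} [CommRing S] [Algebra S L]
    (hx : AttainsIdealValue V I x) (hV : ∀ r : R, algebraMap R L r ∈ V)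
    (h : ∀ s : S, algebraMap S L s ∈ V) (s : S) :
    s ∈ contractIdeal h (extendIdeal I V) ↔ algebraMap S L s / algebraMap R L x ∈ V :=
  mem_extendIdeal_iff_div_mem I V hx.mem (hV x) hx.ne_zero (fun _ hy => hx.div_mem hy) ⟨_, h s⟩

theorem mem_contractIdeal_extendIdeal_reesExtension {S : Type*} [CommRing S]
    [Algebra S (RatFunc L)] (hx : AttainsIdealValue V I x) (hV : ∀ r : R, algebraMap R L r ∈ V)
    (h : ∀ s : S, algebraMap S (RatFunc L) s ∈ reesExtension V I) (s : S) :
    s ∈ contractIdeal h (extendIdeal I (reesExtension V I)) ↔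
      algebraMap S (RatFunc L) s / algebraMap R (RatFunc L) x ∈ reesExtension V I :=
  mem_extendIdeal_iff_div_mem I (reesExtension V I) hx.mem (by
      rw [algebraMap_ratFunc_eq, algebraMap_mem_reesExtension_iff]; exact hV x)
    (algebraMap_ratFunc_ne_zero hx.ne_zero) (fun _ hy => hx.div_mem_reesExtension hy) ⟨_, h s⟩

theorem extendIdeal_ne_top {K : Type*} [Field K] [Algebra R K] {W : ValuationSubring K}
    (h : ∀ y ∈ I, W.valuation (algebraMap R K y) < 1) : extendIdeal I W ≠ ⊤ := by
  have hle : extendIdeal I W ≤ maximalIdeal W := by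
    refine Ideal.span_le.2 ?_
    rintro s ⟨a, ha, has⟩
    rw [SetLike.mem_coe, ValuationSubring.valuation_lt_one_iff, ← has]
    exact h a ha
  exact fun h => (maximalIdeal.isMaximal W).ne_top (top_le_iff.1 (h ▸ hle))

theorem IsDicritical.isPrimary_contractIdeal [IsNoetherianRing R] (h : IsDicritical I V)
    {S : Subring L} (hc : IsLocalizationAtCenter S V) :
    (contractIdeal (fun a : S => hc.le a.2) (extendIdeal I V)).IsPrimary ∧
      (contractIdeal (fun a : S => hc.le a.2) (extendIdeal I V)).radical = hc.center := by
  have := h.isDiscreteValuationRing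
  obtain ⟨x, hx⟩ := h.exists_attainsIdealValue
  exact hc.isPrimary_contractIdeal (extendIdeal_ne_bot h.algebraMap_mem hx.mem hx.ne_zero)
    (extendIdeal_ne_top h.valuation_lt_one)

theorem IsDicritical.isPrimary_contractIdeal_reesExtension [IsNoetherianRing R]
    (h : IsDicritical I V) {S : Subring (RatFunc L)}
    (hc : IsLocalizationAtCenter S (reesExtension V I)) :
    (contractIdeal (fun a : S => hc.le a.2) (extendIdeal I (reesExtension V I))).IsPrimary ∧
      (contractIdeal (fun a : S => hc.le a.2) (extendIdeal I (reesExtension V I))).radical =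
        hc.center := by
  have := h.isDiscreteValuationRing_reesExtension
  obtain ⟨x, hx⟩ := h.exists_attainsIdealValue
  refine hc.isPrimary_contractIdeal (extendIdeal_ne_bot (fun r => ?_) hx.mem
    (algebraMap_ratFunc_ne_zero hx.ne_zero))
    (extendIdeal_ne_top fun y hy => h.reesExtension_valuation_lt_one hy)
  rw [algebraMap_ratFunc_eq, algebraMap_mem_reesExtension_iff]
  exact h.algebraMap_mem r

/-- If all `y / x` with `y ∈ I` are in `S`, then `xS = IS`. -/
theorem extendIdeal_span_singleton {K : Type*} [Field K] [Algebra R K] {S : Subring K}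
    (hS : ∀ r : R, algebraMap R K r ∈ S) (hx : x ∈ I) (hx0 : algebraMap R K x ≠ 0)
    (h : ∀ y ∈ I, algebraMap R K y / algebraMap R K x ∈ S) :
    extendIdeal (Ideal.span {x}) S = extendIdeal I S := by
  ext z
  rw [mem_extendIdeal_iff_div_mem I S hx (hS x) hx0 h,
    mem_extendIdeal_iff_div_mem _ S (Ideal.mem_span_singleton_self x) (hS x) hx0]
  intro y hy
  obtain ⟨r, rfl⟩ := Ideal.mem_span_singleton'.1 hy
  rw [map_mul, mul_div_cancel_right₀ _ hx0]
  exact hS r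

end Contractions

section LaurentRing

variable {R : Type*} [CommRing R] {L : Type*} [Field L] [Algebra R L] {I : Ideal R} {x : R}

theorem algebraMap_chart_mem_laurentRing (a : chart L I x) :
    algebraMap (chart L I x) (RatFunc L) a ∈ laurentRing (chart L I x) (chartVariable L x) :=
  algebraMap_mem_laurentRing _ a.2

theorem algebraMap_mem_laurentRing_chart (r : R) :
    algebraMap R (RatFunc L) r ∈ laurentRing (chart L I x) (chartVariable L x) := by
  rw [algebraMap_ratFunc_eq]
  exact algebraMap_mem_laurentRing _ (algebraMap_mem_chart I x r)

theorem div_mem_laurentRing {y : R} (hy : y ∈ I) :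
    algebraMap R (RatFunc L) y / algebraMap R (RatFunc L) x ∈
      laurentRing (chart L I x) (chartVariable L x) := by
  rw [algebraMap_ratFunc_eq y, algebraMap_div_algebraMap]
  exact algebraMap_mem_laurentRing _ (div_mem_chart I x hy)

/-- An ideal of `B` extended from `E` contains every `b` for which some `b Y^n` is in the ideal of
`E`. -/
theorem mem_extendIdeal_of_mul_pow_mem (hx0 : algebraMap R L x ≠ 0)
    (N : Ideal (reesRing L I)) (b : laurentRing (chart L I x) (chartVariable L x)) {n : ℕ}
    {e : reesRing L I} (he : (b : RatFunc L) * chartVariable L x ^ n = e) (heN : e ∈ N)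
    (hE : reesRing L I ≤ laurentRing (chart L I x) (chartVariable L x)) :
    b ∈ extendIdeal N (laurentRing (chart L I x) (chartVariable L x)) := by
  have h1 : (⟨e, hE e.2⟩ : laurentRing (chart L I x) (chartVariable L x)) ∈
      extendIdeal N (laurentRing (chart L I x) (chartVariable L x)) :=
    Ideal.subset_span ⟨e, heN, rfl⟩
  have h2 : b = ⟨e, hE e.2⟩ * ⟨_, inv_mem_laurentRing (chart L I x) (chartVariable L x)⟩ ^ n := by
    apply Subtype.ext
    simp only [Subring.coe_mul, SubmonoidClass.coe_pow]
    rw [← he, inv_pow, mul_inv_cancel_right₀ (pow_ne_zero _ (chartVariable_ne_zero hx0))]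
  rw [h2]
  exact Ideal.mul_mem_right _ _ h1

/-- An ideal of `B` extended from `A` contains every Laurent polynomial in `Y` with coefficients in
the ideal of `A`. -/
theorem mem_extendIdeal_of_coeff_mem (hx : x ∈ I) (hx0 : algebraMap R L x ≠ 0)
    (N : Ideal (chart L I x)) (b : laurentRing (chart L I x) (chartVariable L x)) {n : ℕ}
    {q : R[X]} (hq : ∀ k, q.coeff k ∈ I ^ k)
    (he : (b : RatFunc L) * chartVariable L x ^ n = polyMap L q)
    (hN : ∀ k, (⟨_, (mem_chart_iff hx hx0 _).2 ⟨k, _, hq k, rfl⟩⟩ : chart L I x) ∈ N) :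
    b ∈ extendIdeal N (laurentRing (chart L I x) (chartVariable L x)) := by
  let B := laurentRing (chart L I x) (chartVariable L x)
  let Y : B := ⟨_, mem_laurentRing_self (chart L I x) (chartVariable L x)⟩
  let Y' : B := ⟨_, inv_mem_laurentRing (chart L I x) (chartVariable L x)⟩
  have h2 : b = (∑ k ∈ q.support, ⟨_, algebraMap_chart_mem_laurentRing
      ⟨_, (mem_chart_iff hx hx0 _).2 ⟨k, _, hq k, rfl⟩⟩⟩ * Y ^ k) * Y' ^ n := by
    apply Subtype.ext
    simp only [Subring.coe_mul, SubmonoidClass.coe_pow, AddSubmonoidClass.coe_finsetSum, Y, Y']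
    rw [inv_pow, eq_mul_inv_iff_mul_eq₀ (pow_ne_zero _ (chartVariable_ne_zero hx0)), he]
    conv_lhs => rw [q.as_sum_support, map_sum]
    refine Finset.sum_congr rfl fun k _ => ?_
    rw [polyMap_monomial, monomial_eq_mul_chartVariable_pow hx0]
    rfl
  rw [h2]
  refine Ideal.mul_mem_right _ _ (Ideal.sum_mem _ fun k _ => Ideal.mul_mem_right _ _ ?_)
  exact Ideal.subset_span ⟨_, hN k, rfl⟩

/-- `x⁻¹ IE ⊆ B`, since `x⁻¹ f = (Zf) Y⁻¹`. -/
theorem div_mem_laurentRing_of_mem_extendIdeal (hx : x ∈ I) (hx0 : algebraMap R L x ≠ 0)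
    {f : reesRing L I} (hf : f ∈ extendIdeal I (reesRing L I)) :
    (f : RatFunc L) / algebraMap R (RatFunc L) x ∈
      laurentRing (chart L I x) (chartVariable L x) := by
  refine (mem_laurentRing_iff hx hx0 _).2 ⟨1, ?_⟩
  have h0 := algebraMap_ratFunc_ne_zero (L := L) hx0
  have h1 : (f : RatFunc L) / algebraMap R (RatFunc L) x * chartVariable L x ^ 1 =
      RatFunc.X * (f : RatFunc L) := by
    rw [chartVariable_eq, pow_one]
    field_simp
  rw [h1]
  exact X_mul_mem_reesRing hf

variable {V : ValuationSubring L}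

theorem valuation_reesExtension_lt_one_iff_mul_pow (hx : AttainsIdealValue V I x) (b : RatFunc L)
    (n : ℕ) : (reesExtension V I).valuation (b * chartVariable L x ^ n) < 1 ↔
      (reesExtension V I).valuation b < 1 := by
  rw [valuation_reesExtension_lt_one_iff, valuation_reesExtension_lt_one_iff, map_mul, map_pow,
    hx.ratFuncValuation_chartVariable, one_pow, mul_one]

theorem mem_reesExtension_iff_mul_pow (hx : AttainsIdealValue V I x) (b : RatFunc L)
    (n : ℕ) : b * chartVariable L x ^ n ∈ reesExtension V I ↔ b ∈ reesExtension V I := by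
  rw [mem_reesExtension_iff, mem_reesExtension_iff, map_mul, map_pow,
    hx.ratFuncValuation_chartVariable, one_pow, mul_one]

theorem valuation_reesExtension_polyMap_lt_one_iff (hx : AttainsIdealValue V I x) (q : R[X]) :
    (reesExtension V I).valuation (polyMap L q) < 1 ↔
      ∀ k, V.valuation (algebraMap R L (q.coeff k) / algebraMap R L x ^ k) < 1 := by
  rw [valuation_reesExtension_lt_one_iff, hx.ratFuncValuation_polyMap_lt_iff _ zero_lt_one]
  refine forall_congr' fun k => ?_
  rw [map_div₀, map_pow, div_lt_one₀ (pow_pos (zero_lt_iff.2 hx.valuation_ne_zero) k), one_mul]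

theorem polyMap_div_mem_reesExtension_iff (hx : AttainsIdealValue V I x) (q : R[X]) :
    polyMap L q / algebraMap R (RatFunc L) x ∈ reesExtension V I ↔
      ∀ k, algebraMap R L (q.coeff k) / algebraMap R L x ^ k / algebraMap R L x ∈ V := by
  have hpos := zero_lt_iff.2 hx.valuation_ne_zero
  rw [mem_reesExtension_iff, map_div₀, algebraMap_ratFunc_eq x, ratFuncValuation_algebraMap,
    div_le_one₀ hpos, hx.ratFuncValuation_polyMap_le_iff]
  refine forall_congr' fun k => ?_
  rw [← V.valuation_le_one_iff, map_div₀, map_div₀, map_pow, div_le_one₀ hpos,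
    div_le_iff₀ (pow_pos hpos k)]

theorem valuation_reesExtension_algebraMap_lt_one_iff (a : L) :
    (reesExtension V I).valuation (algebraMap L (RatFunc L) a) < 1 ↔ V.valuation a < 1 := by
  rw [valuation_reesExtension_lt_one_iff, ratFuncValuation_algebraMap]

theorem extendIdeal_le_of_forall {S K : Type*} [CommRing S] [Field K] [Algebra S K] {B : Subring K}
    {N : Ideal S} {M : Ideal B} (h : ∀ a ∈ N, ∀ b : B, algebraMap S K a = b → b ∈ M) :
    extendIdeal N B ≤ M :=
  Ideal.span_le.2 fun b ⟨a, ha, hab⟩ => h a ha b hab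

/-- The centres of `V` on `A` and of `W` on `E` extend to the centre of `W` on `B`. -/
theorem extendIdeal_center_eq (hx : AttainsIdealValue V I x)
    (hA : ∀ a : chart L I x, algebraMap (chart L I x) L a ∈ V)
    (hE : ∀ e : reesRing L I, algebraMap (reesRing L I) (RatFunc L) e ∈ reesExtension V I)
    (hB : ∀ b : laurentRing (chart L I x) (chartVariable L x),
      algebraMap (laurentRing (chart L I x) (chartVariable L x)) (RatFunc L) b ∈
        reesExtension V I) :
    extendIdeal (contractIdeal hA (maximalIdeal V))
        (laurentRing (chart L I x) (chartVariable L x)) =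
      contractIdeal hB (maximalIdeal (reesExtension V I)) ∧
    extendIdeal (contractIdeal hE (maximalIdeal (reesExtension V I)))
        (laurentRing (chart L I x) (chartVariable L x)) =
      contractIdeal hB (maximalIdeal (reesExtension V I)) := by
  have hmem : ∀ b : laurentRing (chart L I x) (chartVariable L x),
      b ∈ contractIdeal hB (maximalIdeal (reesExtension V I)) →
      ∃ (n : ℕ) (q : R[X]), (∀ k, q.coeff k ∈ I ^ k) ∧
        (b : RatFunc L) * chartVariable L x ^ n = polyMap L q ∧
        (reesExtension V I).valuation (polyMap L q) < 1 := by
    intro b hb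
    obtain ⟨n, hn⟩ := (mem_laurentRing_iff hx.mem hx.ne_zero _).1 b.2
    obtain ⟨q, hq, e⟩ := (mem_reesRing_iff I _).1 hn
    refine ⟨n, q, hq, e.symm, ?_⟩
    rw [e, valuation_reesExtension_lt_one_iff_mul_pow hx]
    exact (mem_contractIdeal_maximalIdeal _ hB b).1 hb
  constructor
  · refine le_antisymm (extendIdeal_le_of_forall fun a ha b hab => ?_) fun b hb => ?_
    · refine (mem_contractIdeal_maximalIdeal _ hB b).2 ?_
      change (reesExtension V I).valuation (b : RatFunc L) < 1
      rw [← hab]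
      exact (valuation_reesExtension_algebraMap_lt_one_iff _).2
        ((mem_contractIdeal_maximalIdeal _ hA a).1 ha)
    · obtain ⟨n, q, hq, e, hv⟩ := hmem b hb
      exact mem_extendIdeal_of_coeff_mem hx.mem hx.ne_zero _ b hq e fun k =>
        (mem_contractIdeal_maximalIdeal _ hA _).2
          ((valuation_reesExtension_polyMap_lt_one_iff hx q).1 hv k)
  · refine le_antisymm (extendIdeal_le_of_forall fun a ha b hab => ?_) fun b hb => ?_
    · refine (mem_contractIdeal_maximalIdeal _ hB b).2 ?_
      change (reesExtension V I).valuation (b : RatFunc L) < 1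
      rw [← hab]
      exact (mem_contractIdeal_maximalIdeal _ hE a).1 ha
    · obtain ⟨n, q, hq, e, hv⟩ := hmem b hb
      exact mem_extendIdeal_of_mul_pow_mem hx.ne_zero _ b
        (e := ⟨_, (mem_reesRing_iff I _).2 ⟨q, hq, rfl⟩⟩) e
        ((mem_contractIdeal_maximalIdeal _ hE _).2 hv)
        (reesRing_le_laurentRing hx.mem hx.ne_zero)

/-- The contractions of `IV` to `A` and of `IW` to `E` extend to the contraction of `IW` to `B`. -/
theorem extendIdeal_contractIdeal_eq (hx : AttainsIdealValue V I x)
    (hV : ∀ r : R, algebraMap R L r ∈ V)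
    (hA : ∀ a : chart L I x, algebraMap (chart L I x) L a ∈ V)
    (hE : ∀ e : reesRing L I, algebraMap (reesRing L I) (RatFunc L) e ∈ reesExtension V I)
    (hB : ∀ b : laurentRing (chart L I x) (chartVariable L x),
      algebraMap (laurentRing (chart L I x) (chartVariable L x)) (RatFunc L) b ∈
        reesExtension V I) :
    extendIdeal (contractIdeal hA (extendIdeal I V))
        (laurentRing (chart L I x) (chartVariable L x)) =
      contractIdeal hB (extendIdeal I (reesExtension V I)) ∧
    extendIdeal (contractIdeal hE (extendIdeal I (reesExtension V I)))
        (laurentRing (chart L I x) (chartVariable L x)) =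
      contractIdeal hB (extendIdeal I (reesExtension V I)) := by
  have hmem : ∀ b : laurentRing (chart L I x) (chartVariable L x),
      b ∈ contractIdeal hB (extendIdeal I (reesExtension V I)) →
      ∃ (n : ℕ) (q : R[X]), (∀ k, q.coeff k ∈ I ^ k) ∧
        (b : RatFunc L) * chartVariable L x ^ n = polyMap L q ∧
        polyMap L q / algebraMap R (RatFunc L) x ∈ reesExtension V I := by
    intro b hb
    obtain ⟨n, hn⟩ := (mem_laurentRing_iff hx.mem hx.ne_zero _).1 b.2
    obtain ⟨q, hq, e⟩ := (mem_reesRing_iff I _).1 hn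
    refine ⟨n, q, hq, e.symm, ?_⟩
    rw [e, mul_div_right_comm, mem_reesExtension_iff_mul_pow hx]
    exact (mem_contractIdeal_extendIdeal_reesExtension hx hV hB b).1 hb
  constructor
  · refine le_antisymm (extendIdeal_le_of_forall fun a ha b hab => ?_) fun b hb => ?_
    · refine (mem_contractIdeal_extendIdeal_reesExtension hx hV hB b).2 ?_
      change (b : RatFunc L) / _ ∈ _
      rw [← hab]
      change algebraMap L (RatFunc L) (a : L) / _ ∈ _
      rw [algebraMap_div_algebraMap, algebraMap_mem_reesExtension_iff]
      exact (mem_contractIdeal_extendIdeal hx hV hA a).1 ha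
    · obtain ⟨n, q, hq, e, hv⟩ := hmem b hb
      exact mem_extendIdeal_of_coeff_mem hx.mem hx.ne_zero _ b hq e fun k =>
        (mem_contractIdeal_extendIdeal hx hV hA _).2
          ((polyMap_div_mem_reesExtension_iff hx q).1 hv k)
  · refine le_antisymm (extendIdeal_le_of_forall fun a ha b hab => ?_) fun b hb => ?_
    · refine (mem_contractIdeal_extendIdeal_reesExtension hx hV hB b).2 ?_
      change (b : RatFunc L) / _ ∈ _
      rw [← hab]
      exact (mem_contractIdeal_extendIdeal_reesExtension hx hV hE a).1 ha
    · obtain ⟨n, q, hq, e, hv⟩ := hmem b hb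
      exact mem_extendIdeal_of_mul_pow_mem hx.ne_zero _ b
        (e := ⟨_, (mem_reesRing_iff I _).2 ⟨q, hq, rfl⟩⟩) e
        ((mem_contractIdeal_extendIdeal_reesExtension hx hV hE _).2 hv)
        (reesRing_le_laurentRing hx.mem hx.ne_zero)

end LaurentRing

/-! ### Intersections of the contracted ideals -/

section Intersections

variable {R : Type*} [CommRing R] [IsDomain R] [IsNoetherianRing R] [IsIntegrallyClosed R]
  {L : Type*} [Field L] [Algebra R L] [IsFractionRing R L] {I : Ideal R}
  {ι : Type*} {V : ι → ValuationSubring L}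

theorem extendIdeal_reesRing_eq_iInf (hI0 : I ≠ ⊥) (hI : IsNormalIdeal L I)
    (hV : ∀ j, IsDicritical I (V j)) (hV' : ∀ V', IsDicritical I V' → ∃ j, V j = V')
    (hE : ∀ j, ∀ e : reesRing L I,
      algebraMap (reesRing L I) (RatFunc L) e ∈ reesExtension (V j) I) :
    extendIdeal I (reesRing L I) =
      ⨅ j, contractIdeal (hE j) (extendIdeal I (reesExtension (V j) I)) := by
  apply le_antisymm
  · refine le_iInf fun j => extendIdeal_le_of_forall fun a ha e hae => ?_
    obtain ⟨x, hx⟩ := (hV j).exists_attainsIdealValue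
    refine (mem_contractIdeal_extendIdeal_reesExtension hx (hV j).algebraMap_mem _ _).2 ?_
    change (e : RatFunc L) / _ ∈ _
    rw [← hae]
    exact hx.div_mem_reesExtension ha
  · intro f hf
    refine mem_extendIdeal_of_forall_isDicritical hI0 hI fun V' h' => ?_
    obtain ⟨j, rfl⟩ := hV' V' h'
    obtain ⟨x, hx⟩ := (hV j).exists_attainsIdealValue
    have hfj := Ideal.mem_iInf.1 hf j
    exact ⟨x, hx, (mem_contractIdeal_extendIdeal_reesExtension hx (hV j).algebraMap_mem
      (hE j) f).1 hfj⟩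

/-- If `b ∈ B` lies in all `IW_j` with `V_j(x) = V_j(I)`, then `b Y^n ∈ IE` for large `n`, since `Y`
lies in the radical of `E ∩ IW_l` for all the other `l`. -/
theorem extendIdeal_laurentRing_eq_iInf [Fintype ι] (hI0 : I ≠ ⊥) (hI : IsNormalIdeal L I)
    (hV : ∀ j, IsDicritical I (V j)) (hV' : ∀ V', IsDicritical I V' → ∃ j, V j = V')
    {x : R} (hx : x ∈ I) (hx0 : algebraMap R L x ≠ 0) (Λ : Finset ι)
    (hΛ : ∀ j ∈ Λ, AttainsIdealValue (V j) I x)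
    (hΛ' : ∀ l, l ∉ Λ → (V l).valuation (algebraMap R L x) ≠ idealValue (V l) I)
    (hB : ∀ j : Λ, ∀ b : laurentRing (chart L I x) (chartVariable L x),
      algebraMap (laurentRing (chart L I x) (chartVariable L x)) (RatFunc L) b ∈
        reesExtension (V j) I) :
    extendIdeal I (laurentRing (chart L I x) (chartVariable L x)) =
      ⨅ j : Λ, contractIdeal (hB j) (extendIdeal I (reesExtension (V j) I)) := by
  have hxK := algebraMap_ratFunc_ne_zero (L := L) hx0
  have hmemIB : ∀ b : laurentRing (chart L I x) (chartVariable L x),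
      b ∈ extendIdeal I (laurentRing (chart L I x) (chartVariable L x)) ↔
        (b : RatFunc L) / algebraMap R (RatFunc L) x ∈
          laurentRing (chart L I x) (chartVariable L x) :=
    mem_extendIdeal_iff_div_mem I _ hx (algebraMap_mem_laurentRing_chart x) hxK
      fun _ hy => div_mem_laurentRing hy
  apply le_antisymm
  · refine le_iInf fun j => extendIdeal_le_of_forall fun a ha b hab => ?_
    have hxj := hΛ j j.2
    refine (mem_contractIdeal_extendIdeal_reesExtension hxj (hV j).algebraMap_mem _ _).2 ?_
    change (b : RatFunc L) / _ ∈ _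
    rw [← hab]
    exact hxj.div_mem_reesExtension ha
  · intro b hb
    have hEW : ∀ j, ∀ e : reesRing L I,
        algebraMap (reesRing L I) (RatFunc L) e ∈ reesExtension (V j) I :=
      fun j e => (hV j).isLocalizationAtCenter_reesRing.le e.2
    let Y : reesRing L I := ⟨_, chartVariable_mem_reesRing hx⟩
    have hYrad : ∀ l, ∃ m : ℕ, l ∉ Λ →
        Y ^ m ∈ contractIdeal (hEW l) (extendIdeal I (reesExtension (V l) I)) := by
      intro l
      by_cases hl : l ∈ Λ
      · exact ⟨0, fun h => (h hl).elim⟩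
      have hY : Y ∈ (hV l).isLocalizationAtCenter_reesRing.center := by
        obtain ⟨z, hz⟩ := (hV l).exists_attainsIdealValue
        rw [IsLocalizationAtCenter.mem_center, valuation_reesExtension_lt_one_iff]
        change ratFuncValuation _ _ (chartVariable L x) < 1
        rw [chartVariable, map_mul, ratFuncValuation_algebraMap, hz.ratFuncValuation_X,
          mul_inv_lt_iff₀ (zero_lt_iff.2 hz.valuation_ne_zero), one_mul]
        exact lt_of_le_of_ne (hz.le x hx) (hz.idealValue_eq ▸ hΛ' l hl)
      rw [← ((hV l).isPrimary_contractIdeal_reesExtension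
        (hV l).isLocalizationAtCenter_reesRing).2] at hY
      obtain ⟨m, hm⟩ := hY
      exact ⟨m, fun _ => hm⟩
    choose m hm using hYrad
    obtain ⟨n, hn⟩ := (mem_laurentRing_iff hx hx0 _).1 b.2
    let e : reesRing L I := ⟨_, hn⟩ * Y ^ (∑ l, m l)
    have he : (e : RatFunc L) = b * chartVariable L x ^ (n + ∑ l, m l) := by
      rw [pow_add, ← mul_assoc]
      rfl
    have heI : e ∈ extendIdeal I (reesRing L I) := by
      rw [extendIdeal_reesRing_eq_iInf hI0 hI hV hV' hEW]
      refine Ideal.mem_iInf.2 fun l => ?_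
      by_cases hl : l ∈ Λ
      · have hxl := hΛ l hl
        refine (mem_contractIdeal_extendIdeal_reesExtension hxl (hV l).algebraMap_mem _ _).2 ?_
        change (e : RatFunc L) / _ ∈ _
        rw [he, mul_div_right_comm, mem_reesExtension_iff_mul_pow hxl]
        have hbl := Ideal.mem_iInf.1 hb ⟨l, hl⟩
        exact (mem_contractIdeal_extendIdeal_reesExtension hxl (hV l).algebraMap_mem
          (hB ⟨l, hl⟩) b).1 hbl
      · refine Ideal.mul_mem_left _ _ (Ideal.pow_mem_of_pow_mem _ (hm l hl) ?_)
        exact Finset.single_le_sum (f := m) (fun _ _ => Nat.zero_le _) (Finset.mem_univ l)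
    have h1 := div_mem_laurentRing_of_mem_extendIdeal hx hx0 heI
    rw [hmemIB]
    have h2 := mul_mem h1
      (pow_mem (inv_mem_laurentRing (chart L I x) (chartVariable L x)) (n + ∑ l, m l))
    rwa [he, mul_div_right_comm, inv_pow,
      mul_inv_cancel_right₀ (pow_ne_zero _ (chartVariable_ne_zero hx0))] at h2

/-- This follows from the corresponding equality in `B`, since `A = B ∩ L`. -/
theorem extendIdeal_chart_eq_iInf [Fintype ι] (hI0 : I ≠ ⊥) (hI : IsNormalIdeal L I)
    (hV : ∀ j, IsDicritical I (V j)) (hV' : ∀ V', IsDicritical I V' → ∃ j, V j = V')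
    {x : R} (hx : x ∈ I) (hx0 : algebraMap R L x ≠ 0) (Λ : Finset ι)
    (hΛ : ∀ j ∈ Λ, AttainsIdealValue (V j) I x)
    (hΛ' : ∀ l, l ∉ Λ → (V l).valuation (algebraMap R L x) ≠ idealValue (V l) I)
    (hA : ∀ j : Λ, ∀ a : chart L I x, algebraMap (chart L I x) L a ∈ V j) :
    extendIdeal I (chart L I x) = ⨅ j : Λ, contractIdeal (hA j) (extendIdeal I (V j)) := by
  have hxK := algebraMap_ratFunc_ne_zero (L := L) hx0
  apply le_antisymm
  · refine le_iInf fun j => extendIdeal_le_of_forall fun y hy a hya => ?_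
    have hxj := hΛ j j.2
    refine (mem_contractIdeal_extendIdeal hxj (hV j).algebraMap_mem _ _).2 ?_
    change (a : L) / _ ∈ _
    rw [← hya]
    exact hxj.div_mem hy
  · intro a ha
    have hB : ∀ j : Λ, ∀ b : laurentRing (chart L I x) (chartVariable L x),
      algebraMap (laurentRing (chart L I x) (chartVariable L x)) (RatFunc L) b ∈
        reesExtension (V j) I := fun j b =>
      (hΛ j j.2).laurentRing_le (hV j).algebraMap_mem b.2
    have haB : (⟨_, algebraMap_chart_mem_laurentRing a⟩ :
        laurentRing (chart L I x) (chartVariable L x)) ∈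
        extendIdeal I (laurentRing (chart L I x) (chartVariable L x)) := by
      rw [extendIdeal_laurentRing_eq_iInf hI0 hI hV hV' hx hx0 Λ hΛ hΛ' hB]
      refine Ideal.mem_iInf.2 fun j => ?_
      refine (mem_contractIdeal_extendIdeal_reesExtension (hΛ j j.2) (hV j).algebraMap_mem _ _).2 ?_
      change algebraMap L (RatFunc L) (a : L) / _ ∈ _
      rw [algebraMap_div_algebraMap, algebraMap_mem_reesExtension_iff]
      have haj := Ideal.mem_iInf.1 ha j
      exact (mem_contractIdeal_extendIdeal (hΛ j j.2) (hV j).algebraMap_mem (hA j) a).1 haj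
    rw [mem_extendIdeal_iff_div_mem I _ hx (algebraMap_mem_laurentRing_chart x) hxK
      fun _ hy => div_mem_laurentRing hy] at haB
    change algebraMap L (RatFunc L) (a : L) / _ ∈ _ at haB
    rw [algebraMap_div_algebraMap] at haB
    rw [mem_extendIdeal_iff_div_mem I _ hx (algebraMap_mem_chart I x x) hx0
      fun _ hy => div_mem_chart I x hy]
    exact mem_chart_of_algebraMap_mem_laurentRing hx hx0 haB

end Intersections

end Dicritical

theorem mainTheorem4 {R L : Type*} [CommRing R] [IsDomain R] [IsNoetherianRing R]
    [IsIntegrallyClosed R] [Field L] [Algebra R L] [IsFractionRing R L]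
    (I : Ideal R) (hI_bot : I ≠ ⊥) (hI_top : I ≠ ⊤) (hI : IsNormalIdeal L I) :
    let E : Subring (RatFunc L) := reesRing L I
    -- the Rees ring, the blowup and the dicritical set
    IsNoetherianRing E ∧ IsIntegrallyClosed E ∧
    normalization (blowup L I) = blowup L I ∧
    (dicriticalSet L I I).Nonempty ∧ (dicriticalSet L I I).Finite ∧
    (∀ T ∈ dicriticalSet L I I, IsDiscreteValuationRing T.toSubring ∧
      ∃ V : ValuationSubring L, V.toLocalSubring = T) ∧
    -- `V 0, …, V (h - 1)` are the distinct members of the dicritical set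
    ∀ (h : ℕ) (V : Fin h → ValuationSubring L), Function.Injective V →
      Set.range (fun j => (V j).toLocalSubring) = dicriticalSet L I I →
    let W : Fin h → ValuationSubring (RatFunc L) := fun j => reesExtension (V j) I
    Function.Injective W ∧ (∀ j, IsDiscreteValuationRing (W j)) ∧
    ∃ (hRV : ∀ j, ∀ r : R, algebraMap R L r ∈ V j)
      (hRE : ∀ r : R, algebraMap R (RatFunc L) r ∈ E)
      (hEW : ∀ j, E ≤ (W j).toSubring),
    let IE : Ideal E := extendIdeal I E
    let Pst : Fin h → Ideal E := fun j =>
      contractIdeal (fun f : E => hEW j f.2) (maximalIdeal (W j))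
    let PstBar : Fin h → Ideal E := fun j =>
      contractIdeal (fun f : E => hEW j f.2) (extendIdeal I (W j))
    let J : Fin h → Ideal R := fun j => contractIdeal (hRV j) (extendIdeal I (V j))
    -- the second paragraph: the minimal primes and the primary decomposition of `IE`
    Function.Injective Pst ∧ Set.range Pst = IE.minimalPrimes ∧
    (∀ j, (Pst j).height = 1 ∧
      (∃ _ : (Pst j).IsPrime, LocalSubring.ofPrime E (Pst j) = (W j).toLocalSubring) ∧
      (PstBar j).IsPrimary ∧ (PstBar j).radical = Pst j) ∧
    IE = ⨅ j, PstBar j ∧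
    IsUniqueIrredundantPrimaryDecomposition IE PstBar ∧
    I = ⨅ j, J j ∧
    (∀ j, J j = contractIdeal hRE (PstBar j)) ∧
    -- the third paragraph: the affine charts
    ∀ (x : R), x ≠ 0 → x ∈ I → ∀ Λ : Finset (Fin h), Λ.Nonempty →
      (∀ j ∈ Λ, (V j).valuation (algebraMap R L x) = idealValue (V j) I) →
    let A : Subring L := chart L I x
    let B : Subring (RatFunc L) := laurentRing A (chartVariable L x)
    IsNoetherianRing A ∧ IsIntegrallyClosed A ∧
    IsNoetherianRing B ∧ IsIntegrallyClosed B ∧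
    ∃ (hAB : ∀ a : A, algebraMap A (RatFunc L) a ∈ B)
      (hEB : E ≤ B)
      (hAV : ∀ j : Λ, A ≤ (V j).toSubring)
      (hBW : ∀ j : Λ, B ≤ (W j).toSubring),
    let IA : Ideal A := extendIdeal I A
    let IB : Ideal B := extendIdeal I B
    let P : Λ → Ideal A := fun j =>
      contractIdeal (fun a : A => hAV j a.2) (maximalIdeal (V j))
    let PBar : Λ → Ideal A := fun j =>
      contractIdeal (fun a : A => hAV j a.2) (extendIdeal I (V j))
    let Q : Λ → Ideal B := fun j =>
      contractIdeal (fun b : B => hBW j b.2) (maximalIdeal (W j))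
    let QBar : Λ → Ideal B := fun j =>
      contractIdeal (fun b : B => hBW j b.2) (extendIdeal I (W j))
    (∀ j j' : Λ, j ≠ j' → P j ≠ P j' ∧ PBar j ≠ PBar j' ∧ Q j ≠ Q j' ∧ QBar j ≠ QBar j') ∧
    extendIdeal (Ideal.span {x}) A = IA ∧ extendIdeal (Ideal.span {x}) B = IB ∧
    (∀ j : Λ,
      (IA ≤ P j ∧ P j ∈ IA.minimalPrimes) ∧ (IB ≤ Q j ∧ Q j ∈ IB.minimalPrimes) ∧
      ((P j).height = 1 ∧
        (∃ _ : (P j).IsPrime, LocalSubring.ofPrime A (P j) = (V j).toLocalSubring) ∧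
        (PBar j).IsPrimary ∧ (PBar j).radical = P j) ∧
      ((Q j).height = 1 ∧
        (∃ _ : (Q j).IsPrime, LocalSubring.ofPrime B (Q j) = (W j).toLocalSubring) ∧
        (QBar j).IsPrimary ∧ (QBar j).radical = Q j) ∧
      (extendIdeal (P j) B = Q j ∧ extendIdeal (Pst j) B = Q j ∧
        P j = contractIdeal hAB (Q j) ∧
        Pst j = contractIdeal (fun f : E => hEB f.2) (Q j)) ∧
      (extendIdeal (PBar j) B = QBar j ∧ extendIdeal (PstBar j) B = QBar j ∧
        PBar j = contractIdeal hAB (QBar j) ∧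
        PstBar j = contractIdeal (fun f : E => hEB f.2) (QBar j))) ∧
    -- the case where `Λ` consists of all `j` with `V_j(x) = V_j(I)`
    ((∀ l, l ∉ Λ → (V l).valuation (algebraMap R L x) ≠ idealValue (V l) I) →
      IA = ⨅ j, PBar j ∧ IsUniqueIrredundantPrimaryDecomposition IA PBar ∧
      IB = ⨅ j, QBar j ∧ IsUniqueIrredundantPrimaryDecomposition IB QBar ∧
      IA.minimalPrimes = Set.range P ∧ IB.minimalPrimes = Set.range Q) := by
  intro E
  have hL := IsFractionRing.injective R L
  have hEnoeth : IsNoetherianRing E := isNoetherianRing_reesRing I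
  have hEnormal : IsIntegrallyClosed E := isIntegrallyClosed_reesRing hI_bot hI
  refine ⟨hEnoeth, hEnormal, normalization_blowup hI, ?_, finite_dicriticalSet hI, ?_, ?_⟩
  · obtain ⟨V, hV⟩ := exists_isDicritical hI_bot hI_top hI
    exact ⟨_, hV.toLocalSubring_mem_dicriticalSet hI⟩
  · intro T hT
    obtain ⟨V, rfl⟩ := exists_toLocalSubring_eq_of_mem_dicriticalSet hI hT
    exact ⟨(IsDicritical.of_toLocalSubring_mem hI hT).isDiscreteValuationRing, V, rfl⟩
  intro h V hVinj hVrange W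
  have hV : ∀ j, IsDicritical I (V j) := fun j =>
    .of_toLocalSubring_mem hI (hVrange ▸ Set.mem_range_self j)
  have hV' : ∀ V' : ValuationSubring L, IsDicritical I V' → ∃ j, V j = V' := by
    intro V' h'
    obtain ⟨j, hj⟩ := hVrange ▸ h'.toLocalSubring_mem_dicriticalSet hI
    exact ⟨j, ValuationSubring.toLocalSubring_injective hj⟩
  have hWdvr : ∀ j, IsDiscreteValuationRing (W j) := fun j =>
    (hV j).isDiscreteValuationRing_reesExtension
  have hVdvr : ∀ j, IsDiscreteValuationRing (V j) := fun j => (hV j).isDiscreteValuationRing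
  have hEW : ∀ j, IsLocalizationAtCenter E (W j) := fun j =>
    (hV j).isLocalizationAtCenter_reesRing
  have hRV : ∀ j, ∀ r : R, algebraMap R L r ∈ V j := fun j => (hV j).algebraMap_mem
  have hWinj : Function.Injective W := fun i j hij => hVinj (by
    rw [← comap_reesExtension (V := V i) (I := I), ← comap_reesExtension (V := V j) (I := I)]
    exact congrArg (ValuationSubring.comap · (algebraMap L (RatFunc L))) hij)
  refine ⟨hWinj, hWdvr, hRV, algebraMap_mem_reesRing I, fun j => (hEW j).le, ?_⟩
  intro IE Pst PstBar J
  have hIE : IE = ⨅ j, PstBar j :=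
    extendIdeal_reesRing_eq_iInf hI_bot hI hV hV' fun j e => (hEW j).le e.2
  have hprim : ∀ j, (PstBar j).IsPrimary ∧ (PstBar j).radical = Pst j := fun j =>
    (hV j).isPrimary_contractIdeal_reesExtension (hEW j)
  have hincomp : ∀ i j, Pst i ≤ Pst j → i = j := fun i j hle =>
    hWinj ((hEW i).eq_of_center_le (hEW j) hle)
  have hJ : ∀ j, J j = contractIdeal (algebraMap_mem_reesRing I) (PstBar j) := by
    intro j
    obtain ⟨x, hx⟩ := (hV j).exists_attainsIdealValue
    ext a
    have h1 := mem_contractIdeal_extendIdeal hx (hRV j) (hRV j) a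
    have h2 := mem_contractIdeal_extendIdeal_reesExtension hx (hRV j)
      (fun e : E => (hEW j).le e.2) ⟨_, algebraMap_mem_reesRing I a⟩
    refine h1.trans (Iff.trans ?_ h2.symm)
    change _ ↔ algebraMap R (RatFunc L) a / _ ∈ _
    rw [algebraMap_ratFunc_eq a, algebraMap_div_algebraMap, algebraMap_mem_reesExtension_iff]
  refine ⟨fun i j hij => hincomp i j hij.le, ?_, ?_, hIE, ?_, ?_, hJ, ?_⟩
  · rw [hIE]
    exact (minimalPrimes_iInf_of_radical (fun j => (hprim j).1) (fun j => (hprim j).2) hincomp).symm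
  · exact fun j => ⟨(hEW j).height_center, ⟨inferInstanceAs (hEW j).center.IsPrime,
      (hEW j).ofPrime_center⟩, hprim j⟩
  · rw [hIE]
    exact isUniqueIrredundantPrimaryDecomposition_iInf (fun j => (hprim j).1)
      (fun j => (hprim j).2) hincomp
  · ext a
    rw [← algebraMap_mem_extendIdeal_iff (L := L)]
    change _ ∈ IE ↔ _
    rw [hIE, Ideal.mem_iInf, Ideal.mem_iInf]
    exact forall_congr' fun j => by rw [hJ j]; rfl
  intro x hxne hx Λ hΛne hΛ A B
  have hx0 : algebraMap R L x ≠ 0 := (map_ne_zero_iff _ hL).2 hxne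
  have hxK : algebraMap R (RatFunc L) x ≠ 0 := algebraMap_ratFunc_ne_zero hx0
  have hatt : ∀ j ∈ Λ, AttainsIdealValue (V j) I x := by
    intro j hj
    obtain ⟨z, hz⟩ := (hV j).exists_attainsIdealValue
    exact hz.of_valuation_eq hx (hΛ j hj)
  have hAV : ∀ j : Λ, IsLocalizationAtCenter A (V j) := fun j =>
    (hV j).isLocalizationAtCenter_chart (hatt j j.2)
  have hBW : ∀ j : Λ, IsLocalizationAtCenter B (W j) := fun j =>
    (hV j).isLocalizationAtCenter_laurentRing (hatt j j.2)
  have hEB : E ≤ B := reesRing_le_laurentRing hx hx0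
  refine ⟨isNoetherianRing_chart hx hx0, isIntegrallyClosed_chart hI hx hx0,
    isNoetherianRing_laurentRing hx hx0, isIntegrallyClosed_laurentRing hI hx hx0,
    algebraMap_chart_mem_laurentRing, hEB, fun j => (hAV j).le, fun j => (hBW j).le, ?_⟩
  intro IA IB P PBar Q QBar
  have hPprim : ∀ j, (PBar j).IsPrimary ∧ (PBar j).radical = P j := fun j =>
    (hV j).isPrimary_contractIdeal (hAV j)
  have hQprim : ∀ j, (QBar j).IsPrimary ∧ (QBar j).radical = Q j := fun j =>
    (hV j).isPrimary_contractIdeal_reesExtension (hBW j)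
  have hPincomp : ∀ i j : Λ, P i ≤ P j → i = j := fun i j hle =>
    Subtype.ext (hVinj ((hAV i).eq_of_center_le (hAV j) hle))
  have hQincomp : ∀ i j : Λ, Q i ≤ Q j → i = j := fun i j hle =>
    Subtype.ext (hWinj ((hBW i).eq_of_center_le (hBW j) hle))
  have hIAP : ∀ j, IA ≤ P j := fun j => extendIdeal_le_of_forall fun y hy a hya =>
    ((hAV j).mem_center a).2 (by rw [← hya]; exact (hV j).valuation_lt_one y hy)
  have hIBQ : ∀ j, IB ≤ Q j := fun j => extendIdeal_le_of_forall fun y hy b hyb =>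
    ((hBW j).mem_center b).2 (by rw [← hyb]; exact (hV j).reesExtension_valuation_lt_one hy)
  have hIA0 : IA ≠ ⊥ := extendIdeal_ne_bot (algebraMap_mem_chart I x) hx hx0
  have hIB0 : IB ≠ ⊥ := extendIdeal_ne_bot algebraMap_mem_laurentRing_chart hx hxK
  refine ⟨fun j j' hne => ⟨fun e => hne (hPincomp j j' e.le), fun e => hne (hPincomp j j' ?_),
    fun e => hne (hQincomp j j' e.le), fun e => hne (hQincomp j j' ?_)⟩,
    extendIdeal_span_singleton (algebraMap_mem_chart I x) hx hx0 fun y hy => div_mem_chart I x hy,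
    extendIdeal_span_singleton algebraMap_mem_laurentRing_chart hx hxK
      fun y hy => div_mem_laurentRing hy, fun j => ⟨⟨hIAP j, ?_⟩, ⟨hIBQ j, ?_⟩, ?_, ?_, ?_, ?_⟩, ?_⟩
  · rw [← (hPprim j).2, ← (hPprim j').2, e]
  · rw [← (hQprim j).2, ← (hQprim j').2, e]
  · exact (hAV j).center_mem_minimalPrimes (hIAP j) hIA0
  · exact (hBW j).center_mem_minimalPrimes (hIBQ j) hIB0
  · exact ⟨(hAV j).height_center, ⟨inferInstanceAs (hAV j).center.IsPrime,
      (hAV j).ofPrime_center⟩, hPprim j⟩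
  · exact ⟨(hBW j).height_center, ⟨inferInstanceAs (hBW j).center.IsPrime,
      (hBW j).ofPrime_center⟩, hQprim j⟩
  · obtain ⟨h1, h2⟩ := extendIdeal_center_eq (hatt j j.2) (fun a => (hAV j).le a.2)
      (fun e => (hEW j).le e.2) (fun b => (hBW j).le b.2)
    refine ⟨h1, h2, ?_, rfl⟩
    ext a
    have h3 := (hAV j).mem_center a
    have h4 := (hBW j).mem_center ⟨_, algebraMap_chart_mem_laurentRing a⟩
    exact h3.trans ((valuation_reesExtension_algebraMap_lt_one_iff _).symm.trans h4.symm)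
  · obtain ⟨h1, h2⟩ := extendIdeal_contractIdeal_eq (hatt j j.2) (hRV j) (fun a => (hAV j).le a.2)
      (fun e => (hEW j).le e.2) (fun b => (hBW j).le b.2)
    refine ⟨h1, h2, ?_, rfl⟩
    ext a
    have h3 := mem_contractIdeal_extendIdeal (hatt j j.2) (hRV j)
      (fun a : A => (hAV j).le a.2) a
    have h4 := mem_contractIdeal_extendIdeal_reesExtension (hatt j j.2) (hRV j)
      (fun b : B => (hBW j).le b.2) ⟨_, algebraMap_chart_mem_laurentRing a⟩
    refine h3.trans (Iff.trans ?_ h4.symm)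
    change _ ↔ algebraMap L (RatFunc L) (a : L) / _ ∈ _
    rw [algebraMap_div_algebraMap, algebraMap_mem_reesExtension_iff]
    rfl
  · intro hΛ'
    have hIA : IA = ⨅ j, PBar j :=
      extendIdeal_chart_eq_iInf hI_bot hI hV hV' hx hx0 Λ hatt hΛ' fun j a => (hAV j).le a.2
    have hIB : IB = ⨅ j, QBar j :=
      extendIdeal_laurentRing_eq_iInf hI_bot hI hV hV' hx hx0 Λ hatt hΛ' fun j b => (hBW j).le b.2
    refine ⟨hIA, ?_, hIB, ?_, ?_, ?_⟩
    · rw [hIA]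
      exact isUniqueIrredundantPrimaryDecomposition_iInf (fun j => (hPprim j).1)
        (fun j => (hPprim j).2) hPincomp
    · rw [hIB]
      exact isUniqueIrredundantPrimaryDecomposition_iInf (fun j => (hQprim j).1)
        (fun j => (hQprim j).2) hQincomp
    · rw [hIA]
      exact minimalPrimes_iInf_of_radical (fun j => (hPprim j).1) (fun j => (hPprim j).2) hPincomp
    · rw [hIB]
      exact minimalPrimes_iInf_of_radical (fun j => (hQprim j).1) (fun j => (hQprim j).2) hQincomp
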